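/- **Setting.** Let $W_1,W_2,\dots$ be i.i.d. with law $F_0$; $Y$ and $Z_1,\dots,Z_J$ ($J\ge 1$) are components of $W$. Let $\Theta\subseteq\mathbb R^{p}$, let $\mathbf B$ be a real Hilbert space, and let $\Xi\subseteq\mathbf B$ be contained in a linear subspace $\mathbf E$ of $\mathbf B$ that carries a norm $\|\cdot\|_\Xi$. The residual functions $m_j(y,\theta,\eta)\in\mathbb R$ ($\theta\in\mathbb R^p$, $\eta\in\mathbf B$) are such that $m_j(Y,\theta_0,\eta)$ has a finite second moment for every $\eta\in\mathbf B$, and $\mathbb E[m_j(Y,\theta_0,\eta_0)\mid Z_j]=0$ a.s., $j=1,\dots,J$, where $\theta_0\in\Theta$, $\eta_0\in\Xi$. Write $\|a\|_2=(\mathbb E[a(Z_j)^2])^{1/2}$, $h_j(\cdot,\theta_0,\eta)=\mathbb E[m_j(Y,\theta_0,\eta)\mid Z_j=\cdot\,]\in L^2(Z_j)$, and $L^2(Z)=\bigoplus_{j}L^2(Z_j)$ with $\langle f,g\rangle=\sum_j\mathbb E[f_j(Z_j)g_j(Z_j)]$. With $S^{(j)}:\mathbf B\to L^2(Z_j)$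 the Fréchet derivative of $h_j(\cdot,\theta_0,\cdot)$ at $\eta_0$, put $S=(S^{(1)},\dots,S^{(J)})$, and let $S^*$ be its adjoint. Given $f_1,\dots,f_q\in L^2(Z)$, let $f_a^*$ be the orthogonal projection of $f_a$ on the closure of the range of $S$, and $\kappa_{0,a}=f_a-f^*_a$. Let $\kappa_{0j}(Z_j)\in\mathbb R^q$ collect the $j$-th components of $\kappa_{0,1},\dots,\kappa_{0,q}$. Put $\psi(W,\theta,\eta,\kappa)=\sum_{j}m_j(Y,\theta,\eta)\kappa_j(Z_j)\in\mathbb R^q$ and $\bar\psi(\theta,\eta,\kappa)=\mathbb E[\psi(W,\theta,\eta,\kappa)]$. **Estimators.** Fix $L\ge2$. For each $n$, $\{1,\dots,n\}$ is partitioned into folds $I_1,\dots,I_L$ of the same size (up to one observation if $L\nmid n$); $n_\ell=\#I_\ell$. All estimators with index $\ell$ are (jointly measurable) functions of $(W_i)_{i\notin I_\ell}$. Given a dictionary $\gamma_{jk}\in L^2(Z_j)$, $k\le r_j$ (possibly depending on $n$), $r=\sum_jr_j$, let $\gamma_1,\dots,\gamma_r\in L^2(Z)$ be its elements, each placed in its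 own coordinate $j$, let $M_{jk}=S^{(j)}S^*\gamma_k\in L^2(Z_j)$, $k\le r$, and let $\hat M_{j\ell k}$ be estimators of $M_{jk}$. For each $a\le q$, $\hat\beta_{\ell,a}\in\mathbb R^r$ is a minimiser over $\beta\in\mathbb R^r$ of $$\sum_{j}\frac1{n-n_\ell}\sum_{i\notin I_\ell}\big(f_{a,j}(Z_{ji})-\hat M_{j\ell}(Z_{ji})'\beta\big)^2+2\lambda_n\|\beta\|_1,\qquad \lambda_n\ge0,$$ and $\hat\kappa_{j\ell}(z)\in\mathbb R^q$ has the entries $f_{a,j}(z)-\hat M_{j\ell}(z)'\hat\beta_{\ell,a}$. With estimators $\hat\eta_\ell$ of $\eta_0$ let $\hat\psi(\theta)=\frac1n\sum_{\ell}\sum_{i\in I_\ell}\psi(W_i,\theta,\hat\eta_\ell,\hat\kappa_\ell)$. Below, integrals with respect to $F_0(dw)$, and statements about the law of $Z_j$, hold the estimators fixed; "wpa1" means with probability approaching one; every condition is for all $j,\ell$. **Assumptions.** 1. $h_j(\cdot,\theta_0,\cdot):\mathbf B\to L^2(Z_j)$ is Fréchet differentiable in a neighbourhood of $\eta_0$,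 and its restriction to $(\mathbf E,\|\cdot\|_\Xi)$ is Fréchet differentiable at $\eta_0$ (automatic if $\|\cdot\|_{\mathbf B}\le C\|\cdot\|_\Xi$). 2. $\mathbb E\|\psi(W,\theta_0,\eta_0,\kappa_0)\|^2<\infty$, and the following tend to $0$ in probability: $\int|m_j(y,\theta_0,\hat\eta_\ell)-m_j(y,\theta_0,\eta_0)|^2F_0(dw)$, $\int|m_j(y,\theta_0,\hat\eta_\ell)-m_j(y,\theta_0,\eta_0)|^2\|\kappa_{0j}(z_j)\|^2F_0(dw)$, and $\int|m_j(y,\theta_0,\eta_0)|^2\|\hat\kappa_{j\ell}(z_j)-\kappa_{0j}(z_j)\|^2F_0(dw)$. 3. Wpa1: $\hat M_{j\ell}(Z_j)'\hat\beta_{\ell,a}\in L^2(Z_j)$ for all $a$, $\hat\kappa_{j\ell}(Z_j)$ is a.s. bounded, and $\hat\eta_\ell\in\Xi$. 4. $\|\hat\eta_\ell-\eta_0\|_\Xi=O_p(n^{-d_\eta})$ with $1/4<d_\eta<1/2$. For constants $0<d_j<1/2$ with $d=\min_jd_j\in(1/4,1/2)$, $\xi>0$ and $c>0$, $$\frac{2\xi(d-c)+d_\eta(2\xi+1)}{2\xi+1}>\frac12$$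 (for all small $c>0$ this follows from the inequality with $c=0$). 5. $\eta\mapsto\bar\psi(\theta_0,\eta,\kappa_0)$ is twice continuously Fréchet differentiable in a neighbourhood of $\eta_0$ with respect to $\|\cdot\|_\Xi$. 6. There are constants $c_j,C_j$ such that, wpa1, $\max_{k\le r}|\hat M_{j\ell k}(Z_j)|\le c_j$ a.s. and, for all $k\le r$, $\|\hat M_{j\ell k}-M_{jk}\|_2\le C_jn^{-d_j}$ as well as $\frac1{n-n_\ell}\sum_{i\notin I_\ell}(\hat M_{j\ell k}(Z_{ji})-M_{jk}(Z_{ji}))^2\le (C_jn^{-d_j})^2$. Moreover $r\le C_1n^{c_2}$ for some $C_1>0$, $c_2>1$. 7. (Lasso step.) Let $\varepsilon_n=\max_j\max\{\sqrt{\log r/n},\,n^{c-d_j},\,n^{-d_j}\}$ and $G=\sum_j\mathbb E[M_j(Z_j)M_j(Z_j)']$. The following hold for all large $n$ with constants not depending on $n$. (a) $\max_{k\le r}|M_{jk}(Z_j)|\le c_j'$ a.s. (b) For some $C>1$ and each $a$ there is $\bar\beta_a\in\mathbb R^r$ with $s_a$ nonzero entries, $s_a\le C\varepsilon_n^{-2/(2\xi+1)}$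 and $\sum_j\mathbb E[(f^*_{a,j}(Z_j)-M_j(Z_j)'\bar\beta_a)^2]\le Cs_a\varepsilon_n^2$. (c) The largest eigenvalue of $G$ is bounded in $n$, and there are $C,c''>0$ such that $\delta'G\delta>c''\|\delta_A\|^2$ whenever $A\subseteq\{1,\dots,r\}$, $\#A\le C\varepsilon_n^{-2}$, $\delta\ne0$ and $\|\delta_{A^c}\|_1\le3\|\delta_A\|_1$. (d) $\varepsilon_n=o(\lambda_n)$, and $\lambda_n=o(n^{c'}\varepsilon_n)$ for every $c'>0$. (e) With $\beta_{0,a}$ a slope of the linear projection of $f^*_a$ on $M=(M_1,\dots,M_J)$, that is $\sum_j\mathbb E[M_j(Z_j)(f_{a,j}^*(Z_j)-M_j(Z_j)'\beta_{0,a})]=0$, some minimiser over $v\in\mathbb R^r$ of $(\beta_{0,a}-v)'G(\beta_{0,a}-v)+2\varepsilon_n\sum_{k:\bar\beta_{a,k}=0}|v_k|$ is bounded in $\ell_1$-norm uniformly in $n$, for each $a$. **Conclusion.** Without any Donsker condition, the cross-fitted debiased sample moment is asymptotically linear: $$\sqrt n\,\hat\psi(\theta_0)=\frac1{\sqrt n}\sum_{i=1}^n\psi(W_i,\theta_0,\eta_0,\kappa_0)+o_p(1).$$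 -/

import Mathlib

open MeasureTheory ProbabilityTheory Filter Topology
open scoped ENNReal

noncomputable section

/-! ### Conditional expectation of a square-integrable variable as a function of the conditioner -/

/-- For `g ∈ L²(μ)`, the element `x ↦ E[g | X = x]` of `L²(law of X)`: the adjoint of
`u ↦ u ∘ X`. See `condL2_comp_ae_eq` for the identification with `μ[g | σ(X)]`. -/
def condL2 {α β : Type*} [MeasurableSpace α] [MeasurableSpace β] (μ : Measure α) (X : α → β)
    (hX : Measurable X) : Lp ℝ 2 μ →L[ℝ] Lp ℝ 2 (μ.map X) :=
  ContinuousLinearMap.adjoint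
    (Lp.compMeasurePreservingₗᵢ ℝ X (⟨hX, rfl⟩ : MeasurePreserving X μ (μ.map X))
      ).toContinuousLinearMap

theorem condL2_comp_ae_eq {α β : Type*} [MeasurableSpace α] [MeasurableSpace β] (μ : Measure α)
    [IsProbabilityMeasure μ] (X : α → β) (hX : Measurable X) (g : Lp ℝ 2 μ) :
    (fun a => condL2 μ X hX g (X a)) =ᵐ[μ]
      μ[(g : α → ℝ) | MeasurableSpace.comap X inferInstance] := by
  have hmp : MeasurePreserving X μ (μ.map X) := ⟨hX, rfl⟩
  have hprob : IsProbabilityMeasure (μ.map X) := Measure.isProbabilityMeasure_map hX.aemeasurable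
  have hint : Integrable (g : α → ℝ) μ := (Lp.memLp g).integrable (by norm_num)
  have hint2 : Integrable (condL2 μ X hX g : β → ℝ) (μ.map X) :=
    (Lp.memLp (condL2 μ X hX g)).integrable (by norm_num)
  have hint3 : Integrable (fun a => condL2 μ X hX g (X a)) μ :=
    (hmp.integrable_comp hint2.aestronglyMeasurable).2 hint2
  refine ae_eq_condExp_of_forall_setIntegral_eq hX.comap_le hint
    (fun s _ _ => hint3.integrableOn) ?_ ?_
  · rintro s ⟨t, ht, rfl⟩ -
    have h1 : ∫ a in X ⁻¹' t, condL2 μ X hX g (X a) ∂μ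
        = ∫ b in t, condL2 μ X hX g b ∂(μ.map X) :=
      (setIntegral_map ht hint2.aestronglyMeasurable hX.aemeasurable).symm
    have h2 := L2.inner_indicatorConstLp_one (𝕜 := ℝ) ht (measure_ne_top (μ.map X) t)
      (condL2 μ X hX g)
    have h3 := L2.inner_indicatorConstLp_one (𝕜 := ℝ) (hX ht) (measure_ne_top μ (X ⁻¹' t)) g
    rw [h1, ← h2, ← h3, condL2, ContinuousLinearMap.adjoint_inner_right]
    congr 1
  · have h := Lp.stronglyMeasurable (condL2 μ X hX g)
    exact (h.comp_measurable (comap_measurable X)).aestronglyMeasurable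

/-! ### Stochastic order symbols (outer measure is used, so events need not be measurable) -/

/-- "With probability approaching one". -/
def Wpa1 {Ω : Type*} [MeasurableSpace Ω] (P : Measure Ω) (A : ℕ → Ω → Prop) : Prop :=
  Tendsto (fun n => P {ω | ¬ A n ω}) atTop (𝓝 0)

/-- `X n = O_p(a n)` for real `X n`. -/
def IsBigOInProb {Ω : Type*} [MeasurableSpace Ω] (P : Measure Ω) (X : ℕ → Ω → ℝ) (a : ℕ → ℝ) :
    Prop :=
  ∀ δ : ℝ≥0∞, 0 < δ → ∃ C : ℝ, ∀ᶠ n in atTop, P {ω | C * a n < |X n ω|} ≤ δ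

/-! ### The model -/

/-- A system of `J` conditional moment restrictions `E[m_j(Y, θ₀, η₀) | Z_j] = 0`.
`F₀` is the law of one observation `w`; `Y w`, `Z j w` are its components. `B` is the Hilbert space
on which the residual functions are defined; `E` (through the injection `ι`) is the linear subspace
of `B` on which the norm `‖·‖_Ξ` lives, and `Ξ ⊆ E` is the nuisance parameter set. -/
structure CMRModel (𝒲 𝒴 B E : Type*) [MeasurableSpace 𝒲] [MeasurableSpace 𝒴]
    [NormedAddCommGroup B] [InnerProductSpace ℝ B] [CompleteSpace B]
    [NormedAddCommGroup E] [NormedSpace ℝ E]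
    {J : ℕ} (𝒵 : Fin J → Type*) [∀ j, MeasurableSpace (𝒵 j)] (p : ℕ) where
  F₀ : Measure 𝒲
  isProb : IsProbabilityMeasure F₀
  Y : 𝒲 → 𝒴
  measurable_Y : Measurable Y
  Z : ∀ j, 𝒲 → 𝒵 j
  measurable_Z : ∀ j, Measurable (Z j)
  Θ : Set (EuclideanSpace ℝ (Fin p))
  θ₀ : EuclideanSpace ℝ (Fin p)
  θ₀_mem : θ₀ ∈ Θ
  ι : E →ₗ[ℝ] B
  ι_injective : Function.Injective ι
  Ξ : Set E
  η₀ : E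
  η₀_mem : η₀ ∈ Ξ
  m : Fin J → 𝒴 → EuclideanSpace ℝ (Fin p) → B → ℝ
  memLp_m : ∀ j η, MemLp (fun w => m j (Y w) θ₀ η) 2 F₀
  cmr : ∀ j, F₀[fun w => m j (Y w) θ₀ (ι η₀) | MeasurableSpace.comap (Z j) inferInstance]
    =ᵐ[F₀] 0

namespace CMRModel

variable {𝒲 𝒴 B E : Type*} [MeasurableSpace 𝒲] [MeasurableSpace 𝒴]
  [NormedAddCommGroup B] [InnerProductSpace ℝ B] [CompleteSpace B]
  [NormedAddCommGroup E] [NormedSpace ℝ E]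
  {J : ℕ} {𝒵 : Fin J → Type*} [∀ j, MeasurableSpace (𝒵 j)] {p : ℕ}
  (D : CMRModel 𝒲 𝒴 B E 𝒵 p)

/-- The law of `Z_j`. -/
def law (j : Fin J) : Measure (𝒵 j) := D.F₀.map (D.Z j)

/-- `L²(Z) = ⨁_j L²(Z_j)` with `⟨f, g⟩ = ∑_j E[f_j(Z_j) g_j(Z_j)]`. -/
abbrev L2Z : Type _ := PiLp 2 (fun j => Lp ℝ 2 (D.law j))

/-- `h_j(·, θ₀, η) = E[m_j(Y, θ₀, η) | Z_j = ·]`, an element of `L²(Z_j)`. -/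
def h (j : Fin J) (η : B) : Lp ℝ 2 (D.law j) :=
  condL2 D.F₀ (D.Z j) (D.measurable_Z j) ((D.memLp_m j η).toLp)

/-- The derivative operator `S^{(j)} : B → L²(Z_j)` of `h_j(·, θ₀, ·)` at `η₀`. -/
def Sj (j : Fin J) : B →L[ℝ] Lp ℝ 2 (D.law j) := fderiv ℝ (D.h j) (D.ι D.η₀)

/-- `S b = (S^{(1)} b, …, S^{(J)} b)`. -/
def S : B →L[ℝ] D.L2Z :=
  ((PiLp.continuousLinearEquiv 2 ℝ (fun j => Lp ℝ 2 (D.law j))).symm :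
    (∀ j, Lp ℝ 2 (D.law j)) →L[ℝ] D.L2Z).comp (ContinuousLinearMap.pi D.Sj)

/-- Closure of the range of `S`. -/
def rangeClosure : Submodule ℝ D.L2Z := (LinearMap.range (D.S : B →ₗ[ℝ] D.L2Z)).topologicalClosure

instance : CompleteSpace D.rangeClosure :=
  inferInstanceAs (CompleteSpace (LinearMap.range (D.S : B →ₗ[ℝ] D.L2Z)).topologicalClosure)

/-- `f* = Π f`, the orthogonal projection on the closure of the range of `S`. -/
def fStar (f : D.L2Z) : D.L2Z := D.rangeClosure.starProjection f

/-- The orthogonal instrument `κ₀ = f - f*` generated by `f`. -/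
def kappa₀ (f : D.L2Z) : D.L2Z := f - D.fStar f

/-- The population regressor `S S* g`. -/
def regressor (g : D.L2Z) : D.L2Z := D.S (ContinuousLinearMap.adjoint D.S g)

/-- `ψ(w, θ, η, κ) = ∑_j m_j(y, θ, η) κ_j(z_j)`, with `κ_j` valued in `ℝ^q`. -/
def psi {q : ℕ} (θ : EuclideanSpace ℝ (Fin p)) (η : B)
    (κ : ∀ j, 𝒵 j → EuclideanSpace ℝ (Fin q)) (w : 𝒲) : EuclideanSpace ℝ (Fin q) :=
  ∑ j, D.m j (D.Y w) θ η • κ j (D.Z j w)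

/-- `ψ̄(θ, η, κ) = E[ψ(W, θ, η, κ)]`. -/
def psiBar {q : ℕ} (θ : EuclideanSpace ℝ (Fin p)) (η : B)
    (κ : ∀ j, 𝒵 j → EuclideanSpace ℝ (Fin q)) : EuclideanSpace ℝ (Fin q) :=
  ∫ w, D.psi θ η κ w ∂D.F₀

/-- Fréchet differentiability of the conditional moments: each `h_j(·, θ₀, ·) : B → L²(Z_j)` is
Fréchet differentiable in a neighbourhood of `η₀`, and it is Fréchet differentiable at `η₀` also
with respect to `‖·‖_Ξ`. The second clause follows from the first one if `‖·‖_B ≤ C ‖·‖_Ξ`. -/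
def FrechetCMR : Prop :=
  ∀ j, (∀ᶠ η in 𝓝 (D.ι D.η₀), DifferentiableAt ℝ (D.h j) η) ∧
    DifferentiableAt ℝ (fun e : E => D.h j (D.ι e)) D.η₀

end CMRModel

/-! ### Initial instruments, dictionary, folds and tuning parameters -/

/-- Choices of the researcher: `q` initial instruments `f_a ∈ L²(Z)`, a dictionary
`γ_{jk} ∈ L²(Z_j)`, `k < r_j(n)`, the folds `I_ℓ = {i : fold n i = ℓ}` (of the same size, up to one
observation when `L ∤ n`), and the Lasso penalty `λ_n`. -/
structure Design {𝒲 𝒴 B E : Type*} [MeasurableSpace 𝒲] [MeasurableSpace 𝒴]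
    [NormedAddCommGroup B] [InnerProductSpace ℝ B] [CompleteSpace B]
    [NormedAddCommGroup E] [NormedSpace ℝ E]
    {J : ℕ} {𝒵 : Fin J → Type*} [∀ j, MeasurableSpace (𝒵 j)] {p : ℕ}
    (D : CMRModel 𝒲 𝒴 B E 𝒵 p) (q L : ℕ) where
  f : Fin q → ∀ j, 𝒵 j → ℝ
  memLp_f : ∀ a j, MemLp (f a j) 2 (D.law j)
  r : ℕ → Fin J → ℕ
  γ : ∀ (n : ℕ) (j : Fin J), Fin (r n j) → 𝒵 j → ℝ
  memLp_γ : ∀ n j k, MemLp (γ n j k) 2 (D.law j)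
  two_le_L : 2 ≤ L
  fold : ∀ n : ℕ, Fin n → Fin L
  balanced : ∀ n ℓ ℓ', (Finset.univ.filter (fun i => fold n i = ℓ)).card
    ≤ (Finset.univ.filter (fun i => fold n i = ℓ')).card + 1
  lam : ℕ → ℝ
  lam_nonneg : ∀ n, 0 ≤ lam n

namespace Design

variable {𝒲 𝒴 B E : Type*} [MeasurableSpace 𝒲] [MeasurableSpace 𝒴]
  [NormedAddCommGroup B] [InnerProductSpace ℝ B] [CompleteSpace B]
  [NormedAddCommGroup E] [NormedSpace ℝ E]
  {J : ℕ} {𝒵 : Fin J → Type*} [∀ j, MeasurableSpace (𝒵 j)] {p : ℕ}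
  {D : CMRModel 𝒲 𝒴 B E 𝒵 p} {q L : ℕ} (C : Design D q L)

/-- Index set of the dictionary, the pairs `(j', k)`. -/
abbrev Idx (n : ℕ) : Type := Σ j : Fin J, Fin (C.r n j)

/-- Total dictionary size `r = ∑_j r_j`. -/
def rTot (n : ℕ) : ℕ := ∑ j, C.r n j

/-- Indices of the observations outside fold `ℓ`. -/
abbrev Out (n : ℕ) (ℓ : Fin L) : Type := {i : Fin n // C.fold n i ≠ ℓ}

/-- Data sets consisting of the observations outside fold `ℓ`. -/
abbrev Train (n : ℕ) (ℓ : Fin L) : Type _ := C.Out n ℓ → 𝒲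

/-- The observations outside fold `ℓ`, at the sample point `ω`. -/
def train {Ω : Type*} (W : ℕ → Ω → 𝒲) (n : ℕ) (ℓ : Fin L) (ω : Ω) : C.Train n ℓ :=
  fun i => W i.1.1 ω

/-- `f_a` as an element of `L²(Z)`. -/
def fL (a : Fin q) : D.L2Z := WithLp.toLp 2 (fun j => (C.memLp_f a j).toLp)

/-- The dictionary element `(j', k)` as an element of `L²(Z)`: `γ_{j'k}` in coordinate `j'`. -/
def γL (n : ℕ) (k : C.Idx n) : D.L2Z := PiLp.single 2 k.1 ((C.memLp_γ n k.1 k.2).toLp)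

/-- `f*_a`. -/
def fStar (a : Fin q) : D.L2Z := D.fStar (C.fL a)

/-- The `q`-vector valued `κ_{0j}`, collecting the `j`-th components of the `q` instruments. -/
def kappa₀ (j : Fin J) (z : 𝒵 j) : EuclideanSpace ℝ (Fin q) :=
  WithLp.toLp 2 (fun a => D.kappa₀ (C.fL a) j z)

/-- Population regressors `M_{jk} = [S^{(j)} S* γ_k](Z_j)`. -/
def M (n : ℕ) (j : Fin J) (k : C.Idx n) : Lp ℝ 2 (D.law j) := D.regressor (C.γL n k) j

/-- `∑_j G_j`, with `G_j = E[M_j(Z_j) M_j(Z_j)']`. -/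
def G (n : ℕ) : Matrix (C.Idx n) (C.Idx n) ℝ :=
  ∑ j, Matrix.of fun k l => ∫ z, C.M n j k z * C.M n j l z ∂(D.law j)

/-- `ε^G_{jn} = max {√(log r / n), n^c n^{-d_j}}`. -/
def epsG (c : ℝ) (d : Fin J → ℝ) (n : ℕ) (j : Fin J) : ℝ :=
  max (√(Real.log (C.rTot n) / n)) ((n : ℝ) ^ c * (n : ℝ) ^ (-d j))

/-- `ε_n = max_j {ε^G_{jn}, ε^F_{jn}}` with `ε^F_{jn} = n^{-d_j}`. -/
def eps (c : ℝ) (d : Fin J → ℝ) (n : ℕ) : ℝ :=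
  ⨆ j, max (C.epsG c d n j) ((n : ℝ) ^ (-d j))

/-- Approximate sparsity of `f*_a`: `∑_j E[(f*_j - M_j'β̄)²] ≤ C s ε_n²`,
`s = #{β̄ ≠ 0} ≤ C ε_n^{-2/(2ξ+1)}`. -/
def ApproxSparse (ε : ℕ → ℝ) (ξ : ℝ) (βbar : ∀ n, Fin q → C.Idx n → ℝ) : Prop :=
  ∃ K : ℝ, 1 < K ∧ ∀ᶠ n in atTop, ∀ a,
    (∑ j, ∫ z, (C.fStar a j z - ∑ k, C.M n j k z * βbar n a k) ^ 2 ∂(D.law j)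
      ≤ K * (Finset.univ.filter fun k => βbar n a k ≠ 0).card * ε n ^ 2) ∧
    ((Finset.univ.filter fun k => βbar n a k ≠ 0).card : ℝ) ≤ K * ε n ^ (-2 / (2 * ξ + 1))

/-- The largest eigenvalue of `∑_j G_j` is bounded in `n`, and `∑_j G_j` has restricted eigenvalues
bounded away from zero over supports of size at most a multiple of `ε_n^{-2}`. -/
def SparseEigen (ε : ℕ → ℝ) : Prop :=
  (∃ K : ℝ, ∀ᶠ n in atTop, ∀ μ : ℝ,
    Module.End.HasEigenvalue (Matrix.toLin' (C.G n)) μ → μ ≤ K) ∧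
  ∃ K : ℝ, 0 < K ∧ ∃ c : ℝ, 0 < c ∧ ∀ᶠ n in atTop,
    ∀ (A : Finset (C.Idx n)) (δ : C.Idx n → ℝ), δ ≠ 0 → (A.card : ℝ) ≤ K * ε n ^ (-2 : ℝ) →
      ∑ k ∈ Aᶜ, |δ k| ≤ 3 * ∑ k ∈ A, |δ k| →
      c < (δ ⬝ᵥ (C.G n).mulVec δ) / ∑ k ∈ A, δ k ^ 2

/-- `b` is the slope of the linear projection of `f*_a` on `(M_1, …, M_J)`. -/
def IsProjSlope (n : ℕ) (a : Fin q) (b : C.Idx n → ℝ) : Prop :=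
  ∀ k, ∑ j, ∫ z, C.M n j k z * (C.fStar a j z - ∑ l, C.M n j l z * b l) ∂(D.law j) = 0

/-- The `ℓ₁`-boundedness condition: a minimiser `β_*` of
`(β₀ - v)' ∑_j G_j (β₀ - v) + 2 ε_n ∑_{k : β̄_k = 0} |v_k|` is bounded in `ℓ₁`-norm,
uniformly in `n`. -/
def BetaStarBounded (ε : ℕ → ℝ) (βbar : ∀ n, Fin q → C.Idx n → ℝ) : Prop :=
  ∃ K : ℝ, ∀ᶠ n in atTop, ∀ a, ∃ β₀ βs : C.Idx n → ℝ, C.IsProjSlope n a β₀ ∧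
    IsMinOn (fun v : C.Idx n → ℝ => (β₀ - v) ⬝ᵥ (C.G n).mulVec (β₀ - v)
      + 2 * ε n * ∑ k ∈ Finset.univ.filter (fun k => βbar n a k = 0), |v k|) Set.univ βs ∧
    ∑ k, |βs k| ≤ K

/-- `max_k |M_{jk}(Z_j)| ≤ c_j` almost surely, with `c_j` free of `n`. -/
def BoundedM : Prop :=
  ∃ c : Fin J → ℝ, ∀ᶠ n in atTop, ∀ j, ∀ᵐ z ∂(D.law j), ∀ k, |C.M n j k z| ≤ c j

/-- `ε_n = o(λ_n)` and `λ_n = o(n^c ε_n)` for every `c > 0`. -/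
def PenaltyRate (ε : ℕ → ℝ) : Prop :=
  (ε =o[atTop] C.lam) ∧ ∀ c : ℝ, 0 < c → C.lam =o[atTop] fun n : ℕ => (n : ℝ) ^ c * ε n

/-- `r ≤ C₁ n^{c₂}` with `C₁ > 0`, `c₂ > 1`. -/
def DictionaryGrowth : Prop :=
  ∃ C₁ : ℝ, 0 < C₁ ∧ ∃ c₂ : ℝ, 1 < c₂ ∧ ∀ᶠ n : ℕ in atTop, (C.rTot n : ℝ) ≤ C₁ * (n : ℝ) ^ c₂

end Design

/-! ### The cross-fitted estimators -/

/-- Estimators computed, for each fold `ℓ`, from the observations outside `I_ℓ`: `η̂_ℓ`, the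
estimated regressors `M̂_{jℓk}`, and the Lasso coefficients `β̂_ℓ` (one vector for each of the `q`
initial instruments) obtained by regressing on the estimated regressors. -/
structure Estimators {𝒲 𝒴 B E : Type*} [MeasurableSpace 𝒲] [MeasurableSpace 𝒴]
    [NormedAddCommGroup B] [InnerProductSpace ℝ B] [CompleteSpace B]
    [NormedAddCommGroup E] [NormedSpace ℝ E]
    {J : ℕ} {𝒵 : Fin J → Type*} [∀ j, MeasurableSpace (𝒵 j)] {p : ℕ}
    {D : CMRModel 𝒲 𝒴 B E 𝒵 p} {q L : ℕ} (C : Design D q L) where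
  ηhat : ∀ (n : ℕ) (ℓ : Fin L), C.Train n ℓ → E
  measurable_ηhat : ∀ n ℓ j, Measurable fun x : C.Train n ℓ × 𝒲 =>
    D.m j (D.Y x.2) D.θ₀ (D.ι (ηhat n ℓ x.1))
  Mhat : ∀ (n : ℕ) (ℓ : Fin L) (j : Fin J), C.Idx n → C.Train n ℓ → 𝒵 j → ℝ
  measurable_Mhat : ∀ n ℓ j k, Measurable fun x : C.Train n ℓ × 𝒵 j => Mhat n ℓ j k x.1 x.2
  βhat : ∀ (n : ℕ) (ℓ : Fin L), Fin q → C.Train n ℓ → C.Idx n → ℝ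
  measurable_βhat : ∀ n ℓ a, Measurable (βhat n ℓ a)
  lasso : ∀ n ℓ a (t : C.Train n ℓ), IsMinOn (fun β : C.Idx n → ℝ =>
    ∑ j, (Fintype.card (C.Out n ℓ) : ℝ)⁻¹ * ∑ i : C.Out n ℓ,
      (C.f a j (D.Z j (t i)) - ∑ k, Mhat n ℓ j k t (D.Z j (t i)) * β k) ^ 2
    + 2 * C.lam n * ∑ k, |β k|) Set.univ (βhat n ℓ a t)

namespace Estimators

variable {𝒲 𝒴 B E : Type*} [MeasurableSpace 𝒲] [MeasurableSpace 𝒴]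
  [NormedAddCommGroup B] [InnerProductSpace ℝ B] [CompleteSpace B]
  [NormedAddCommGroup E] [NormedSpace ℝ E]
  {J : ℕ} {𝒵 : Fin J → Type*} [∀ j, MeasurableSpace (𝒵 j)] {p : ℕ}
  {D : CMRModel 𝒲 𝒴 B E 𝒵 p} {q L : ℕ} {C : Design D q L} (T : Estimators C)

/-- `M̂_{jℓ}(z)'β̂_ℓ`, the estimate of `f*_{a,j}(z)`. -/
def fit (n : ℕ) (ℓ : Fin L) (a : Fin q) (t : C.Train n ℓ) (j : Fin J) (z : 𝒵 j) : ℝ :=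
  ∑ k, T.Mhat n ℓ j k t z * T.βhat n ℓ a t k

/-- `κ̂_{jℓ}(z) = f_j(z) - M̂_{jℓ}(z)'β̂_ℓ`, as a `q`-vector. -/
def kappaHat (n : ℕ) (ℓ : Fin L) (t : C.Train n ℓ) (j : Fin J) (z : 𝒵 j) :
    EuclideanSpace ℝ (Fin q) :=
  WithLp.toLp 2 (fun a => C.f a j z - T.fit n ℓ a t j z)

/-- The cross-fitted sample moment
`ψ̂(θ) = n⁻¹ ∑_ℓ ∑_{i ∈ I_ℓ} ψ(W_i, θ, η̂_ℓ, κ̂_ℓ)` at the sample point `ω`. -/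
def psiHat {Ω : Type*} (W : ℕ → Ω → 𝒲) (n : ℕ) (θ : EuclideanSpace ℝ (Fin p)) (ω : Ω) :
    EuclideanSpace ℝ (Fin q) :=
  (n : ℝ)⁻¹ • ∑ ℓ, ∑ i ∈ Finset.univ.filter (fun i => C.fold n i = ℓ),
    D.psi θ (D.ι (T.ηhat n ℓ (C.train W n ℓ ω))) (T.kappaHat n ℓ (C.train W n ℓ ω)) (W i ω)

variable {Ω : Type*} [MeasurableSpace Ω] (P : Measure Ω) (W : ℕ → Ω → 𝒲)

/-- Second moment of `ψ(W, θ₀, η₀, κ₀)` and mean-square consistency conditions. The integrals are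
over a new observation `w ∼ F₀`, the estimators being held fixed. -/
def MeanSquare : Prop :=
  (∫⁻ w, ‖D.psi D.θ₀ (D.ι D.η₀) C.kappa₀ w‖ₑ ^ 2 ∂D.F₀ < ∞) ∧
  ∀ j ℓ,
    TendstoInMeasure P (fun n ω => ∫⁻ w,
      ‖D.m j (D.Y w) D.θ₀ (D.ι (T.ηhat n ℓ (C.train W n ℓ ω)))
        - D.m j (D.Y w) D.θ₀ (D.ι D.η₀)‖ₑ ^ 2 ∂D.F₀) atTop (fun _ => 0) ∧
    TendstoInMeasure P (fun n ω => ∫⁻ w,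
      ‖D.m j (D.Y w) D.θ₀ (D.ι (T.ηhat n ℓ (C.train W n ℓ ω)))
        - D.m j (D.Y w) D.θ₀ (D.ι D.η₀)‖ₑ ^ 2
        * ‖C.kappa₀ j (D.Z j w)‖ₑ ^ 2 ∂D.F₀) atTop (fun _ => 0) ∧
    TendstoInMeasure P (fun n ω => ∫⁻ w,
      ‖D.m j (D.Y w) D.θ₀ (D.ι D.η₀)‖ₑ ^ 2
        * ‖T.kappaHat n ℓ (C.train W n ℓ ω) j (D.Z j w)
          - C.kappa₀ j (D.Z j w)‖ₑ ^ 2 ∂D.F₀) atTop (fun _ => 0)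

/-- With probability approaching one, the fits are in `L²(Z_j)`, the estimated instruments are
bounded almost surely, and `η̂_ℓ ∈ Ξ`. -/
def WellDefined : Prop :=
  ∀ j ℓ, Wpa1 P fun n ω =>
    (∀ a, MemLp (T.fit n ℓ a (C.train W n ℓ ω) j) 2 (D.law j)) ∧
    (∃ K : ℝ, ∀ᵐ z ∂(D.law j), ‖T.kappaHat n ℓ (C.train W n ℓ ω) j z‖ ≤ K) ∧
    T.ηhat n ℓ (C.train W n ℓ ω) ∈ D.Ξ

/-- `‖η̂_ℓ - η₀‖_Ξ = O_p(n^{-d_η})`. -/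
def EtaRate (dη : ℝ) : Prop :=
  ∀ ℓ, IsBigOInProb P (fun n ω => ‖T.ηhat n ℓ (C.train W n ℓ ω) - D.η₀‖)
    (fun n => (n : ℝ) ^ (-dη))

/-- With probability approaching one, `max_k |M̂_{jℓk}(Z_j)| ≤ c_j` almost surely. -/
def BoundedMhat : Prop :=
  ∃ c : Fin J → ℝ, ∀ j ℓ, Wpa1 P fun n ω =>
    ∀ᵐ z ∂(D.law j), ∀ k, |T.Mhat n ℓ j k (C.train W n ℓ ω) z| ≤ c j

/-- With probability approaching one, for all `k`, the mean-square error of `M̂_{jℓk}` under the law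
of `Z_j` satisfies `‖M̂_{jℓk} - M_{jk}‖₂ ≤ C n^{-d_j}`. -/
def RegressorRate (d : Fin J → ℝ) : Prop :=
  ∃ K : Fin J → ℝ, ∀ j ℓ, Wpa1 P fun n ω => ∀ k,
    eLpNorm (fun z => T.Mhat n ℓ j k (C.train W n ℓ ω) z - C.M n j k z) 2 (D.law j)
      ≤ ENNReal.ofReal (K j * (n : ℝ) ^ (-d j))

/-- With probability approaching one, for all `k`, the average squared error of `M̂_{jℓk}` over the
observations `i ∉ I_ℓ` that enter the Lasso regression is at most `(C n^{-d_j})²`. -/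
def RegressorRateInSample (d : Fin J → ℝ) : Prop :=
  ∃ K : Fin J → ℝ, ∀ j ℓ, Wpa1 P fun n ω => ∀ k,
    (Fintype.card (C.Out n ℓ) : ℝ)⁻¹ * ∑ i : C.Out n ℓ,
        (T.Mhat n ℓ j k (C.train W n ℓ ω) (D.Z j (W i.1.1 ω))
          - C.M n j k (D.Z j (W i.1.1 ω))) ^ 2
      ≤ (K j * (n : ℝ) ^ (-d j)) ^ 2

end Estimators

end

open MeasureTheory ProbabilityTheory Filter Topology
open scoped ENNReal

noncomputable section

/-! ### Deterministic bounds for the Lasso -/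

section Lasso

variable {ι H H' : Type*} [Fintype ι] [NormedAddCommGroup H] [InnerProductSpace ℝ H]
  [NormedAddCommGroup H'] [InnerProductSpace ℝ H']

/-! The scaled difference between the debiased moment and its oracle version splits over folds into
`n^{-1/2} ∑_{i ∈ I_ℓ} Δ_ℓ(W_i)`, where `Δ_ℓ` is `momentError`. Given the observations outside `I_ℓ`,
`Δ_ℓ` is a fixed function evaluated at fresh i.i.d. points. Cross-fitting thus replaces empirical
process theory by Chebyshev's inequality: it suffices that `∫ Δ_ℓ² dF₀ → 0` and `√n ∫ Δ_ℓ dF₀ → 0`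
in probability (`wpa1_abs_fold_sum_lt`).

The second moment is controlled by `m̂κ̂ - mκ₀ = (m̂ - m)κ̂ + m(κ̂ - κ₀)`, mean-square consistency
and a uniform bound on `κ̂` (`lintegral_sum_sub_sq_le`). For the mean, `h_j(η₀) = 0` gives `∫ Δ_ℓ
dF₀ = ∑_j ⟨h_j(η̂) - h_j(η₀), κ̂_j - κ₀_j⟩ + ψ̄(η̂, κ₀) - ψ̄(η₀, κ₀)` (`abs_integral_sum_sub_le`).
The last difference is quadratic in `η̂ - η₀`: since `κ₀` is orthogonal to the range of `S`, the
derivative of `ψ̄` in `η` vanishes at `η₀` (`fderiv_psiBar_eq_zero`), and `2 d_η > 1/2`. The first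
sum is a product of the rate of `η̂` and the Lasso rate; the rate inequality makes it `o(n^{-1/2})`.

The Lasso can learn `f*` from `f` because the population regressors lie in the range of `S`, so they
have the same inner products with `f` and `f*`. Hoeffding's inequality for the population
regressors, with the in-sample error of their estimates, shows that the moments entering the Lasso
are entrywise within `O(n^{-d})` of population moments (`wpa1_lasso_moments`). The estimated
coefficients are compared not with `β̄` but with the minimiser `β_*` of a quadratic penalised only
off the support of `β̄`: it satisfies a sup-norm first-order condition of size `ε_n`, has bounded
`ℓ₁`-norm, and has little mass off that support (`exists_sparse_oracle`). As `ε_n = o(λ_n)`, the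
penalty dominates all moment errors, and restricted eigenvalues of the population Gram matrix
suffice (`lasso_bound`). The resulting rate is `λ_n ε_n^{-1/(2ξ+1)}`, plus the regressor error;
eventually `ε_n = n^{c - d}`. -/

theorem abs_le_of_forall_quadratic_nonneg {a b ε : ℝ}
    (h : ∀ t : ℝ, 0 ≤ t ^ 2 * a - 2 * t * b + 2 * ε * |t|) : |b| ≤ ε := by
  have key : ∀ b' : ℝ, (∀ t : ℝ, 0 ≤ t → 0 ≤ t ^ 2 * a - 2 * t * b' + 2 * ε * t) → b' ≤ ε := by
    intro b' hb
    by_contra! hlt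
    -- For this `t`, `t * |a| < b' - ε`, so the quadratic term is too small to offset the negative
    -- linear term.
    have ha := hb ((b' - ε) / (|a| + 1)) (div_nonneg (by linarith) (by positivity))
    set t := (b' - ε) / (|a| + 1) with ht
    have htpos : 0 < t := div_pos (by linarith) (by positivity)
    have htm : t * (|a| + 1) = b' - ε := by rw [ht]; field_simp
    have h1 : t * a ≤ t * |a| := mul_le_mul_of_nonneg_left (le_abs_self a) htpos.le
    have h2 : 0 ≤ t * (t * a - 2 * b' + 2 * ε) := by nlinarith
    have h3 : 0 ≤ t * a - 2 * b' + 2 * ε := nonneg_of_mul_nonneg_right h2 htpos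
    nlinarith
  refine abs_le.2 ⟨?_, key b fun t ht => by simpa [abs_of_nonneg ht] using h t⟩
  have := key (-b) fun t ht => by
    have := h (-t)
    rw [abs_neg, abs_of_nonneg ht] at this
    nlinarith
  linarith

theorem abs_sum_mul_le_mul_sum_abs {g : ℝ} (c β : ι → ℝ) (h : ∀ k, |c k| ≤ g) :
    |∑ k, β k * c k| ≤ g * ∑ k, |β k| := by
  refine (Finset.abs_sum_le_sum_abs _ _).trans ?_
  rw [Finset.mul_sum]
  refine Finset.sum_le_sum fun k _ => ?_
  rw [abs_mul, mul_comm]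
  exact mul_le_mul_of_nonneg_right (h k) (abs_nonneg _)

/-- Gram matrices that are entrywise close have close bilinear forms on `ℓ₁`-balls. -/
theorem abs_inner_sum_sub_inner_sum_le {g : ℝ} (x : ι → H) (x' : ι → H')
    (h : ∀ k l, |inner ℝ (x' k) (x' l) - inner ℝ (x k) (x l)| ≤ g) (k : ι) (β : ι → ℝ) :
    |inner ℝ (x' k) (∑ l, β l • x' l) - inner ℝ (x k) (∑ l, β l • x l)| ≤ g * ∑ l, |β l| := by
  rw [inner_sum, inner_sum, ← Finset.sum_sub_distrib]
  simp_rw [real_inner_smul_right, ← mul_sub]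
  exact abs_sum_mul_le_mul_sum_abs _ _ (h k)

theorem abs_norm_sq_sum_sub_norm_sq_sum_le {g : ℝ} (x : ι → H) (x' : ι → H')
    (h : ∀ k l, |inner ℝ (x' k) (x' l) - inner ℝ (x k) (x l)| ≤ g) (β : ι → ℝ) :
    |‖∑ k, β k • x' k‖ ^ 2 - ‖∑ k, β k • x k‖ ^ 2| ≤ g * (∑ k, |β k|) * ∑ k, |β k| := by
  rw [← real_inner_self_eq_norm_sq, ← real_inner_self_eq_norm_sq, sum_inner, sum_inner,
    ← Finset.sum_sub_distrib]
  simp_rw [real_inner_smul_left, ← mul_sub]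
  exact abs_sum_mul_le_mul_sum_abs _ _ (abs_inner_sum_sub_inner_sum_le x x' h · β)

/-- First-order condition for the minimiser of a partially `ℓ₁`-penalised quadratic. -/
theorem abs_inner_le_of_isMinOn_penalized [DecidableEq ι] (x : ι → H) (A : Finset ι) {ε : ℝ}
    (hε : 0 ≤ ε) (β₀ βs : ι → ℝ)
    (hmin : IsMinOn (fun v : ι → ℝ => ‖∑ k, (β₀ k - v k) • x k‖ ^ 2 + 2 * ε * ∑ k ∈ A, |v k|)
      Set.univ βs) (k : ι) :
    |inner ℝ (x k) (∑ l, (β₀ l - βs l) • x l)| ≤ ε := by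
  -- Move the `k`-th coordinate by `t`. The penalty grows by at most `2 ε |t|`, whether or not `k ∈
  -- A`.
  refine abs_le_of_forall_quadratic_nonneg (a := ‖x k‖ ^ 2) fun t => ?_
  have h := hmin (Set.mem_univ (βs + Pi.single k t))
  simp only [Set.mem_ofPred_eq] at h
  have e1 : ∑ l, (β₀ l - (βs + (Pi.single k t : ι → ℝ)) l) • x l
      = ∑ l, (β₀ l - βs l) • x l - t • x k := by
    have : t • x k = ∑ l, (Pi.single k t : ι → ℝ) l • x l := by
      rw [Finset.sum_eq_single k (fun b _ hb => by simp [Pi.single_eq_of_ne hb]) (by simp)]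
      simp
    rw [this, ← Finset.sum_sub_distrib]
    refine Finset.sum_congr rfl fun l _ => ?_
    rw [← sub_smul]
    congr 1
    simp
    ring
  have e2 : ∑ l ∈ A, |(βs + (Pi.single k t : ι → ℝ)) l| ≤ ∑ l ∈ A, |βs l| + |t| := by
    calc ∑ l ∈ A, |(βs + (Pi.single k t : ι → ℝ)) l|
        ≤ ∑ l ∈ A, (|βs l| + |(Pi.single k t : ι → ℝ) l|) :=
          Finset.sum_le_sum fun l _ => abs_add_le _ _
      _ = ∑ l ∈ A, |βs l| + ∑ l ∈ A, |(Pi.single k t : ι → ℝ) l| := Finset.sum_add_distrib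
      _ ≤ ∑ l ∈ A, |βs l| + ∑ l, |(Pi.single k t : ι → ℝ) l| := by
          gcongr
          exact Finset.subset_univ _
      _ = ∑ l ∈ A, |βs l| + |t| := by
          congr 1
          rw [Finset.sum_eq_single k (fun b _ hb => by simp [Pi.single_eq_of_ne hb]) (by simp)]
          simp
  rw [e1, norm_sub_sq_real, real_inner_smul_right, norm_smul, mul_pow, Real.norm_eq_abs, sq_abs,
    real_inner_comm] at h
  have e3 := mul_le_mul_of_nonneg_left e2 (by positivity : 0 ≤ 2 * ε)
  linarith

/-- Basic inequality for the Lasso, compared with an arbitrary coefficient vector. -/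
theorem lasso_basic_inequality (x' : ι → H') (y' : H') (βh βs : ι → ℝ) (lam : ℝ)
    (hmin : ‖y' - ∑ k, βh k • x' k‖ ^ 2 + 2 * lam * ∑ k, |βh k|
      ≤ ‖y' - ∑ k, βs k • x' k‖ ^ 2 + 2 * lam * ∑ k, |βs k|)
    {e : ℝ} (he : ∀ k, |inner ℝ (x' k) (y' - ∑ l, βs l • x' l)| ≤ e) :
    ‖∑ k, (βh k - βs k) • x' k‖ ^ 2 + 2 * lam * ∑ k, |βh k|
      ≤ 2 * lam * ∑ k, |βs k| + 2 * e * ∑ k, |βh k - βs k| := by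
  have e1 : y' - ∑ k, βh k • x' k = (y' - ∑ k, βs k • x' k) - ∑ k, (βh k - βs k) • x' k := by
    simp_rw [sub_smul, Finset.sum_sub_distrib]
    abel
  rw [e1, norm_sub_sq_real] at hmin
  have e2 : inner ℝ (y' - ∑ k, βs k • x' k) (∑ k, (βh k - βs k) • x' k)
      ≤ e * ∑ k, |βh k - βs k| := by
    rw [inner_sum]
    simp_rw [real_inner_smul_right]
    refine (le_abs_self _).trans (abs_sum_mul_le_mul_sum_abs _ _ fun k => ?_)
    rw [real_inner_comm]
    exact he k
  linarith

/-- The `ℓ₁`-norm of the Lasso coefficients and the prediction error of the Lasso in terms of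
the entrywise estimation error `g` of the moments. -/
theorem lasso_bound [DecidableEq ι] (x : ι → H) (y : H) (x' : ι → H') (y' : H')
    (βh βs : ι → ℝ) (A : Finset ι) {lam ε g K ρ c₀ : ℝ} (hlam : 0 < lam) (hg : 0 ≤ g)
    (hmin : ‖y' - ∑ k, βh k • x' k‖ ^ 2 + 2 * lam * ∑ k, |βh k|
      ≤ ‖y' - ∑ k, βs k • x' k‖ ^ 2 + 2 * lam * ∑ k, |βs k|)
    (hG : ∀ k l, |inner ℝ (x' k) (x' l) - inner ℝ (x k) (x l)| ≤ g)
    (hF : ∀ k, |inner ℝ (x' k) y' - inner ℝ (x k) y| ≤ g)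
    (hfoc : ∀ k, |inner ℝ (x k) (y - ∑ l, βs l • x l)| ≤ ε)
    (hK : ∑ k, |βs k| ≤ K) (hρ : ∑ k ∈ Aᶜ, |βs k| ≤ ρ)
    (hsmall : 2 * (g * K + g + ε) + 3 * g * K ≤ lam / 4) (hc₀ : 0 < c₀)
    (hRE : ∀ δ : ι → ℝ, ∑ k ∈ Aᶜ, |δ k| ≤ 3 * ∑ k ∈ A, |δ k| →
      c₀ * ∑ k ∈ A, δ k ^ 2 ≤ ‖∑ k, δ k • x k‖ ^ 2) :
    ∑ k, |βh k| ≤ 2 * K ∧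
      ‖∑ k, (βh k - βs k) • x k‖ ^ 2 ≤ 28 / c₀ * lam ^ 2 * A.card + 7 * lam * ρ := by
  have hK0 : 0 ≤ K := (Finset.sum_nonneg fun k _ => abs_nonneg (βs k)).trans hK
  have hρ0 : 0 ≤ ρ := (Finset.sum_nonneg fun k _ => abs_nonneg (βs k)).trans hρ
  have hgK : 0 ≤ g * K := mul_nonneg hg hK0
  -- The sample score at `βs` differs from the population score by the Gram error, at most `g * K`,
  -- and by the error `g` of the cross moments.
  have he : ∀ k, |inner ℝ (x' k) (y' - ∑ l, βs l • x' l)| ≤ g * K + g + ε := by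
    intro k
    have h1 := abs_inner_sum_sub_inner_sum_le x x' hG k βs
    have h2 := mul_le_mul_of_nonneg_left hK hg
    have h3 := hfoc k
    have h4 := hF k
    rw [inner_sub_right] at h3 ⊢
    rw [abs_le] at *
    constructor <;> linarith
  have hbasic := lasso_basic_inequality x' y' βh βs lam hmin he
  set e := g * K + g + ε
  set Δ : ι → ℝ := fun k => βh k - βs k with hΔ
  have hΔ1 : ∑ k, |Δ k| ≤ ∑ k, |βh k| + ∑ k, |βs k| := by
    rw [← Finset.sum_add_distrib]
    exact Finset.sum_le_sum fun k _ => abs_sub _ _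
  have hΔ0 : 0 ≤ ∑ k, |Δ k| := Finset.sum_nonneg fun k _ => abs_nonneg _
  have he4 : 2 * e ≤ lam / 4 := by nlinarith
  have hβh : ∑ k, |βh k| ≤ 2 * K := by
    have h1 : 2 * e * ∑ k, |Δ k| ≤ lam / 4 * ∑ k, |Δ k| := mul_le_mul_of_nonneg_right he4 hΔ0
    have h2 := sq_nonneg ‖∑ k, (βh k - βs k) • x' k‖
    have h3 : lam * (∑ k, |βh k| * 1) ≤ lam * (2 * K) := by
      simp only [mul_one]
      nlinarith
    simpa using le_of_mul_le_mul_left h3 hlam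
  refine ⟨hβh, ?_⟩
  -- The eigenvalue bound is available only for the population regressors `x`. Since `‖Δ‖₁ ≤ 3K`,
  -- passing from the sample to the population quadratic form costs a term linear in `‖Δ‖₁`, which
  -- the penalty absorbs.
  have hcmp := abs_norm_sq_sum_sub_norm_sq_sum_le x x' hG Δ
  have hΔK : g * (∑ k, |Δ k|) ≤ 3 * g * K := by nlinarith
  have hmain : ‖∑ k, Δ k • x k‖ ^ 2 + 2 * lam * ∑ k, |βh k|
      ≤ 2 * lam * ∑ k, |βs k| + lam / 4 * ∑ k, |Δ k| := by
    have h1 := (abs_le.1 hcmp).1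
    have h2 : g * (∑ k, |Δ k|) * ∑ k, |Δ k| ≤ 3 * g * K * ∑ k, |Δ k| :=
      mul_le_mul_of_nonneg_right hΔK hΔ0
    have h3 := mul_le_mul_of_nonneg_right hsmall hΔ0
    linarith
  have sβh := Finset.sum_add_sum_compl A fun k => |βh k|
  have sβs := Finset.sum_add_sum_compl A fun k => |βs k|
  have sΔ := Finset.sum_add_sum_compl A fun k => |Δ k|
  have hA : ∑ k ∈ A, |βs k| ≤ ∑ k ∈ A, |βh k| + ∑ k ∈ A, |Δ k| := by
    rw [← Finset.sum_add_distrib]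
    refine Finset.sum_le_sum fun k _ => ?_
    have := abs_sub_abs_le_abs_sub (βs k) (βh k)
    rw [abs_sub_comm] at this
    simp only [hΔ]
    linarith
  have hAc : ∑ k ∈ Aᶜ, |Δ k| ≤ ∑ k ∈ Aᶜ, |βh k| + ∑ k ∈ Aᶜ, |βs k| := by
    rw [← Finset.sum_add_distrib]
    exact Finset.sum_le_sum fun k _ => abs_sub _ _
  set a := ∑ k ∈ A, |Δ k| with ha
  set b := ∑ k ∈ Aᶜ, |Δ k| with hb
  have hb0 : 0 ≤ b := Finset.sum_nonneg fun k _ => abs_nonneg _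
  have ha0 : 0 ≤ a := Finset.sum_nonneg fun k _ => abs_nonneg _
  have hkey : ‖∑ k, Δ k • x k‖ ^ 2 + 7 / 4 * lam * b ≤ 9 / 4 * lam * a + 4 * lam * ρ := by
    rw [← sβh, ← sβs, ← sΔ] at hmain
    have h1 := mul_le_mul_of_nonneg_left hA hlam.le
    have h2 := mul_le_mul_of_nonneg_left hAc hlam.le
    have h3 := mul_le_mul_of_nonneg_left hρ hlam.le
    nlinarith
  set X := ‖∑ k, Δ k • x k‖ ^ 2 with hX
  have hX0 : 0 ≤ X := sq_nonneg _
  have hlb : 0 ≤ lam * b := mul_nonneg hlam.le hb0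
  -- If `4ρ ≤ 3a`, the right side of `hkey` is at most `(9/4 + 3) lam * a = 3 * (7/4) lam * a`,
  -- which is exactly the cone condition. Otherwise `a < 4ρ/3`, and the right side is at most `(3 +
  -- 4) lam * ρ`.
  rcases le_or_gt (4 * ρ) (3 * a) with hcase | hcase
  · have h1 : X + 7 / 4 * lam * b ≤ 21 / 4 * lam * a := by
      have := mul_le_mul_of_nonneg_left hcase hlam.le
      linarith
    have hcone : b ≤ 3 * a := by
      have : lam * b ≤ lam * (3 * a) := by linarith
      exact le_of_mul_le_mul_left this hlam
    have hre := hRE Δ hcone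
    have hcs : a ^ 2 ≤ A.card * ∑ k ∈ A, Δ k ^ 2 := by
      have := sq_sum_le_card_mul_sum_sq (s := A) (f := fun k => |Δ k|)
      simpa using this
    have h2 : X ≤ 21 / 4 * lam * a := by linarith
    have h3 : X ^ 2 ≤ (28 / c₀ * lam ^ 2 * A.card) * X := by
      -- The constant 28 rounds up `(21/4)² = 27.5625`.
      calc X ^ 2 ≤ (21 / 4 * lam * a) ^ 2 := by gcongr
        _ = (21 / 4) ^ 2 * lam ^ 2 * a ^ 2 := by ring
        _ ≤ 28 * lam ^ 2 * a ^ 2 := by gcongr; norm_num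
        _ ≤ 28 * lam ^ 2 * (A.card * ∑ k ∈ A, Δ k ^ 2) := by gcongr
        _ = (28 / c₀ * lam ^ 2 * A.card) * (c₀ * ∑ k ∈ A, Δ k ^ 2) := by field_simp
        _ ≤ _ := by gcongr
    have h4 : X ≤ 28 / c₀ * lam ^ 2 * A.card := by
      rcases hX0.eq_or_lt with h0 | h0
      · rw [← h0]; positivity
      · rw [sq] at h3
        exact le_of_mul_le_mul_right h3 h0
    have : 0 ≤ 7 * lam * ρ := by positivity
    linarith
  · have h1 : X ≤ 7 * lam * ρ := by
      have := mul_le_mul_of_nonneg_left hcase.le hlam.le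
      linarith
    have : 0 ≤ 28 / c₀ * lam ^ 2 * A.card := by positivity
    linarith

/-- Approximation properties of the partially penalised population coefficients. -/
theorem penalized_minimizer_bound [DecidableEq ι] (x : ι → H) (y : H) (A : Finset ι) {ε b : ℝ}
    (hε : 0 < ε) (β₀ βs βbar : ι → ℝ)
    (hproj : ∀ k, inner ℝ (x k) (y - ∑ l, β₀ l • x l) = 0)
    (hmin : IsMinOn (fun v : ι → ℝ => ‖∑ k, (β₀ k - v k) • x k‖ ^ 2 + 2 * ε * ∑ k ∈ Aᶜ, |v k|)
      Set.univ βs)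
    (hbar : ∀ k ∈ Aᶜ, βbar k = 0) (happ : ‖y - ∑ k, βbar k • x k‖ ^ 2 ≤ b) :
    (∀ k, |inner ℝ (x k) (y - ∑ l, βs l • x l)| ≤ ε) ∧
      ‖y - ∑ k, βs k • x k‖ ^ 2 ≤ 2 * b ∧ 2 * ε * ∑ k ∈ Aᶜ, |βs k| ≤ b := by
  have hpyth : ∀ v : ι → ℝ, ‖y - ∑ k, v k • x k‖ ^ 2
      = ‖y - ∑ k, β₀ k • x k‖ ^ 2 + ‖∑ k, (β₀ k - v k) • x k‖ ^ 2 := by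
    intro v
    have e : y - ∑ k, v k • x k = (y - ∑ k, β₀ k • x k) + ∑ k, (β₀ k - v k) • x k := by
      simp_rw [sub_smul, Finset.sum_sub_distrib]
      abel
    have ho : inner ℝ (y - ∑ k, β₀ k • x k) (∑ k, (β₀ k - v k) • x k) = 0 := by
      rw [inner_sum]
      refine Finset.sum_eq_zero fun k _ => ?_
      rw [real_inner_smul_right, real_inner_comm, hproj, mul_zero]
    rw [e, norm_add_sq_real, ho]
    ring
  -- As a competitor `βbar` pays no penalty, since it vanishes on `Aᶜ`. By Pythagoras its excess
  -- loss is at most `b`, which controls both the loss and the penalty of `βs`.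
  have hm := hmin (Set.mem_univ βbar)
  simp only [Set.mem_ofPred_eq] at hm
  have hz : ∑ k ∈ Aᶜ, |βbar k| = 0 :=
    Finset.sum_eq_zero fun k hk => by rw [hbar k hk, abs_zero]
  rw [hz, mul_zero, add_zero] at hm
  have h1 := hpyth βbar
  have h2 := hpyth βs
  have h3 : 0 ≤ 2 * ε * ∑ k ∈ Aᶜ, |βs k| :=
    mul_nonneg (by positivity) (Finset.sum_nonneg fun k _ => abs_nonneg _)
  have h4 := sq_nonneg ‖y - ∑ k, β₀ k • x k‖
  have h5 := sq_nonneg ‖∑ k, (β₀ k - βs k) • x k‖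
  refine ⟨fun k => ?_, by linarith, by linarith⟩
  have := abs_inner_le_of_isMinOn_penalized x Aᶜ hε.le β₀ βs hmin k
  have e : y - ∑ k, βs k • x k = (y - ∑ k, β₀ k • x k) + ∑ k, (β₀ k - βs k) • x k := by
    simp_rw [sub_smul, Finset.sum_sub_distrib]
    abel
  rw [e, inner_add_right, hproj, zero_add]
  exact this

end Lasso

/-! ### Calculus of events with probability approaching one -/

section Wpa1

variable {Ω : Type*} [MeasurableSpace Ω] {P : Measure Ω}

theorem Wpa1.mono {A B : ℕ → Ω → Prop} (hA : Wpa1 P A)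
    (h : ∀ᶠ n in atTop, ∀ ω, A n ω → B n ω) : Wpa1 P B :=
  tendsto_of_tendsto_of_tendsto_of_le_of_le' tendsto_const_nhds hA
    (Eventually.of_forall fun _ => zero_le)
    (h.mono fun _ hn => measure_mono fun _ hω hAω => hω (hn _ hAω))

theorem Wpa1.and {A B : ℕ → Ω → Prop} (hA : Wpa1 P A) (hB : Wpa1 P B) :
    Wpa1 P fun n ω => A n ω ∧ B n ω := by
  have h := Tendsto.add hA hB
  rw [add_zero] at h
  refine tendsto_of_tendsto_of_tendsto_of_le_of_le tendsto_const_nhds h (fun _ => zero_le)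
    fun n => (measure_mono ?_).trans (measure_union_le _ _)
  intro ω hω
  by_cases hAω : A n ω
  · exact Or.inr fun hBω => hω ⟨hAω, hBω⟩
  · exact Or.inl hAω

theorem Wpa1.of_ae {A : ℕ → Ω → Prop} (h : ∀ᶠ n in atTop, ∀ᵐ ω ∂P, A n ω) : Wpa1 P A :=
  tendsto_const_nhds.congr' (h.mono fun _ hn => (ae_iff.1 hn).symm)

theorem Wpa1.forall {κ : Type*} [Finite κ] {A : κ → ℕ → Ω → Prop} (h : ∀ k, Wpa1 P (A k)) :
    Wpa1 P fun n ω => ∀ k, A k n ω := by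
  cases nonempty_fintype κ
  have hs : Tendsto (fun n => ∑ k, P {ω | ¬ A k n ω}) atTop (𝓝 0) := by
    simpa using tendsto_finsetSum Finset.univ fun k _ => h k
  refine tendsto_of_tendsto_of_tendsto_of_le_of_le tendsto_const_nhds hs (fun _ => zero_le)
    fun n => (measure_mono ?_).trans (measure_iUnion_fintype_le P fun k => {ω | ¬ A k n ω})
  intro ω hω
  simpa using hω

/-- Turns a probabilistic condition into one realisation; a consequence of the condition that
involves no randomness then holds outright. -/
theorem Wpa1.exists_of_eventually [IsProbabilityMeasure P] {A : ℕ → Ω → Prop} (hA : Wpa1 P A) :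
    ∃ n ω, A n ω := by
  obtain ⟨n, hn⟩ := (hA.eventually_lt_const (zero_lt_one)).exists
  by_contra! hcon
  have : {ω | ¬ A n ω} = Set.univ := Set.eq_univ_of_forall fun ω => hcon n ω
  rw [this, measure_univ] at hn
  exact lt_irrefl _ hn

/-- The constant in an `O_p` bound depends on the probability level; a sequence `b` that eventually
exceeds every multiple of `a` serves all levels at once. -/
theorem IsBigOInProb.wpa1_abs_le {X : ℕ → Ω → ℝ} {a b : ℕ → ℝ} (hX : IsBigOInProb P X a)
    (hab : ∀ K : ℝ, ∀ᶠ n in atTop, K * a n ≤ b n) : Wpa1 P fun n ω => |X n ω| ≤ b n := by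
  refine ENNReal.tendsto_nhds_zero.2 fun δ hδ => ?_
  obtain ⟨K, hK⟩ := hX δ hδ
  filter_upwards [hK, hab K] with n h1 h2
  refine (measure_mono fun ω hω => ?_).trans h1
  exact h2.trans_lt (not_le.1 hω)

theorem ENNReal.edist_zero_right_eq (x : ℝ≥0∞) : edist x 0 = x := by
  cases x
  · exact (ENNReal.edist_eq_top_iff _ _).2 (by simp)
  · rename_i x
    have : edist (x : ℝ≥0∞) 0 = edist x 0 := rfl
    rw [this, edist_nndist, NNReal.nndist_zero_eq_val']

theorem MeasureTheory.TendstoInMeasure.wpa1_lt {f : ℕ → Ω → ℝ≥0∞}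
    (h : TendstoInMeasure P f atTop fun _ => 0) {ε : ℝ≥0∞} (hε : 0 < ε) :
    Wpa1 P fun n ω => f n ω < ε := by
  have := h ε hε
  simp_rw [ENNReal.edist_zero_right_eq] at this
  simpa [Wpa1] using this

end Wpa1

/-! ### Chebyshev's inequality conditionally on an independent variable -/

section Chebyshev

variable {Ω 𝒯 𝒲 : Type*} [MeasurableSpace Ω] [MeasurableSpace 𝒯] [MeasurableSpace 𝒲]

theorem integral_sq_le_of_lintegral_enorm_sq_le {F : Measure 𝒲} {g : 𝒲 → ℝ} {η : ℝ} (hη : 0 ≤ η)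
    (h : ∫⁻ w, ‖g w‖ₑ ^ 2 ∂F ≤ ENNReal.ofReal η) : ∫ w, g w ^ 2 ∂F ≤ η := by
  have h1 : ‖∫ w, g w ^ 2 ∂F‖ₑ ≤ ENNReal.ofReal η :=
    (enorm_integral_le_lintegral_enorm _).trans (by simpa [enorm_pow] using h)
  rw [Real.enorm_eq_ofReal (integral_nonneg fun _ => sq_nonneg _)] at h1
  exact (ENNReal.ofReal_le_ofReal_iff hη).1 h1

theorem memLp_two_of_lintegral_enorm_sq_lt_top {F : Measure 𝒲} {g : 𝒲 → ℝ}
    (hg : AEStronglyMeasurable g F) (h : ∫⁻ w, ‖g w‖ₑ ^ 2 ∂F < ∞) : MemLp g 2 F := by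
  refine ⟨hg, (eLpNorm_lt_top_iff_lintegral_rpow_enorm_lt_top (by norm_num) (by norm_num)).2 ?_⟩
  simpa using h

/-- Chebyshev: under a product measure the variance of the sum is the sum of the variances, each at
most the second moment. -/
theorem pi_centered_sum_ge_le {κ : Type*} [Fintype κ] (F : Measure 𝒲) [IsProbabilityMeasure F]
    {g : 𝒲 → ℝ} (hg : AEStronglyMeasurable g F) {η δ : ℝ} (hη : 0 ≤ η) (hδ : 0 < δ)
    (h : ∫⁻ w, ‖g w‖ₑ ^ 2 ∂F ≤ ENNReal.ofReal η) :
    Measure.pi (fun _ : κ => F) {v | δ ≤ |∑ i, (g (v i) - ∫ w, g w ∂F)|}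
      ≤ ENNReal.ofReal (Fintype.card κ * η / δ ^ 2) := by
  have hL : MemLp g 2 F := memLp_two_of_lintegral_enorm_sq_lt_top hg (h.trans_lt (by simp))
  have hLi : ∀ i : κ, MemLp (fun v : κ → 𝒲 => g (v i)) 2 (Measure.pi fun _ : κ => F) := fun i =>
    hL.comp_measurePreserving (measurePreserving_eval (fun _ : κ => F) i)
  have hmean : ∫ v, (∑ i, fun v : κ → 𝒲 => g (v i)) v ∂(Measure.pi fun _ : κ => F)
      = ∑ _i : κ, ∫ w, g w ∂F := by
    simp_rw [Finset.sum_apply]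
    rw [integral_finsetSum _ fun i _ => (hLi i).integrable (by norm_num)]
    refine Finset.sum_congr rfl fun i _ => ?_
    exact integral_comp_eval (μ := fun _ : κ => F) (i := i) hg
  have hch := meas_ge_le_variance_div_sq (memLp_finsetSum' Finset.univ fun i _ => hLi i) hδ
  rw [hmean, variance_sum_pi (fun _ => hL)] at hch
  have hset : {v : κ → 𝒲 | δ ≤ |∑ i, (g (v i) - ∫ w, g w ∂F)|}
      = {v | δ ≤ |(∑ i, fun v : κ → 𝒲 => g (v i)) v - ∑ _i : κ, ∫ w, g w ∂F|} := by
    ext v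
    simp [Finset.sum_sub_distrib]
  rw [hset]
  refine hch.trans (ENNReal.ofReal_le_ofReal ?_)
  gcongr
  rw [Finset.sum_const, Finset.card_univ, nsmul_eq_mul]
  gcongr
  exact (variance_le_expectation_sq hg).trans (integral_sq_le_of_lintegral_enorm_sq_le hη h)

/-- By independence the joint law is a product, so the probability can be computed by fixing the
value `t` of `X`. Including the second-moment bound in the event leaves two kinds of slices: those
where Chebyshev applies and empty ones. -/
theorem measure_centered_sum_ge_le {κ : Type*} [Fintype κ] (P : Measure Ω) [IsProbabilityMeasure P]
    (F : Measure 𝒲) [IsProbabilityMeasure F] (X : Ω → 𝒯) (hX : Measurable X) (V : κ → Ω → 𝒲)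
    (hV : ∀ i, Measurable (V i)) (hind : IndepFun X (fun ω i => V i ω) P) (hVind : iIndepFun V P)
    (hlaw : ∀ i, P.map (V i) = F) (u : 𝒯 × 𝒲 → ℝ) (hu : Measurable u) {η δ : ℝ} (hη : 0 ≤ η)
    (hδ : 0 < δ) :
    P {ω | ∫⁻ w, ‖u (X ω, w)‖ₑ ^ 2 ∂F ≤ ENNReal.ofReal η ∧
        δ ≤ |∑ i, (u (X ω, V i ω) - ∫ w, u (X ω, w) ∂F)|}
      ≤ ENNReal.ofReal (Fintype.card κ * η / δ ^ 2) := by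
  have hVm : Measurable fun ω i => V i ω := measurable_pi_lambda _ hV
  have hpi : P.map (fun ω i => V i ω) = Measure.pi fun _ : κ => F := by
    rw [(iIndepFun_iff_map_fun_eq_pi_map fun i => (hV i).aemeasurable).1 hVind]
    simp_rw [hlaw]
  have hjoint := (indepFun_iff_map_prod_eq_prod_map_map hX.aemeasurable hVm.aemeasurable).1 hind
  rw [hpi] at hjoint
  set S : Set (𝒯 × (κ → 𝒲)) := {x | ∫⁻ w, ‖u (x.1, w)‖ₑ ^ 2 ∂F ≤ ENNReal.ofReal η ∧
        δ ≤ |∑ i, (u (x.1, x.2 i) - ∫ w, u (x.1, w) ∂F)|} with hS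
  have hv : Measurable fun t => ∫⁻ w, ‖u (t, w)‖ₑ ^ 2 ∂F :=
    Measurable.lintegral_prod_right' (f := fun x : 𝒯 × 𝒲 => ‖u x‖ₑ ^ 2) (by fun_prop)
  have hb : Measurable fun t => ∫ w, u (t, w) ∂F :=
    (StronglyMeasurable.integral_prod_right' hu.stronglyMeasurable).measurable
  have hSm : MeasurableSet S := by
    refine MeasurableSet.inter (measurableSet_le (hv.comp measurable_fst) measurable_const) ?_
    have : Measurable fun x : 𝒯 × (κ → 𝒲) =>
        ∑ i, (u (x.1, x.2 i) - ∫ w, u (x.1, w) ∂F) := by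
      refine Finset.measurable_sum _ fun i _ => ?_
      exact (hu.comp (measurable_fst.prodMk ((measurable_pi_apply i).comp measurable_snd))).sub
        (hb.comp measurable_fst)
    exact measurableSet_le measurable_const (continuous_abs.measurable.comp this)
  have heq : P {ω | ∫⁻ w, ‖u (X ω, w)‖ₑ ^ 2 ∂F ≤ ENNReal.ofReal η ∧
        δ ≤ |∑ i, (u (X ω, V i ω) - ∫ w, u (X ω, w) ∂F)|}
      = ((P.map X).prod (Measure.pi fun _ : κ => F)) S := by
    rw [← hjoint, Measure.map_apply (hX.prodMk hVm) hSm]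
    rfl
  have : IsProbabilityMeasure (P.map X) := Measure.isProbabilityMeasure_map hX.aemeasurable
  rw [heq, Measure.prod_apply hSm]
  calc ∫⁻ t, Measure.pi (fun _ : κ => F) (Prod.mk t ⁻¹' S) ∂(P.map X)
      ≤ ∫⁻ _, ENNReal.ofReal (Fintype.card κ * η / δ ^ 2) ∂(P.map X) := by
        refine lintegral_mono fun t => ?_
        by_cases ht : ∫⁻ w, ‖u (t, w)‖ₑ ^ 2 ∂F ≤ ENNReal.ofReal η
        · refine (measure_mono ?_).trans (pi_centered_sum_ge_le F
            (hu.comp measurable_prodMk_left).aestronglyMeasurable hη hδ ht)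
          exact fun v hv => hv.2
        · have : Prod.mk t ⁻¹' S = ∅ := by
            ext v
            simp only [hS, Set.mem_preimage, Set.mem_empty_iff_false, iff_false]
            exact fun hv => ht hv.1
          rw [this, measure_empty]
          exact zero_le
    _ = _ := by simp

end Chebyshev

/-! ### A maximal Hoeffding inequality -/

section Hoeffding

variable {Ω 𝒲 : Type*} [MeasurableSpace Ω] [MeasurableSpace 𝒲]

/-- Hoeffding's inequality: each bounded summand is sub-Gaussian after centring, and the one-sided
tail bound is applied to the summands and to their negatives. -/
theorem measure_abs_avg_sub_integral_gt_le (P : Measure Ω) [IsProbabilityMeasure P]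
    (F : Measure 𝒲) [IsProbabilityMeasure F] {κ : Type*} [Fintype κ] [Nonempty κ] (V : κ → Ω → 𝒲)
    (hV : ∀ i, Measurable (V i)) (hind : iIndepFun V P) (hlaw : ∀ i, P.map (V i) = F)
    {φ : 𝒲 → ℝ} (hφ : AEMeasurable φ F) {b : ℝ} (hb : 0 < b) (hφb : ∀ᵐ w ∂F, |φ w| ≤ b)
    {t : ℝ} (ht : 0 ≤ t) :
    P {ω | t < |(Fintype.card κ : ℝ)⁻¹ * ∑ i, φ (V i ω) - ∫ w, φ w ∂F|}
      ≤ ENNReal.ofReal (2 * Real.exp (-(Fintype.card κ * t ^ 2 / (2 * b ^ 2)))) := by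
  set N : ℝ := (Fintype.card κ : ℝ) with hN
  have hNpos : 0 < N := by rw [hN]; exact_mod_cast Fintype.card_pos
  set X : κ → Ω → ℝ := fun i ω => φ (V i ω) - ∫ w, φ w ∂F with hX
  have hφV : ∀ i, AEMeasurable φ (P.map (V i)) := fun i => by rw [hlaw i]; exact hφ
  have hint : ∀ i, ∫ ω, φ (V i ω) ∂P = ∫ w, φ w ∂F := fun i => by
    rw [← hlaw i, integral_map (hV i).aemeasurable (hφV i).aestronglyMeasurable]
  have hsub : ∀ i, HasSubgaussianMGF (X i) (b ^ 2).toNNReal P := by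
    intro i
    have hbd : ∀ᵐ ω ∂P, φ (V i ω) ∈ Set.Icc (-b) b := by
      have : ∀ᵐ w ∂(P.map (V i)), |φ w| ≤ b := by rw [hlaw i]; exact hφb
      filter_upwards [ae_of_ae_map (hV i).aemeasurable this] with ω hω
      exact abs_le.1 hω
    have := hasSubgaussianMGF_of_mem_Icc ((hφV i).comp_measurable (hV i)) hbd
    simp only [Function.comp_def, hint] at this
    -- The sub-Gaussian parameter is the squared half-length of `[-b, b]`.
    have hcst : (‖b - -b‖₊ / 2) ^ 2 = (b ^ 2).toNNReal := by
      ext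
      rw [Real.coe_toNNReal _ (sq_nonneg b)]
      push_cast
      rw [sub_neg_eq_add, Real.norm_of_nonneg (by positivity)]
      ring
    rwa [hcst] at this
  have hXind : iIndepFun X P := by
    refine hind.comp₀ (fun _ w => φ w - ∫ w, φ w ∂F) (fun i => (hV i).aemeasurable) fun i => ?_
    exact (hφV i).sub_const _
  have hXind' : iIndepFun (fun i => -X i) P :=
    hXind.comp (fun _ x => -x) fun _ => measurable_neg
  have h1 := HasSubgaussianMGF.measure_sum_ge_le_of_iIndepFun hXind (s := Finset.univ)
    (fun i _ => hsub i) (ε := N * t) (by positivity)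
  have h2 := HasSubgaussianMGF.measure_sum_ge_le_of_iIndepFun hXind' (s := Finset.univ)
    (fun i _ => (hsub i).neg) (ε := N * t) (by positivity)
  have hexp : -(N * t) ^ 2 / (2 * ((∑ _i : κ, (b ^ 2).toNNReal : NNReal) : ℝ))
      = -(N * t ^ 2 / (2 * b ^ 2)) := by
    simp only [Finset.sum_const, Finset.card_univ, nsmul_eq_mul, NNReal.coe_mul, NNReal.coe_natCast,
      Real.coe_toNNReal _ (sq_nonneg b), ← hN]
    field_simp
  rw [hexp] at h1 h2
  have hsubset : {ω | t < |N⁻¹ * ∑ i, φ (V i ω) - ∫ w, φ w ∂F|}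
      ⊆ {ω | N * t ≤ ∑ i, X i ω} ∪ {ω | N * t ≤ ∑ i, (-X i) ω} := by
    intro ω hω
    have hsum : ∑ i, X i ω = N * (N⁻¹ * ∑ i, φ (V i ω) - ∫ w, φ w ∂F) := by
      simp only [hX, Finset.sum_sub_distrib, Finset.sum_const, Finset.card_univ, nsmul_eq_mul, ← hN]
      field_simp
    have hsum' : ∑ i, (-X i) ω = -∑ i, X i ω := by simp
    rcases lt_abs.1 (show t < _ from hω) with h | h
    · left
      show N * t ≤ ∑ i, X i ω
      rw [hsum]
      gcongr
    · right
      show N * t ≤ ∑ i, (-X i) ω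
      rw [hsum', hsum, ← mul_neg]
      gcongr
  refine (measure_mono hsubset).trans ((measure_union_le _ _).trans ?_)
  rw [two_mul, ENNReal.ofReal_add (by positivity) (by positivity)]
  refine add_le_add ?_ ?_
  · exact (ENNReal.le_ofReal_iff_toReal_le (measure_ne_top _ _) (by positivity)).2 h1
  · exact (ENNReal.le_ofReal_iff_toReal_le (measure_ne_top _ _) (by positivity)).2 h2

theorem tendsto_natCast_rpow_mul_exp_neg (m : ℝ) {a b : ℝ} (ha : 0 < a) (hb : 0 < b) :
    Tendsto (fun n : ℕ => (n : ℝ) ^ m * Real.exp (-(b * (n : ℝ) ^ a))) atTop (𝓝 0) := by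
  have h1 : Tendsto (fun n : ℕ => (n : ℝ) ^ a) atTop atTop :=
    (tendsto_rpow_atTop ha).comp tendsto_natCast_atTop_atTop
  refine ((tendsto_rpow_mul_exp_neg_mul_atTop_nhds_zero (m / a) b hb).comp h1).congr fun n => ?_
  simp only [Function.comp_apply]
  rw [← Real.rpow_mul n.cast_nonneg, mul_div_cancel₀ _ ha.ne', neg_mul]

/-- Sample averages over polynomially many bounded functions are uniformly close to their means. -/
theorem wpa1_forall_abs_avg_sub_integral_le (P : Measure Ω) [IsProbabilityMeasure P]
    (F : Measure 𝒲) [IsProbabilityMeasure F] (W : ℕ → Ω → 𝒲)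
    (hW : ∀ i, Measurable (W i)) (hind : iIndepFun W P) (hlaw : ∀ i, P.map (W i) = F)
    {κ : ℕ → Type*} [∀ n, Fintype (κ n)] (e : ∀ n, κ n → ℕ) (he : ∀ n, Function.Injective (e n))
    (hcard : ∀ᶠ n : ℕ in atTop, (n : ℝ) / 4 ≤ Fintype.card (κ n))
    {ι : ℕ → Type*} [∀ n, Fintype (ι n)] {K m : ℝ}
    (hι : ∀ᶠ n : ℕ in atTop, (Fintype.card (ι n) : ℝ) ≤ K * (n : ℝ) ^ m)
    (φ : ∀ n, ι n → 𝒲 → ℝ) (hφ : ∀ n k, AEMeasurable (φ n k) F) {b : ℝ}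
    (hφb : ∀ᶠ n in atTop, ∀ k, ∀ᵐ w ∂F, |φ n k w| ≤ b) {d : ℝ} (hd : d < 1 / 2) :
    Wpa1 P fun n ω => ∀ k, |(Fintype.card (κ n) : ℝ)⁻¹ * ∑ i, φ n k (W (e n i) ω)
      - ∫ w, φ n k w ∂F| ≤ (n : ℝ) ^ (-d) := by
  -- Enlarging `b` provides the positivity that the Hoeffding exponent requires. With at least `n/4`
  -- summands and deviation `n^{-d}`, each tail decays like `exp(-n^{1-2d}/(8b'²))`, which beats the
  -- polynomial number of functions because `d < 1/2`.
  set b' : ℝ := max b 1 with hb'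
  have hb'pos : 0 < b' := lt_of_lt_of_le one_pos (le_max_right _ _)
  have hlim := (tendsto_natCast_rpow_mul_exp_neg m (a := 1 - 2 * d) (b := 1 / (8 * b' ^ 2))
    (by linarith) (by positivity)).const_mul (K * 2)
  rw [mul_zero] at hlim
  have hlim' := ENNReal.tendsto_ofReal hlim
  rw [ENNReal.ofReal_zero] at hlim'
  refine tendsto_of_tendsto_of_tendsto_of_le_of_le' tendsto_const_nhds hlim'
    (Eventually.of_forall fun _ => zero_le) ?_
  filter_upwards [hcard, hι, hφb, eventually_gt_atTop 0] with n hc hk hbd hn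
  have hnpos : (0 : ℝ) < n := by exact_mod_cast hn
  have : Nonempty (κ n) := by
    have : (0 : ℝ) < Fintype.card (κ n) := lt_of_lt_of_le (by positivity) hc
    exact Fintype.card_pos_iff.1 (by exact_mod_cast this)
  have hsub : {ω | ¬ ∀ k, |(Fintype.card (κ n) : ℝ)⁻¹ * ∑ i, φ n k (W (e n i) ω)
      - ∫ w, φ n k w ∂F| ≤ (n : ℝ) ^ (-d)}
      ⊆ ⋃ k, {ω | (n : ℝ) ^ (-d) < |(Fintype.card (κ n) : ℝ)⁻¹ * ∑ i, φ n k (W (e n i) ω)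
      - ∫ w, φ n k w ∂F|} := by
    intro ω hω
    simpa using hω
  refine (measure_mono hsub).trans ((measure_iUnion_fintype_le _ _).trans ?_)
  have hexp : ∀ k, P {ω | (n : ℝ) ^ (-d) < |(Fintype.card (κ n) : ℝ)⁻¹ *
      ∑ i, φ n k (W (e n i) ω) - ∫ w, φ n k w ∂F|}
      ≤ ENNReal.ofReal (2 * Real.exp (-(1 / (8 * b' ^ 2) * (n : ℝ) ^ (1 - 2 * d)))) := by
    intro k
    refine (measure_abs_avg_sub_integral_gt_le P F (fun i => W (e n i)) (fun i => hW _)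
      (hind.precomp (he n)) (fun i => hlaw _) (hφ n k) hb'pos
      ((hbd k).mono fun w hw => hw.trans (le_max_left _ _)) (by positivity)).trans ?_
    refine ENNReal.ofReal_le_ofReal ?_
    gcongr
    have e1 : (n : ℝ) ^ (1 - 2 * d) = n * ((n : ℝ) ^ (-d)) ^ 2 := by
      rw [← Real.rpow_natCast, ← Real.rpow_mul hnpos.le, ← Real.rpow_one_add' hnpos.le]
      · congr 1; push_cast; ring
      · push_cast; intro h; linarith
    rw [e1]
    calc 1 / (8 * b' ^ 2) * (n * ((n : ℝ) ^ (-d)) ^ 2)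
        = (n / 4) * ((n : ℝ) ^ (-d)) ^ 2 / (2 * b' ^ 2) := by field_simp; norm_num
      _ ≤ _ := by gcongr
  refine (Finset.sum_le_sum fun k _ => hexp k).trans ?_
  rw [Finset.sum_const, Finset.card_univ, nsmul_eq_mul, ← ENNReal.ofReal_natCast,
    ← ENNReal.ofReal_mul (by positivity)]
  refine ENNReal.ofReal_le_ofReal ?_
  calc (Fintype.card (ι n) : ℝ) * (2 * Real.exp (-(1 / (8 * b' ^ 2) * (n : ℝ) ^ (1 - 2 * d))))
      ≤ K * (n : ℝ) ^ m * (2 * Real.exp (-(1 / (8 * b' ^ 2) * (n : ℝ) ^ (1 - 2 * d)))) := by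
        gcongr
    _ = _ := by ring

end Hoeffding

/-! ### Population facts -/

namespace CMRModel

variable {𝒲 𝒴 B E : Type*} [MeasurableSpace 𝒲] [MeasurableSpace 𝒴]
  [NormedAddCommGroup B] [InnerProductSpace ℝ B] [CompleteSpace B]
  [NormedAddCommGroup E] [NormedSpace ℝ E]
  {J : ℕ} {𝒵 : Fin J → Type*} [∀ j, MeasurableSpace (𝒵 j)] {p : ℕ}
  (D : CMRModel 𝒲 𝒴 B E 𝒵 p)

instance isProbabilityMeasure_F₀ : IsProbabilityMeasure D.F₀ := D.isProb

instance isProbabilityMeasure_law (j : Fin J) : IsProbabilityMeasure (D.law j) :=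
  Measure.isProbabilityMeasure_map (D.measurable_Z j).aemeasurable

theorem measurePreserving_Z (j : Fin J) : MeasurePreserving (D.Z j) D.F₀ (D.law j) :=
  ⟨D.measurable_Z j, rfl⟩

theorem inner_L2Z (x y : D.L2Z) : inner ℝ x y = ∑ j, ∫ z, x j z * y j z ∂(D.law j) := by
  rw [PiLp.inner_apply]
  refine Finset.sum_congr rfl fun j _ => ?_
  rw [L2.inner_def]
  refine integral_congr_ae (Eventually.of_forall fun z => ?_)
  simp [mul_comm]

theorem norm_sq_L2Z (x : D.L2Z) : ‖x‖ ^ 2 = ∑ j, ∫ z, x j z ^ 2 ∂(D.law j) := by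
  rw [← real_inner_self_eq_norm_sq, inner_L2Z]
  simp_rw [sq]

theorem coeFn_sub_sum_smul {ι : Type*} [Fintype ι] (y : D.L2Z) (x : ι → D.L2Z) (b : ι → ℝ)
    (j : Fin J) : (((y - ∑ k, b k • x k) j : Lp ℝ 2 (D.law j)) : 𝒵 j → ℝ)
      =ᵐ[D.law j] fun z => y j z - ∑ k, x k j z * b k := by
  have h1 : (y - ∑ k, b k • x k) j = y j - ∑ k, b k • x k j := by
    rw [PiLp.sub_apply, WithLp.ofLp_sum, Finset.sum_apply]
    rfl
  rw [h1]
  have h2 := Lp.coeFn_sub (y j) (∑ k, b k • x k j)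
  have h3 := Lp.coeFn_finsetSum (p := 2) (μ := D.law j) Finset.univ fun k => b k • x k j
  have h4 : ∀ᵐ z ∂(D.law j), ∀ k, (b k • x k j : Lp ℝ 2 (D.law j)) z = b k * x k j z :=
    ae_all_iff.2 fun k => (Lp.coeFn_smul (b k) (x k j)).mono fun z hz => by simpa using hz
  filter_upwards [h2, h3, h4] with z h2 h3 h4
  rw [h2, Pi.sub_apply, h3, Finset.sum_apply]
  simp_rw [h4, mul_comm]

/-- The instrument `κ₀` is orthogonal to the range of `S`. -/
theorem inner_S_kappa₀ (f : D.L2Z) (b : B) : inner ℝ (D.S b) (D.kappa₀ f) = 0 := by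
  refine Submodule.sub_starProjection_mem_orthogonal (K := D.rangeClosure) f _ ?_
  exact Submodule.le_topologicalClosure _ ⟨b, rfl⟩

end CMRModel

/-! ### Gram representation, the sparse oracle, and the order of `ε_n` -/

namespace Design

variable {𝒲 𝒴 B E : Type*} [MeasurableSpace 𝒲] [MeasurableSpace 𝒴]
  [NormedAddCommGroup B] [InnerProductSpace ℝ B] [CompleteSpace B]
  [NormedAddCommGroup E] [NormedSpace ℝ E]
  {J : ℕ} {𝒵 : Fin J → Type*} [∀ j, MeasurableSpace (𝒵 j)] {p : ℕ}
  {D : CMRModel 𝒲 𝒴 B E 𝒵 p} {q L : ℕ} (C : Design D q L)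

/-- The population regressors `S S* γ_k` as elements of `L²(Z)`. -/
def Mvec (n : ℕ) (k : C.Idx n) : D.L2Z := D.regressor (C.γL n k)

/-- Lets the matrix conditions of the Lasso step be read as statements about norms and inner
products in `L²(Z)`, where the deterministic Lasso bounds apply. -/
theorem G_eq_gram (n : ℕ) : C.G n = Matrix.gram ℝ (C.Mvec n) := by
  ext k l
  rw [Matrix.gram_apply, CMRModel.inner_L2Z, G, Matrix.sum_apply]
  rfl

theorem dotProduct_G_mulVec (n : ℕ) (v : C.Idx n → ℝ) :
    v ⬝ᵥ (C.G n).mulVec v = ‖∑ k, v k • C.Mvec n k‖ ^ 2 := by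
  rw [G_eq_gram, ← real_inner_self_eq_norm_sq]
  exact Matrix.star_dotProduct_gram_mulVec (C.Mvec n) v v

theorem inner_Mvec_sub_of_isProjSlope {n : ℕ} {a : Fin q} {b : C.Idx n → ℝ}
    (h : C.IsProjSlope n a b) (k : C.Idx n) :
    inner ℝ (C.Mvec n k) (C.fStar a - ∑ l, b l • C.Mvec n l) = 0 := by
  rw [← h k, CMRModel.inner_L2Z]
  refine Finset.sum_congr rfl fun j _ => integral_congr_ae ?_
  filter_upwards [D.coeFn_sub_sum_smul (C.fStar a) (C.Mvec n) b j] with z hz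
  rw [hz]
  rfl

theorem norm_sq_fStar_sub (n : ℕ) (a : Fin q) (b : C.Idx n → ℝ) :
    ‖C.fStar a - ∑ k, b k • C.Mvec n k‖ ^ 2
      = ∑ j, ∫ z, (C.fStar a j z - ∑ k, C.M n j k z * b k) ^ 2 ∂(D.law j) := by
  rw [CMRModel.norm_sq_L2Z]
  refine Finset.sum_congr rfl fun j _ => integral_congr_ae ?_
  filter_upwards [D.coeFn_sub_sum_smul (C.fStar a) (C.Mvec n) b j] with z hz
  rw [hz]
  rfl

/-- The regressors lie in the range of `S`, to which `f - f*` is orthogonal. Hence regressing the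
known `f` on them has the same normal equations as regressing the unknown `f*`. -/
theorem inner_Mvec_fL (n : ℕ) (a : Fin q) (k : C.Idx n) :
    inner ℝ (C.Mvec n k) (C.fL a) = inner ℝ (C.Mvec n k) (C.fStar a) := by
  have h := D.inner_S_kappa₀ (C.fL a) (ContinuousLinearMap.adjoint D.S (C.γL n k))
  rw [CMRModel.kappa₀, inner_sub_right, sub_eq_zero] at h
  exact h

/-- A sparse oracle coefficient vector together with the restricted eigenvalue bound on its
support. -/
theorem exists_sparse_oracle {ε : ℕ → ℝ} {ξ : ℝ} (hξ : 0 < ξ) {βbar : ∀ n, Fin q → C.Idx n → ℝ}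
    (hε : ∀ᶠ n in atTop, 0 < ε n) (hε0 : Tendsto ε atTop (𝓝 0))
    (hsparse : C.ApproxSparse ε ξ βbar) (heigen : C.SparseEigen ε)
    (hβs : C.BetaStarBounded ε βbar) :
    ∃ K c₀ : ℝ, 0 < K ∧ 0 < c₀ ∧ ∀ᶠ n in atTop, ∀ a, ∃ (A : Finset (C.Idx n)) (βs : C.Idx n → ℝ),
      (∀ k, |inner ℝ (C.Mvec n k) (C.fL a - ∑ l, βs l • C.Mvec n l)| ≤ ε n) ∧
      ‖C.fStar a - ∑ k, βs k • C.Mvec n k‖ ^ 2 ≤ K * A.card * ε n ^ 2 ∧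
      ∑ k ∈ Aᶜ, |βs k| ≤ K * A.card * ε n ∧ ∑ k, |βs k| ≤ K ∧
      (A.card : ℝ) ≤ K * ε n ^ (-2 / (2 * ξ + 1)) ∧
      ∀ δ : C.Idx n → ℝ, ∑ k ∈ Aᶜ, |δ k| ≤ 3 * ∑ k ∈ A, |δ k| →
        c₀ * ∑ k ∈ A, δ k ^ 2 ≤ ‖∑ k, δ k • C.Mvec n k‖ ^ 2 := by
  obtain ⟨K₁, hK₁, hsp⟩ := hsparse
  obtain ⟨-, K₂, hK₂, c₀, hc₀, hre⟩ := heigen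
  obtain ⟨K₃, hbd⟩ := hβs
  -- The exponent is `2 - 2/(2ξ+1)`. Thus the sparsity `O(ε^{-2/(2ξ+1)})` is of smaller order than
  -- `ε^{-2}`, and the support of `βbar` is eventually admissible in the eigenvalue condition.
  have hexp : Tendsto (fun n => K₁ * ε n ^ (4 * ξ / (2 * ξ + 1))) atTop (𝓝 0) := by
    have : 0 < 4 * ξ / (2 * ξ + 1) := by positivity
    have h := (hε0.rpow_const (Or.inr this.le)).const_mul K₁
    rwa [Real.zero_rpow this.ne', mul_zero] at h
  refine ⟨max (2 * K₁) K₃, c₀, lt_max_of_lt_left (by linarith), hc₀, ?_⟩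
  filter_upwards [hsp, hre, hbd, hε, hexp.eventually_lt_const hK₂] with n hsp hre hbd hε hexp a
  obtain ⟨β₀, βs, hproj, hmin, hK₃⟩ := hbd a
  obtain ⟨happ, hcard⟩ := hsp a
  set A : Finset (C.Idx n) := Finset.univ.filter fun k => βbar n a k ≠ 0 with hA
  have hAc : Finset.univ.filter (fun k => βbar n a k = 0) = Aᶜ := by
    ext k
    simp [hA]
  rw [hAc] at hmin
  have hmin' : IsMinOn (fun v : C.Idx n → ℝ => ‖∑ k, (β₀ k - v k) • C.Mvec n k‖ ^ 2
      + 2 * ε n * ∑ k ∈ Aᶜ, |v k|) Set.univ βs := by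
    simp_rw [dotProduct_G_mulVec] at hmin
    exact hmin
  rw [← norm_sq_fStar_sub] at happ
  obtain ⟨h1, h2, h3⟩ := penalized_minimizer_bound (C.Mvec n) (C.fStar a) A hε β₀ βs (βbar n a)
    (C.inner_Mvec_sub_of_isProjSlope hproj) hmin' (fun k hk => by simpa [hA] using hk) happ
  refine ⟨A, βs, ?_, ?_, ?_, hK₃.trans (le_max_right _ _), ?_, ?_⟩
  · intro k
    rw [inner_sub_right, inner_Mvec_fL, ← inner_sub_right]
    exact h1 k
  · refine h2.trans ?_
    calc 2 * (K₁ * A.card * ε n ^ 2) = 2 * K₁ * A.card * ε n ^ 2 := by ring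
      _ ≤ _ := by gcongr; exact le_max_left _ _
  · have h4 : ε n * (2 * ∑ k ∈ Aᶜ, |βs k|) ≤ ε n * (K₁ * A.card * ε n) := by
      calc _ = 2 * ε n * ∑ k ∈ Aᶜ, |βs k| := by ring
        _ ≤ _ := h3
        _ = _ := by ring
    have h5 := le_of_mul_le_mul_left h4 hε
    have h6 : 0 ≤ ∑ k ∈ Aᶜ, |βs k| := Finset.sum_nonneg fun k _ => abs_nonneg _
    calc ∑ k ∈ Aᶜ, |βs k| ≤ K₁ * A.card * ε n := by linarith
      _ ≤ _ := by gcongr; exact le_trans (by linarith) (le_max_left _ _)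
  · refine hcard.trans ?_
    gcongr
    exact le_trans (by linarith) (le_max_left _ _)
  · intro δ hδ
    have hAcard : (A.card : ℝ) ≤ K₂ * ε n ^ (-2 : ℝ) := by
      refine hcard.trans ?_
      have e : ε n ^ (-2 / (2 * ξ + 1)) = ε n ^ (4 * ξ / (2 * ξ + 1)) * ε n ^ (-2 : ℝ) := by
        rw [← Real.rpow_add hε]
        congr 1
        field_simp
        ring
      rw [e, ← mul_assoc]
      gcongr
    -- The eigenvalue condition is stated as a quotient, so a vanishing denominator is treated
    -- apart; there the bound is trivial.
    rcases (Finset.sum_nonneg fun k (_ : k ∈ A) => sq_nonneg (δ k)).eq_or_lt with h0 | h0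
    · rw [← h0, mul_zero]
      positivity
    · have hδ0 : δ ≠ 0 := by
        rintro rfl
        simp at h0
      have := hre A δ hδ0 hAcard hδ
      rw [lt_div_iff₀ h0, dotProduct_G_mulVec] at this
      exact this.le

/-- Since `r` is polynomially bounded, `√(log r / n)` is `n^{-1/2}` up to a logarithmic factor,
hence below `n^{c - dmin}` because `dmin - c < 1/2`. The maximum over `j` is attained where `d j =
dmin`. -/
theorem eps_eq_eventually {c : ℝ} {d : Fin J → ℝ} {dmin : ℝ} (hc : 0 < c)
    (hdmin : IsLeast (Set.range d) dmin) (hdmin_lt : dmin < 1 / 2) (hr : C.DictionaryGrowth) :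
    ∀ᶠ n : ℕ in atTop, C.eps c d n = (n : ℝ) ^ (c - dmin) := by
  obtain ⟨C₁, hC₁, c₂, hc₂, hr⟩ := hr
  obtain ⟨⟨j₀, hj₀⟩, hlb⟩ := hdmin
  have : Nonempty (Fin J) := ⟨j₀⟩
  have hpos : 0 < 1 + 2 * (c - dmin) := by linarith
  have hlog : ∀ᶠ n : ℕ in atTop, Real.log C₁ + c₂ * Real.log n ≤ (n : ℝ) ^ (1 + 2 * (c - dmin)) := by
    have h1 : (fun x : ℝ => Real.log C₁ + c₂ * Real.log x) =o[atTop]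
        fun x => x ^ (1 + 2 * (c - dmin)) := by
      refine Asymptotics.IsLittleO.add ?_ ((isLittleO_log_rpow_atTop hpos).const_mul_left c₂)
      exact Asymptotics.isLittleO_const_left.2
        (Or.inr (tendsto_norm_atTop_atTop.comp (tendsto_rpow_atTop hpos)))
    have h2 := (h1.bound one_pos)
    filter_upwards [tendsto_natCast_atTop_atTop.eventually h2] with n hn
    rw [one_mul, Real.norm_of_nonneg (Real.rpow_nonneg n.cast_nonneg _)] at hn
    exact (Real.le_norm_self _).trans hn
  filter_upwards [hr, hlog, eventually_ge_atTop 1] with n hr hlog hn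
  have hn1 : (1 : ℝ) ≤ n := by exact_mod_cast hn
  have hn0 : (0 : ℝ) < n := by linarith
  have hsqrt : √(Real.log (C.rTot n) / n) ≤ (n : ℝ) ^ (c - dmin) := by
    rw [Real.sqrt_le_left (by positivity), div_le_iff₀ hn0]
    have e : ((n : ℝ) ^ (c - dmin)) ^ 2 * n = (n : ℝ) ^ (1 + 2 * (c - dmin)) := by
      rw [Real.rpow_add hn0, Real.rpow_one, mul_comm 2, Real.rpow_mul hn0.le]
      norm_cast
      ring
    rw [e]
    rcases Nat.eq_zero_or_pos (C.rTot n) with h0 | h0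
    · rw [h0]
      simp only [Nat.cast_zero, Real.log_zero]
      positivity
    · have h0' : (0 : ℝ) < C.rTot n := by exact_mod_cast h0
      refine le_trans ?_ hlog
      calc Real.log (C.rTot n) ≤ Real.log (C₁ * (n : ℝ) ^ c₂) := Real.log_le_log h0' hr
        _ = _ := by rw [Real.log_mul hC₁.ne' (by positivity), Real.log_rpow hn0]
  have hle : ∀ j, (n : ℝ) ^ c * (n : ℝ) ^ (-d j) ≤ (n : ℝ) ^ (c - dmin) := fun j => by
    rw [← Real.rpow_add hn0]
    exact Real.rpow_le_rpow_of_exponent_le hn1 (by linarith [hlb ⟨j, rfl⟩])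
  refine le_antisymm (ciSup_le fun j => max_le (max_le hsqrt (hle j)) ?_) ?_
  · exact Real.rpow_le_rpow_of_exponent_le hn1 (by linarith [hlb ⟨j, rfl⟩])
  · have h1 : (n : ℝ) ^ (c - dmin) ≤ max (C.epsG c d n j₀) ((n : ℝ) ^ (-d j₀)) := by
      refine le_max_of_le_left (le_max_of_le_right ?_)
      rw [← Real.rpow_add hn0, hj₀, sub_eq_add_neg]
    exact h1.trans (le_ciSup (f := fun j => max (C.epsG c d n j) ((n : ℝ) ^ (-d j)))
      (Set.finite_range _).bddAbove j₀)

end Design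

/-! ### Sample moments of the Lasso regression -/

namespace Design

variable {𝒲 𝒴 B E : Type*} [MeasurableSpace 𝒲] [MeasurableSpace 𝒴]
  [NormedAddCommGroup B] [InnerProductSpace ℝ B] [CompleteSpace B]
  [NormedAddCommGroup E] [NormedSpace ℝ E]
  {J : ℕ} {𝒵 : Fin J → Type*} [∀ j, MeasurableSpace (𝒵 j)] {p : ℕ}
  {D : CMRModel 𝒲 𝒴 B E 𝒵 p} {q L : ℕ} (C : Design D q L)

theorem card_Out_add (n : ℕ) (ℓ : Fin L) :
    Fintype.card (C.Out n ℓ) + (Finset.univ.filter fun i => C.fold n i = ℓ).card = n := by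
  rw [Fintype.card_subtype, add_comm]
  have := Finset.card_filter_add_card_filter_not (s := (Finset.univ : Finset (Fin n)))
    (fun i => C.fold n i = ℓ)
  simpa using this

/-- There is a second fold, contained in the complement of `I_ℓ` and at most one observation smaller
than `I_ℓ`. Hence `n ≤ 2N + 1`, where `N` is the size of the complement. -/
theorem le_card_Out (ℓ : Fin L) :
    ∀ᶠ n : ℕ in atTop, (n : ℝ) / 4 ≤ Fintype.card (C.Out n ℓ) := by
  filter_upwards [eventually_ge_atTop 2] with n hn
  have : Nontrivial (Fin L) := Fin.nontrivial_iff_two_le.2 C.two_le_L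
  obtain ⟨ℓ', hℓ'⟩ := exists_ne ℓ
  have h1 := C.card_Out_add n ℓ
  have h2 := C.balanced n ℓ ℓ'
  have h3 : (Finset.univ.filter fun i => C.fold n i = ℓ').card ≤ Fintype.card (C.Out n ℓ) := by
    rw [Fintype.card_subtype]
    refine Finset.card_le_card fun i hi => ?_
    simp only [Finset.mem_filter, Finset.mem_univ, true_and] at hi ⊢
    rw [hi]
    exact hℓ'
  have h4 : n ≤ 4 * Fintype.card (C.Out n ℓ) := by omega
  have h5 : (n : ℝ) ≤ 4 * Fintype.card (C.Out n ℓ) := by exact_mod_cast h4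
  linarith

/-- The vector of values of `(g_j(Z_j))_j` in the training sample, normalised so that inner
products are sums of sample averages. -/
def sampleVec {n : ℕ} {ℓ : Fin L} (t : C.Train n ℓ) (g : ∀ j, 𝒵 j → ℝ) :
    EuclideanSpace ℝ (Fin J × C.Out n ℓ) :=
  WithLp.toLp 2 fun x => √((Fintype.card (C.Out n ℓ) : ℝ)⁻¹) * g x.1 (D.Z x.1 (t x.2))

variable {n : ℕ} {ℓ : Fin L} (t : C.Train n ℓ)

theorem inner_sampleVec (g g' : ∀ j, 𝒵 j → ℝ) :
    inner ℝ (C.sampleVec t g) (C.sampleVec t g') = ∑ j, (Fintype.card (C.Out n ℓ) : ℝ)⁻¹ *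
      ∑ i, g j (D.Z j (t i)) * g' j (D.Z j (t i)) := by
  rw [PiLp.inner_apply, Fintype.sum_prod_type]
  refine Finset.sum_congr rfl fun j _ => ?_
  rw [Finset.mul_sum]
  refine Finset.sum_congr rfl fun i _ => ?_
  have h : √((Fintype.card (C.Out n ℓ) : ℝ)⁻¹) * √((Fintype.card (C.Out n ℓ) : ℝ)⁻¹)
      = (Fintype.card (C.Out n ℓ) : ℝ)⁻¹ := Real.mul_self_sqrt (by positivity)
  simp only [sampleVec, RCLike.inner_apply, conj_trivial]
  linear_combination (g j (D.Z j (t i)) * g' j (D.Z j (t i))) * h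

theorem norm_sq_sampleVec (g : ∀ j, 𝒵 j → ℝ) :
    ‖C.sampleVec t g‖ ^ 2 = ∑ j, (Fintype.card (C.Out n ℓ) : ℝ)⁻¹ *
      ∑ i, g j (D.Z j (t i)) ^ 2 := by
  rw [← real_inner_self_eq_norm_sq, inner_sampleVec]
  simp_rw [sq]

theorem sampleVec_sub (g g' : ∀ j, 𝒵 j → ℝ) :
    C.sampleVec t g - C.sampleVec t g' = C.sampleVec t fun j z => g j z - g' j z := by
  ext x
  simp [sampleVec, mul_sub]

theorem sampleVec_sub_sum {ι : Type*} [Fintype ι] (g : ∀ j, 𝒵 j → ℝ) (x : ι → ∀ j, 𝒵 j → ℝ)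
    (b : ι → ℝ) : C.sampleVec t g - ∑ k, b k • C.sampleVec t (x k)
      = C.sampleVec t fun j z => g j z - ∑ k, x k j z * b k := by
  ext x
  simp only [sampleVec, PiLp.sub_apply, WithLp.ofLp_sum, Finset.sum_apply, PiLp.smul_apply,
    smul_eq_mul, mul_sub, Finset.mul_sum]
  congr 1
  exact Finset.sum_congr rfl fun k _ => by ring

theorem norm_sampleVec_le {g : ∀ j, 𝒵 j → ℝ} {b : ℝ} (hb : 0 ≤ b)
    (h : ∀ j i, |g j (D.Z j (t i))| ≤ b) : ‖C.sampleVec t g‖ ≤ J * b := by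
  refine (abs_le_of_sq_le_sq' ?_ (by positivity)).2
  rw [norm_sq_sampleVec]
  calc ∑ j, (Fintype.card (C.Out n ℓ) : ℝ)⁻¹ * ∑ i, g j (D.Z j (t i)) ^ 2
      ≤ ∑ _j : Fin J, b ^ 2 := by
        refine Finset.sum_le_sum fun j _ => ?_
        have h1 : ∑ i, g j (D.Z j (t i)) ^ 2 ≤ ∑ _i : C.Out n ℓ, b ^ 2 :=
          Finset.sum_le_sum fun i _ => sq_le_sq' (abs_le.1 (h j i)).1 (abs_le.1 (h j i)).2
        rw [Finset.sum_const, Finset.card_univ, nsmul_eq_mul] at h1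
        rcases Nat.eq_zero_or_pos (Fintype.card (C.Out n ℓ)) with h0 | h0
        · rw [h0]
          simp only [Nat.cast_zero, inv_zero, zero_mul]
          positivity
        · have h0' : (0 : ℝ) < Fintype.card (C.Out n ℓ) := by exact_mod_cast h0
          rw [inv_mul_le_iff₀ h0']
          exact h1
    _ = J * b ^ 2 := by simp
    _ ≤ (J * b) ^ 2 := by
        rw [mul_pow]
        refine mul_le_mul_of_nonneg_right ?_ (sq_nonneg b)
        exact_mod_cast Nat.le_self_pow two_ne_zero J

end Design

section

variable {H : Type*} [NormedAddCommGroup H] [InnerProductSpace ℝ H]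

/-- Expand the difference around `x` and `y` and apply Cauchy–Schwarz to each of the three terms. -/
theorem abs_inner_sub_inner_le (x y x' y' : H) {b e : ℝ} (hx : ‖x‖ ≤ b) (hy : ‖y‖ ≤ b)
    (hx' : ‖x' - x‖ ≤ e) (hy' : ‖y' - y‖ ≤ e) :
    |inner ℝ x' y' - inner ℝ x y| ≤ e * e + 2 * (b * e) := by
  have he : 0 ≤ e := (norm_nonneg _).trans hx'
  have hb : 0 ≤ b := (norm_nonneg _).trans hx
  have h : inner ℝ x' y' - inner ℝ x y
      = inner ℝ (x' - x) (y' - y) + inner ℝ (x' - x) y + inner ℝ x (y' - y) := by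
    simp only [inner_sub_left, inner_sub_right]
    ring
  rw [h]
  have h1 := (abs_real_inner_le_norm (x' - x) (y' - y)).trans
    (mul_le_mul hx' hy' (norm_nonneg _) he)
  have h2 := (abs_real_inner_le_norm (x' - x) y).trans (mul_le_mul hx' hy (norm_nonneg _) he)
  have h3 := (abs_real_inner_le_norm x (y' - y)).trans (mul_le_mul hx hy' (norm_nonneg _) hb)
  have h4 := abs_add_three (inner ℝ (x' - x) (y' - y)) (inner ℝ (x' - x) y) (inner ℝ x (y' - y))
  linarith

end

/-! ### Concentration of the moments formed with population regressors -/

namespace Design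

variable {𝒲 𝒴 B E : Type*} [MeasurableSpace 𝒲] [MeasurableSpace 𝒴]
  [NormedAddCommGroup B] [InnerProductSpace ℝ B] [CompleteSpace B]
  [NormedAddCommGroup E] [NormedSpace ℝ E]
  {J : ℕ} {𝒵 : Fin J → Type*} [∀ j, MeasurableSpace (𝒵 j)] {p : ℕ}
  {D : CMRModel 𝒲 𝒴 B E 𝒵 p} {q L : ℕ} (C : Design D q L)
  {Ω : Type*} [MeasurableSpace Ω] (P : Measure Ω) (W : ℕ → Ω → 𝒲)

theorem card_Idx (n : ℕ) : Fintype.card (C.Idx n) = C.rTot n := by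
  simp [rTot, Fintype.card_sigma]

theorem ae_sample_of_ae_law (hW : ∀ i, Measurable (W i)) (hWlaw : ∀ i, P.map (W i) = D.F₀)
    {j : Fin J} {A : 𝒵 j → Prop} (h : ∀ᵐ z ∂(D.law j), A z) :
    ∀ᵐ ω ∂P, ∀ i, A (D.Z j (W i ω)) := by
  refine ae_all_iff.2 fun i => ?_
  have h1 : ∀ᵐ w ∂D.F₀, A (D.Z j w) := ae_of_ae_map (D.measurable_Z j).aemeasurable h
  rw [← hWlaw i] at h1
  exact ae_of_ae_map (hW i).aemeasurable h1

variable [IsProbabilityMeasure P]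

/-- Averages over the training sample of polynomially many bounded functions are uniformly close
to their means. -/
theorem wpa1_forall_abs_avg_Out_sub_integral_le (hW : ∀ i, Measurable (W i))
    (hWlaw : ∀ i, P.map (W i) = D.F₀) (hWind : iIndepFun W P) (ℓ : Fin L)
    (ι : ℕ → Type*) [∀ n, Fintype (ι n)] (K m b : ℝ)
    (φ : ∀ n, ι n → 𝒲 → ℝ) (hφ : ∀ n k, AEMeasurable (φ n k) D.F₀)
    (hφb : ∀ᶠ n in atTop, ∀ k, ∀ᵐ w ∂D.F₀, |φ n k w| ≤ b)
    (hι : ∀ᶠ n : ℕ in atTop, (Fintype.card (ι n) : ℝ) ≤ K * (n : ℝ) ^ m)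
    {d : ℝ} (hd : d < 1 / 2) :
    Wpa1 P fun n ω => ∀ k, |(Fintype.card (C.Out n ℓ) : ℝ)⁻¹ *
      ∑ i : C.Out n ℓ, φ n k (W i.1.1 ω) - ∫ w, φ n k w ∂D.F₀| ≤ (n : ℝ) ^ (-d) :=
  wpa1_forall_abs_avg_sub_integral_le P D.F₀ W hW hWind hWlaw (κ := fun n => C.Out n ℓ)
    (ι := ι) (fun _ i => i.1.1) (fun _ => Fin.val_injective.comp Subtype.val_injective)
    (C.le_card_Out ℓ) hι φ hφ hφb hd

/-- The sample moments formed with the population regressors are uniformly close to the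
population moments. -/
theorem wpa1_sample_moments (hW : ∀ i, Measurable (W i)) (hWlaw : ∀ i, P.map (W i) = D.F₀)
    (hWind : iIndepFun W P) (hM : C.BoundedM) {bf : ℝ}
    (hf : ∀ a j, ∀ᵐ z ∂(D.law j), |C.f a j z| ≤ bf) (hr : C.DictionaryGrowth) (ℓ : Fin L)
    {d : ℝ} (hd : d < 1 / 2) :
    Wpa1 P fun n ω =>
      (∀ k l, |inner ℝ (C.sampleVec (C.train W n ℓ ω) fun j => C.M n j k)
        (C.sampleVec (C.train W n ℓ ω) fun j => C.M n j l) - inner ℝ (C.Mvec n k) (C.Mvec n l)|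
        ≤ J * (n : ℝ) ^ (-d)) ∧
      ∀ k a, |inner ℝ (C.sampleVec (C.train W n ℓ ω) fun j => C.M n j k)
        (C.sampleVec (C.train W n ℓ ω) (C.f a)) - inner ℝ (C.Mvec n k) (C.fL a)|
        ≤ J * (n : ℝ) ^ (-d) := by
  obtain ⟨cM, hcM⟩ := hM
  obtain ⟨C₁, hC₁, c₂, hc₂, hr⟩ := hr
  have hsum : ∀ (n : ℕ) (u v : Fin J → ℝ), (∀ j, |u j - v j| ≤ (n : ℝ) ^ (-d)) →
      |∑ j, u j - ∑ j, v j| ≤ J * (n : ℝ) ^ (-d) := by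
    intro n u v h
    rw [← Finset.sum_sub_distrib]
    refine (Finset.abs_sum_le_sum_abs _ _).trans ((Finset.sum_le_sum fun j _ => h j).trans ?_)
    simp
  have hMm : ∀ n j k, Measurable (C.M n j k) := fun n j k => (Lp.stronglyMeasurable _).measurable
  have hfm : ∀ a j, AEMeasurable (fun w => C.f a j (D.Z j w)) D.F₀ := fun a j =>
    (C.memLp_f a j).1.aemeasurable.comp_measurable (D.measurable_Z j)
  have hMb : ∀ j, ∀ᶠ n in atTop, ∀ k, ∀ᵐ w ∂D.F₀, |C.M n j k (D.Z j w)| ≤ cM j := fun j => by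
    filter_upwards [hcM] with n hn k
    exact ae_of_ae_map (D.measurable_Z j).aemeasurable ((hn j).mono fun z hz => hz k)
  have hfb : ∀ a j, ∀ᵐ w ∂D.F₀, |C.f a j (D.Z j w)| ≤ bf := fun a j =>
    ae_of_ae_map (D.measurable_Z j).aemeasurable (hf a j)
  have h1 : ∀ j, Wpa1 P fun n ω => ∀ x : C.Idx n × C.Idx n,
      |(Fintype.card (C.Out n ℓ) : ℝ)⁻¹ * ∑ i : C.Out n ℓ,
        C.M n j x.1 (D.Z j (W i.1.1 ω)) * C.M n j x.2 (D.Z j (W i.1.1 ω))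
        - ∫ w, C.M n j x.1 (D.Z j w) * C.M n j x.2 (D.Z j w) ∂D.F₀| ≤ (n : ℝ) ^ (-d) := by
    intro j
    refine C.wpa1_forall_abs_avg_Out_sub_integral_le P W hW hWlaw hWind ℓ
      (fun n => C.Idx n × C.Idx n) (C₁ * C₁) (c₂ + c₂) (cM j * cM j)
      (fun n x w => C.M n j x.1 (D.Z j w) * C.M n j x.2 (D.Z j w)) ?_ ?_ ?_ hd
    rotate_left 2
    · filter_upwards [hr, eventually_gt_atTop 0] with n hn hn0
      have hn0' : (0 : ℝ) < n := by exact_mod_cast hn0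
      rw [Fintype.card_prod, card_Idx, Nat.cast_mul, Real.rpow_add hn0']
      calc (C.rTot n : ℝ) * C.rTot n ≤ (C₁ * (n : ℝ) ^ c₂) * (C₁ * (n : ℝ) ^ c₂) := by gcongr
        _ = _ := by ring
    · intro n x
      exact (((hMm n j _).comp (D.measurable_Z j)).mul
        ((hMm n j _).comp (D.measurable_Z j))).aemeasurable
    · filter_upwards [hMb j] with n hn x
      filter_upwards [hn x.1, hn x.2] with w h1 h2
      rw [abs_mul]
      exact mul_le_mul h1 h2 (abs_nonneg _) ((abs_nonneg _).trans h1)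
  have h2 : ∀ j, Wpa1 P fun n ω => ∀ x : C.Idx n × Fin q,
      |(Fintype.card (C.Out n ℓ) : ℝ)⁻¹ * ∑ i : C.Out n ℓ,
        C.M n j x.1 (D.Z j (W i.1.1 ω)) * C.f x.2 j (D.Z j (W i.1.1 ω))
        - ∫ w, C.M n j x.1 (D.Z j w) * C.f x.2 j (D.Z j w) ∂D.F₀| ≤ (n : ℝ) ^ (-d) := by
    intro j
    refine C.wpa1_forall_abs_avg_Out_sub_integral_le P W hW hWlaw hWind ℓ
      (fun n => C.Idx n × Fin q) (C₁ * q) c₂ (cM j * bf)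
      (fun n x w => C.M n j x.1 (D.Z j w) * C.f x.2 j (D.Z j w)) ?_ ?_ ?_ hd
    rotate_left 2
    · filter_upwards [hr] with n hn
      rw [Fintype.card_prod, card_Idx, Nat.cast_mul, Fintype.card_fin]
      calc (C.rTot n : ℝ) * q ≤ (C₁ * (n : ℝ) ^ c₂) * q := by gcongr
        _ = _ := by ring
    · intro n x
      exact ((hMm n j _).comp (D.measurable_Z j)).aemeasurable.mul (hfm x.2 j)
    · filter_upwards [hMb j] with n hn x
      filter_upwards [hn x.1, hfb x.2 j] with w h1 h2
      rw [abs_mul]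
      exact mul_le_mul h1 h2 (abs_nonneg _) ((abs_nonneg _).trans h1)
  refine ((Wpa1.forall h1).and (Wpa1.forall h2)).mono (Eventually.of_forall fun n ω hω => ⟨?_, ?_⟩)
  · intro k l
    rw [inner_sampleVec, CMRModel.inner_L2Z]
    refine hsum n _ _ fun j => ?_
    have := hω.1 j (k, l)
    rwa [← integral_map (D.measurable_Z j).aemeasurable
      (f := fun z => C.M n j k z * C.M n j l z)
      ((hMm n j k).mul (hMm n j l)).aestronglyMeasurable] at this
  · intro k a
    rw [inner_sampleVec, CMRModel.inner_L2Z]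
    refine hsum n _ _ fun j => ?_
    have := hω.2 j (k, a)
    rw [← integral_map (D.measurable_Z j).aemeasurable
      (f := fun z => C.M n j k z * C.f a j z)
      ((hMm n j k).aemeasurable.mul (C.memLp_f a j).1.aemeasurable).aestronglyMeasurable] at this
    have hcongr : ∫ z, C.Mvec n k j z * C.fL a j z ∂(D.law j)
        = ∫ z, C.M n j k z * C.f a j z ∂(D.law j) := by
      refine integral_congr_ae ?_
      filter_upwards [(C.memLp_f a j).coeFn_toLp] with z hz
      have : C.fL a j z = C.f a j z := hz
      rw [this]
      rfl
    rw [hcongr]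
    exact this

end Design

namespace Estimators

variable {𝒲 𝒴 B E : Type*} [MeasurableSpace 𝒲] [MeasurableSpace 𝒴]
  [NormedAddCommGroup B] [InnerProductSpace ℝ B] [CompleteSpace B]
  [NormedAddCommGroup E] [NormedSpace ℝ E]
  {J : ℕ} {𝒵 : Fin J → Type*} [∀ j, MeasurableSpace (𝒵 j)] {p : ℕ}
  {D : CMRModel 𝒲 𝒴 B E 𝒵 p} {q L : ℕ} {C : Design D q L} (T : Estimators C)
  {Ω : Type*} [MeasurableSpace Ω] (P : Measure Ω) [IsProbabilityMeasure P] (W : ℕ → Ω → 𝒲)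

/-- The sample vector of an estimated regressor. -/
def MhatVec {n : ℕ} {ℓ : Fin L} (t : C.Train n ℓ) (k : C.Idx n) :
    EuclideanSpace ℝ (Fin J × C.Out n ℓ) :=
  C.sampleVec t fun j => T.Mhat n ℓ j k t

/-- Puts the Lasso criterion into Euclidean form, so that the deterministic bounds apply to the
sample regressors. -/
theorem lasso_norm_sq {n : ℕ} {ℓ : Fin L} (t : C.Train n ℓ) (a : Fin q) (β : C.Idx n → ℝ) :
    ‖C.sampleVec t (C.f a) - ∑ k, T.βhat n ℓ a t k • T.MhatVec t k‖ ^ 2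
        + 2 * C.lam n * ∑ k, |T.βhat n ℓ a t k|
      ≤ ‖C.sampleVec t (C.f a) - ∑ k, β k • T.MhatVec t k‖ ^ 2 + 2 * C.lam n * ∑ k, |β k| := by
  simp_rw [MhatVec, Design.sampleVec_sub_sum, Design.norm_sq_sampleVec]
  exact T.lasso n ℓ a t (Set.mem_univ β)

/-- The sample moments of the Lasso regression are uniformly close to the population moments. -/
theorem wpa1_lasso_moments (hW : ∀ i, Measurable (W i)) (hWlaw : ∀ i, P.map (W i) = D.F₀)
    (hWind : iIndepFun W P) {d : Fin J → ℝ} {dmin : ℝ} (hdmin : ∀ j, dmin ≤ d j) (hd0 : 0 ≤ dmin)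
    (hd : dmin < 1 / 2) (hregIn : T.RegressorRateInSample P W d) (hM : C.BoundedM) {bf : ℝ}
    (hf : ∀ a j, ∀ᵐ z ∂(D.law j), |C.f a j z| ≤ bf) (hr : C.DictionaryGrowth) (ℓ : Fin L) :
    ∃ K : ℝ, 0 ≤ K ∧ Wpa1 P fun n ω =>
      (∀ k l, |inner ℝ (T.MhatVec (C.train W n ℓ ω) k) (T.MhatVec (C.train W n ℓ ω) l)
        - inner ℝ (C.Mvec n k) (C.Mvec n l)| ≤ K * (n : ℝ) ^ (-dmin)) ∧
      ∀ k a, |inner ℝ (T.MhatVec (C.train W n ℓ ω) k) (C.sampleVec (C.train W n ℓ ω) (C.f a))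
        - inner ℝ (C.Mvec n k) (C.fL a)| ≤ K * (n : ℝ) ^ (-dmin) := by
  have hmom := C.wpa1_sample_moments P W hW hWlaw hWind hM hf hr ℓ hd
  obtain ⟨cM, hcM⟩ := hM
  obtain ⟨Kr, hKr⟩ := hregIn
  set b : ℝ := max bf 0 + ∑ j, |cM j| with hb
  have hb0 : 0 ≤ b := add_nonneg (le_max_right _ _) (Finset.sum_nonneg fun _ _ => abs_nonneg _)
  set R : ℝ := ∑ j, |Kr j| with hR
  have hR0 : 0 ≤ R := Finset.sum_nonneg fun _ _ => abs_nonneg _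
  have hcb : ∀ j, cM j ≤ b := fun j => (le_abs_self _).trans <|
    (Finset.single_le_sum (f := fun j => |cM j|) (fun _ _ => abs_nonneg _)
      (Finset.mem_univ j)).trans (le_add_of_nonneg_left (le_max_right _ _))
  have hfb : bf ≤ b := (le_max_left _ _).trans
    (le_add_of_nonneg_right (Finset.sum_nonneg fun _ _ => abs_nonneg _))
  have hae : Wpa1 P fun n ω => (∀ j k (i : C.Out n ℓ), |C.M n j k (D.Z j (W i.1.1 ω))| ≤ b) ∧
      ∀ a j (i : C.Out n ℓ), |C.f a j (D.Z j (W i.1.1 ω))| ≤ b := by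
    refine Wpa1.of_ae ?_
    filter_upwards [hcM] with n hn
    have h1 : ∀ᵐ ω ∂P, ∀ j, ∀ i k, |C.M n j k (D.Z j (W i ω))| ≤ cM j :=
      ae_all_iff.2 fun j => Design.ae_sample_of_ae_law P W hW hWlaw (hn j)
    have h2 : ∀ᵐ ω ∂P, ∀ a j, ∀ i, |C.f a j (D.Z j (W i ω))| ≤ bf :=
      ae_all_iff.2 fun a => ae_all_iff.2 fun j =>
        Design.ae_sample_of_ae_law P W hW hWlaw (hf a j)
    filter_upwards [h1, h2] with ω h1 h2
    exact ⟨fun j k i => (h1 j _ k).trans (hcb j), fun a j i => (h2 a j _).trans hfb⟩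
  -- `M̂` is built from the same observations that enter the Lasso, so concentration cannot be
  -- applied to it. Hoeffding handles the nonrandom `M`, and the replacement of `M` by `M̂` is
  -- charged to the in-sample error through Cauchy–Schwarz.
  have hreg := Wpa1.forall fun j => hKr j ℓ
  set K : ℝ := J + (R * R + 2 * (J * b * R)) with hK
  refine ⟨K, by positivity, ((hmom.and hae).and hreg).mono ?_⟩
  filter_upwards [eventually_ge_atTop 1] with n hn ω hω
  obtain ⟨⟨⟨hGG, hFF⟩, hMb, hfb'⟩, hreg⟩ := hω
  have hn1 : (1 : ℝ) ≤ n := by exact_mod_cast hn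
  set s := (n : ℝ) ^ (-dmin) with hs
  have hs0 : 0 ≤ s := by positivity
  have hs1 : s ≤ 1 := Real.rpow_le_one_of_one_le_of_nonpos hn1 (by linarith)
  set t := C.train W n ℓ ω with ht
  have hxM : ∀ k, ‖C.sampleVec t fun j => C.M n j k‖ ≤ J * b := fun k =>
    C.norm_sampleVec_le t hb0 fun j i => hMb j k i
  have hxf : ∀ a, ‖C.sampleVec t (C.f a)‖ ≤ J * b := fun a =>
    C.norm_sampleVec_le t hb0 fun j i => hfb' a j i
  have hdiff : ∀ k, ‖T.MhatVec t k - C.sampleVec t fun j => C.M n j k‖ ≤ R * s := by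
    intro k
    rw [MhatVec, Design.sampleVec_sub]
    refine (abs_le_of_sq_le_sq' ?_ (by positivity)).2
    rw [Design.norm_sq_sampleVec]
    calc _ ≤ ∑ j, (|Kr j| * s) ^ 2 := by
          refine Finset.sum_le_sum fun j _ => (hreg j k).trans ?_
          rw [mul_pow, mul_pow, sq_abs]
          gcongr
          exact Real.rpow_le_rpow_of_exponent_le hn1 (by linarith [hdmin j])
      _ ≤ (∑ j, |Kr j| * s) ^ 2 := Finset.sum_sq_le_sq_sum_of_nonneg fun j _ => by positivity
      _ = (R * s) ^ 2 := by rw [← Finset.sum_mul]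
  have hfin : (R * s) * (R * s) + 2 * (J * b * (R * s)) + J * s ≤ K * s := by
    have : (R * s) * (R * s) ≤ R * R * s := by
      calc (R * s) * (R * s) = R * R * s * s := by ring
        _ ≤ R * R * s * 1 := by gcongr
        _ = _ := by ring
    rw [hK]
    linarith
  constructor
  · intro k l
    have h1 := abs_inner_sub_inner_le _ _ _ _ (hxM k) (hxM l) (hdiff k) (hdiff l)
    have h2 := hGG k l
    refine le_trans ?_ hfin
    exact (abs_sub_le _ _ _).trans (add_le_add h1 h2)
  · intro k a
    have hzero : ‖C.sampleVec t (C.f a) - C.sampleVec t (C.f a)‖ ≤ R * s := by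
      rw [sub_self, norm_zero]
      positivity
    have h1 := abs_inner_sub_inner_le _ _ _ _ (hxM k) (hxf a) (hdiff k) hzero
    have h2 := hFF k a
    refine le_trans ?_ hfin
    exact (abs_sub_le _ _ _).trans (add_le_add h1 h2)

end Estimators

/-! ### Lasso coefficients and the mean-square rate of the fit -/

namespace Estimators

variable {𝒲 𝒴 B E : Type*} [MeasurableSpace 𝒲] [MeasurableSpace 𝒴]
  [NormedAddCommGroup B] [InnerProductSpace ℝ B] [CompleteSpace B]
  [NormedAddCommGroup E] [NormedSpace ℝ E]
  {J : ℕ} {𝒵 : Fin J → Type*} [∀ j, MeasurableSpace (𝒵 j)] {p : ℕ}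
  {D : CMRModel 𝒲 𝒴 B E 𝒵 p} {q L : ℕ} {C : Design D q L} (T : Estimators C)
  {Ω : Type*} [MeasurableSpace Ω] (P : Measure Ω) (W : ℕ → Ω → 𝒲)

/-- Bounds for the Lasso coefficients, given uniform closeness of the sample moments. -/
theorem wpa1_lasso_coefficients {ε : ℕ → ℝ} {ξ : ℝ} (hξ : 0 < ξ)
    {βbar : ∀ n, Fin q → C.Idx n → ℝ} (hε : ∀ᶠ n in atTop, 0 < ε n)
    (hε0 : Tendsto ε atTop (𝓝 0)) (hsparse : C.ApproxSparse ε ξ βbar) (heigen : C.SparseEigen ε)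
    (hβs : C.BetaStarBounded ε βbar) (hpen : ε =o[atTop] C.lam) {ℓ : Fin L} {Kg : ℝ} (hKg : 0 ≤ Kg)
    (hmom : Wpa1 P fun n ω =>
      (∀ k l, |inner ℝ (T.MhatVec (C.train W n ℓ ω) k) (T.MhatVec (C.train W n ℓ ω) l)
        - inner ℝ (C.Mvec n k) (C.Mvec n l)| ≤ Kg * ε n) ∧
      ∀ k a, |inner ℝ (T.MhatVec (C.train W n ℓ ω) k) (C.sampleVec (C.train W n ℓ ω) (C.f a))
        - inner ℝ (C.Mvec n k) (C.fL a)| ≤ Kg * ε n) :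
    ∃ K : ℝ, 0 < K ∧ Wpa1 P fun n ω => ∀ a, ∑ k, |T.βhat n ℓ a (C.train W n ℓ ω) k| ≤ K ∧
      ‖C.fStar a - ∑ k, T.βhat n ℓ a (C.train W n ℓ ω) k • C.Mvec n k‖
        ≤ K * (C.lam n * ε n ^ (-1 / (2 * ξ + 1))) := by
  obtain ⟨K, c₀, hK, hc₀, horacle⟩ := C.exists_sparse_oracle hξ hε hε0 hsparse heigen hβs
  -- The factor 2 comes from `‖x - y‖² ≤ 2(‖x‖² + ‖y‖²)`, the term `K` from the oracle error, the
  -- rest of the bracket from `lasso_bound` with `ρ ≤ K |A| lam`, and the last `K` from the bound on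
  -- `|A|`.
  set Q : ℝ := 2 * (K + (28 / c₀ + 7 * K)) * K with hQ
  have hQ0 : 0 ≤ Q := by positivity
  -- Chosen so that `r₀ * ε ≤ lam` is precisely the smallness requirement of `lasso_bound` with
  -- moment error `g = Kg * ε`.
  set r₀ : ℝ := 4 * (2 * (Kg * K + Kg + 1) + 3 * Kg * K) with hr₀
  have hr₀pos : 0 < r₀ := by positivity
  have hbig : ∀ᶠ n in atTop, r₀ * ε n ≤ C.lam n := by
    filter_upwards [hpen.bound (inv_pos.2 hr₀pos), hε] with n hn hpos
    rw [Real.norm_of_nonneg hpos.le, Real.norm_of_nonneg (C.lam_nonneg n)] at hn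
    rwa [← le_inv_mul_iff₀ hr₀pos]
  refine ⟨2 * K + √Q, by positivity, hmom.mono ?_⟩
  filter_upwards [horacle, hε, hbig] with n horacle hε hbig ω ⟨hG, hF⟩ a
  obtain ⟨A, βs, hfoc, happ, hρ, hK1, hcard, hRE⟩ := horacle a
  set lam := C.lam n with hlam
  have hlampos : 0 < lam := lt_of_lt_of_le (by positivity) hbig
  have hεlam : ε n ≤ lam := by
    refine le_trans ?_ hbig
    have : 1 ≤ r₀ := by
      have h1 : 0 ≤ Kg * K := by positivity
      rw [hr₀]
      nlinarith
    exact le_mul_of_one_le_left hε.le this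
  set t := C.train W n ℓ ω
  obtain ⟨h1, h2⟩ := lasso_bound (C.Mvec n) (C.fL a) (T.MhatVec t) (C.sampleVec t (C.f a))
    (T.βhat n ℓ a t) βs A hlampos (mul_nonneg hKg hε.le) (T.lasso_norm_sq t a βs) hG
    (fun k => hF k a) hfoc hK1 hρ (by
      calc 2 * (Kg * ε n * K + Kg * ε n + ε n) + 3 * (Kg * ε n) * K = r₀ * ε n / 4 := by
            rw [hr₀]; ring
        _ ≤ lam / 4 := by linarith) hc₀ hRE
  have hsq0 := Real.sqrt_nonneg Q
  refine ⟨by linarith, ?_⟩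
  set e₁ := ε n ^ (-1 / (2 * ξ + 1)) with he₁
  have he₁0 : 0 ≤ e₁ := by positivity
  have he₂ : ε n ^ (-2 / (2 * ξ + 1)) = e₁ ^ 2 := by
    rw [he₁, ← Real.rpow_natCast, ← Real.rpow_mul hε.le]
    congr 1
    push_cast
    ring
  rw [he₂] at hcard
  have hsplit : C.fStar a - ∑ k, T.βhat n ℓ a t k • C.Mvec n k
      = (C.fStar a - ∑ k, βs k • C.Mvec n k)
        - ∑ k, (T.βhat n ℓ a t k - βs k) • C.Mvec n k := by
    simp_rw [sub_smul, Finset.sum_sub_distrib]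
    abel
  have hX : ‖C.fStar a - ∑ k, T.βhat n ℓ a t k • C.Mvec n k‖ ^ 2 ≤ (√Q * (lam * e₁)) ^ 2 := by
    rw [hsplit]
    set x := C.fStar a - ∑ k, βs k • C.Mvec n k
    set y := ∑ k, (T.βhat n ℓ a t k - βs k) • C.Mvec n k
    have hs0 : (0 : ℝ) ≤ A.card := Nat.cast_nonneg _
    have hx : ‖x‖ ^ 2 ≤ K * A.card * lam ^ 2 := happ.trans (by gcongr)
    have hy : ‖y‖ ^ 2 ≤ (28 / c₀ + 7 * K) * A.card * lam ^ 2 := by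
      refine h2.trans ?_
      have : lam * (A.card * ε n) ≤ lam * (A.card * lam) := by gcongr
      have := mul_le_mul_of_nonneg_left this (by positivity : 0 ≤ 7 * K)
      linarith
    have hxy : ‖x - y‖ ^ 2 ≤ 2 * (‖x‖ ^ 2 + ‖y‖ ^ 2) := by
      have h3 := norm_sub_le x y
      have h4 := pow_le_pow_left₀ (norm_nonneg _) h3 2
      nlinarith [sq_nonneg (‖x‖ - ‖y‖)]
    rw [mul_pow, Real.sq_sqrt hQ0]
    calc ‖x - y‖ ^ 2 ≤ 2 * (K * A.card * lam ^ 2 + (28 / c₀ + 7 * K) * A.card * lam ^ 2) := by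
          linarith
      _ = 2 * (K + (28 / c₀ + 7 * K)) * lam ^ 2 * A.card := by ring
      _ ≤ 2 * (K + (28 / c₀ + 7 * K)) * lam ^ 2 * (K * e₁ ^ 2) := by gcongr
      _ = Q * (lam * e₁) ^ 2 := by rw [hQ]; ring
  refine ((abs_le_of_sq_le_sq' hX (by positivity)).2).trans ?_
  gcongr
  linarith

/-- Write `f* - M̂'β̂ = (f* - M'β̂) - (M̂ - M)'β̂`. The second term is at most the `ℓ₁`-norm of `β̂`
times the largest regressor error, so the dictionary size does not enter. -/
theorem eLpNorm_fStar_sub_fit_le {n : ℕ} {ℓ : Fin L} (a : Fin q) (t : C.Train n ℓ) (j : Fin J)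
    {K e ρ : ℝ} (he : 0 ≤ e) (hβ : ∑ k, |T.βhat n ℓ a t k| ≤ K)
    (hM : ∀ k, eLpNorm (fun z => T.Mhat n ℓ j k t z - C.M n j k z) 2 (D.law j)
      ≤ ENNReal.ofReal e)
    (hρ : ‖C.fStar a - ∑ k, T.βhat n ℓ a t k • C.Mvec n k‖ ≤ ρ) :
    eLpNorm (fun z => C.fStar a j z - T.fit n ℓ a t j z) 2 (D.law j)
      ≤ ENNReal.ofReal (ρ + K * e) := by
  set g := C.fStar a - ∑ k, T.βhat n ℓ a t k • C.Mvec n k with hg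
  have hK0 : 0 ≤ K := (Finset.sum_nonneg fun k _ => abs_nonneg _).trans hβ
  have hρ0 : 0 ≤ ρ := (norm_nonneg _).trans hρ
  set Δ : C.Idx n → 𝒵 j → ℝ := fun k z =>
    T.βhat n ℓ a t k * (T.Mhat n ℓ j k t z - C.M n j k z) with hΔ
  have hMm : ∀ k, Measurable fun z => T.Mhat n ℓ j k t z := fun k =>
    (T.measurable_Mhat n ℓ j k).comp measurable_prodMk_left
  have hΔm : ∀ k, AEStronglyMeasurable (Δ k) (D.law j) := fun k =>
    (((hMm k).sub (Lp.stronglyMeasurable (C.M n j k)).measurable).const_mul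
      _).aestronglyMeasurable
  have hcongr : (fun z => C.fStar a j z - T.fit n ℓ a t j z)
      =ᵐ[D.law j] (g j : 𝒵 j → ℝ) - ∑ k, Δ k := by
    filter_upwards [D.coeFn_sub_sum_smul (C.fStar a) (C.Mvec n) (T.βhat n ℓ a t) j] with z hz
    rw [Pi.sub_apply, hz, Finset.sum_apply, sub_sub, ← Finset.sum_add_distrib]
    congr 1
    refine Finset.sum_congr rfl fun k _ => ?_
    have : C.Mvec n k j z = C.M n j k z := rfl
    rw [this, hΔ]
    ring
  rw [eLpNorm_congr_ae hcongr]
  refine (eLpNorm_sub_le (Lp.aestronglyMeasurable _)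
    (Finset.aestronglyMeasurable_sum _ fun k _ => hΔm k) (by norm_num)).trans ?_
  rw [ENNReal.ofReal_add hρ0 (by positivity)]
  refine add_le_add ?_ ?_
  · have h1 : ‖g j‖ ≤ ρ := (PiLp.norm_apply_le g j).trans hρ
    rw [← Lp.enorm_def, ← ofReal_norm]
    exact ENNReal.ofReal_le_ofReal h1
  · refine (eLpNorm_sum_le (fun k _ => hΔm k) (by norm_num)).trans ?_
    calc ∑ k, eLpNorm (Δ k) 2 (D.law j)
        ≤ ∑ k, ENNReal.ofReal (|T.βhat n ℓ a t k| * e) := by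
          refine Finset.sum_le_sum fun k _ => ?_
          have : Δ k = T.βhat n ℓ a t k • fun z => T.Mhat n ℓ j k t z - C.M n j k z := rfl
          rw [this, eLpNorm_const_smul, ENNReal.ofReal_mul (abs_nonneg _), ← Real.norm_eq_abs,
            ofReal_norm]
          exact mul_le_mul_right (hM k) _
      _ = ENNReal.ofReal ((∑ k, |T.βhat n ℓ a t k|) * e) := by
          rw [Finset.sum_mul, ENNReal.ofReal_sum_of_nonneg fun k _ => by positivity]
      _ ≤ ENNReal.ofReal (K * e) := ENNReal.ofReal_le_ofReal (by gcongr)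

variable [IsProbabilityMeasure P]

/-- The Lasso coefficients are bounded in `ℓ₁`-norm and the fit converges to `f*` in mean
square. -/
theorem wpa1_lasso (hW : ∀ i, Measurable (W i)) (hWlaw : ∀ i, P.map (W i) = D.F₀)
    (hWind : iIndepFun W P) {d : Fin J → ℝ} {dmin ξ c : ℝ}
    (hdmin : IsLeast (Set.range d) dmin) (hd0 : 0 < dmin)
    (hd : dmin < 1 / 2) (hξ : 0 < ξ) (hc : 0 < c) (hcd : c < dmin) (hreg : T.RegressorRate P W d)
    (hregIn : T.RegressorRateInSample P W d) (hr : C.DictionaryGrowth) (hM : C.BoundedM) {bf : ℝ}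
    (hf : ∀ a j, ∀ᵐ z ∂(D.law j), |C.f a j z| ≤ bf) {βbar : ∀ n, Fin q → C.Idx n → ℝ}
    (hsparse : C.ApproxSparse (C.eps c d) ξ βbar) (heigen : C.SparseEigen (C.eps c d))
    (hpen : C.PenaltyRate (C.eps c d)) (hβs : C.BetaStarBounded (C.eps c d) βbar) (ℓ : Fin L)
    {τ : ℝ} (hτ : 0 < τ) :
    ∃ K : ℝ, 0 < K ∧ Wpa1 P fun n ω => ∀ a, ∑ k, |T.βhat n ℓ a (C.train W n ℓ ω) k| ≤ K ∧
      ∀ j, eLpNorm (fun z => C.fStar a j z - T.fit n ℓ a (C.train W n ℓ ω) j z) 2 (D.law j)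
        ≤ ENNReal.ofReal (K * ((n : ℝ) ^ (τ - (dmin - c) * (2 * ξ / (2 * ξ + 1)))
          + (n : ℝ) ^ (-dmin))) := by
  have heps := C.eps_eq_eventually hc hdmin hd hr
  have hpos : ∀ᶠ n in atTop, 0 < C.eps c d n := by
    filter_upwards [heps, eventually_gt_atTop 0] with n hn hn0
    rw [hn]
    positivity
  have hlim : Tendsto (C.eps c d) atTop (𝓝 0) := by
    have h1 : Tendsto (fun n : ℕ => (n : ℝ) ^ (-(dmin - c))) atTop (𝓝 0) :=
      (tendsto_rpow_neg_atTop (by linarith)).comp tendsto_natCast_atTop_atTop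
    refine h1.congr' (heps.mono fun n hn => ?_)
    rw [hn, neg_sub]
  have hle : ∀ᶠ n : ℕ in atTop, (n : ℝ) ^ (-dmin) ≤ C.eps c d n := by
    filter_upwards [heps, eventually_ge_atTop 1] with n hn hn1
    rw [hn]
    exact Real.rpow_le_rpow_of_exponent_le (by exact_mod_cast hn1) (by linarith)
  obtain ⟨Kg, hKg, hmom⟩ := T.wpa1_lasso_moments P W hW hWlaw hWind
    (fun j => hdmin.2 ⟨j, rfl⟩) hd0.le hd hregIn hM hf hr ℓ
  obtain ⟨K, hK, hcoef⟩ := T.wpa1_lasso_coefficients P W hξ hpos hlim hsparse heigen hβs hpen.1 hKg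
    (hmom.mono (hle.mono fun n hn ω hω =>
      ⟨fun k l => (hω.1 k l).trans (by gcongr), fun k a => (hω.2 k a).trans (by gcongr)⟩))
  obtain ⟨Kr, hKr⟩ := hreg
  set R : ℝ := ∑ j, |Kr j| with hR
  have hR0 : 0 ≤ R := Finset.sum_nonneg fun _ _ => abs_nonneg _
  have hlam : ∀ᶠ n : ℕ in atTop, C.lam n ≤ (n : ℝ) ^ τ * C.eps c d n := by
    filter_upwards [(hpen.2 τ hτ).bound one_pos, hpos] with n hn hpos
    rw [one_mul, Real.norm_of_nonneg (C.lam_nonneg n), Real.norm_of_nonneg (by positivity)] at hn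
    exact hn
  refine ⟨K + K * R, by positivity, (hcoef.and (Wpa1.forall fun j => hKr j ℓ)).mono ?_⟩
  filter_upwards [heps, hlam, eventually_ge_atTop 1] with n heps hlam hn ω ⟨hcoef, hreg⟩ a
  have hn1 : (1 : ℝ) ≤ n := by exact_mod_cast hn
  have hn0 : (0 : ℝ) < n := by linarith
  obtain ⟨h1, h2⟩ := hcoef a
  refine ⟨h1.trans (le_add_of_nonneg_right (by positivity)), fun j => ?_⟩
  have hMj : ∀ k, eLpNorm (fun z => T.Mhat n ℓ j k (C.train W n ℓ ω) z - C.M n j k z) 2 (D.law j)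
      ≤ ENNReal.ofReal (R * (n : ℝ) ^ (-dmin)) := by
    intro k
    refine (hreg j k).trans (ENNReal.ofReal_le_ofReal ?_)
    calc Kr j * (n : ℝ) ^ (-d j) ≤ |Kr j| * (n : ℝ) ^ (-d j) := by
          gcongr
          exact le_abs_self _
      _ ≤ R * (n : ℝ) ^ (-dmin) := by
          have : |Kr j| ≤ R := Finset.single_le_sum (f := fun j => |Kr j|)
            (fun _ _ => abs_nonneg _) (Finset.mem_univ j)
          have := Real.rpow_le_rpow_of_exponent_le hn1 (neg_le_neg (hdmin.2 ⟨j, rfl⟩))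
          gcongr
  refine (T.eLpNorm_fStar_sub_fit_le a _ j (by positivity) h1 hMj h2).trans
    (ENNReal.ofReal_le_ofReal ?_)
  -- With `λ_n ≤ n^τ ε_n` and `ε_n = n^{c - dmin}`, the exponent of `ε_n` becomes `1 - 1/(2ξ+1) =
  -- 2ξ/(2ξ+1)`.
  have hrate : C.lam n * C.eps c d n ^ (-1 / (2 * ξ + 1))
      ≤ (n : ℝ) ^ (τ - (dmin - c) * (2 * ξ / (2 * ξ + 1))) := by
    calc C.lam n * C.eps c d n ^ (-1 / (2 * ξ + 1))
        ≤ (n : ℝ) ^ τ * C.eps c d n * C.eps c d n ^ (-1 / (2 * ξ + 1)) := by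
          have : 0 ≤ C.eps c d n := by rw [heps]; positivity
          gcongr
      _ = _ := by
          rw [heps, ← Real.rpow_mul hn0.le, ← Real.rpow_add hn0, ← Real.rpow_add hn0]
          congr 1
          field_simp
          ring
  have h3 : 0 ≤ (n : ℝ) ^ (τ - (dmin - c) * (2 * ξ / (2 * ξ + 1))) := by positivity
  have h4 : 0 ≤ (n : ℝ) ^ (-dmin) := by positivity
  calc K * (C.lam n * C.eps c d n ^ (-1 / (2 * ξ + 1))) + K * (R * (n : ℝ) ^ (-dmin))
      ≤ K * (n : ℝ) ^ (τ - (dmin - c) * (2 * ξ / (2 * ξ + 1))) + K * (R * (n : ℝ) ^ (-dmin)) := by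
        gcongr
    _ ≤ _ := by
        have h5 : 0 ≤ K * (n : ℝ) ^ (-dmin) := by positivity
        have h6 : 0 ≤ K * R * (n : ℝ) ^ (τ - (dmin - c) * (2 * ξ / (2 * ξ + 1))) := by positivity
        nlinarith

end Estimators

/-! ### Bias of the debiased moment -/

/-- A `C²` function differs from its value at a critical point by at most a quadratic term. -/
theorem ContDiffAt.eventually_norm_sub_le_of_fderiv_eq_zero {E F : Type*} [NormedAddCommGroup E]
    [NormedSpace ℝ E] [NormedAddCommGroup F] [NormedSpace ℝ F] {φ : E → F} {x : E}
    (h : ContDiffAt ℝ 2 φ x) (h0 : fderiv ℝ φ x = 0) :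
    ∃ K : ℝ, 0 ≤ K ∧ ∀ᶠ y in 𝓝 x, ‖φ y - φ x‖ ≤ K * ‖y - x‖ ^ 2 := by
  -- The derivative is Lipschitz near `x` and vanishes at `x`, so on the closed ball of radius `‖y -
  -- x‖` it is at most `K * ‖y - x‖`. The mean value inequality contributes the second factor.
  have h1 : ContDiffAt ℝ 1 (fderiv ℝ φ) x := h.fderiv_right (by norm_num)
  obtain ⟨K, s, hs, hK⟩ := h1.exists_lipschitzOnWith
  have hd : ∀ᶠ y in 𝓝 x, DifferentiableAt ℝ φ y :=
    (h.eventually (by simp)).mono fun y hy => hy.differentiableAt (by simp)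
  obtain ⟨δ, hδ, hball⟩ := Metric.eventually_nhds_iff_ball.1 (hd.and hs)
  refine ⟨K, K.2, Metric.eventually_nhds_iff_ball.2 ⟨δ, hδ, fun y hy => ?_⟩⟩
  have hsub : Metric.closedBall x ‖y - x‖ ⊆ Metric.ball x δ := by
    refine Metric.closedBall_subset_ball ?_
    rwa [← dist_eq_norm]
  have hx : x ∈ s := mem_of_mem_nhds hs
  have := Convex.norm_image_sub_le_of_norm_fderiv_le (𝕜 := ℝ) (f := φ) (C := K * ‖y - x‖)
    (fun z hz => (hball z (hsub hz)).1) (fun z hz => by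
      have h2 := hK.norm_sub_le (hball z (hsub hz)).2 hx
      rw [h0, sub_zero] at h2
      refine h2.trans ?_
      gcongr
      rwa [← dist_eq_norm]) (convex_closedBall x ‖y - x‖)
    (Metric.mem_closedBall_self (norm_nonneg _)) (y := y)
    (by rw [Metric.mem_closedBall, dist_eq_norm])
  rw [sq, ← mul_assoc]
  exact this

theorem inner_condL2 {α β : Type*} [MeasurableSpace α] [MeasurableSpace β] (μ : Measure α)
    (X : α → β) (hX : Measurable X) (g : Lp ℝ 2 μ) (u : Lp ℝ 2 (μ.map X)) :
    inner ℝ (condL2 μ X hX g) u = inner ℝ g (Lp.compMeasurePreserving X ⟨hX, rfl⟩ u) := by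
  rw [condL2, ContinuousLinearMap.adjoint_inner_left]
  rfl

namespace CMRModel

variable {𝒲 𝒴 B E : Type*} [MeasurableSpace 𝒲] [MeasurableSpace 𝒴]
  [NormedAddCommGroup B] [InnerProductSpace ℝ B] [CompleteSpace B]
  [NormedAddCommGroup E] [NormedSpace ℝ E]
  {J : ℕ} {𝒵 : Fin J → Type*} [∀ j, MeasurableSpace (𝒵 j)] {p : ℕ}
  (D : CMRModel 𝒲 𝒴 B E 𝒵 p)

theorem memLp_comp_Z {j : Fin J} {g : 𝒵 j → ℝ} (hg : MemLp g 2 (D.law j)) :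
    MemLp (fun w => g (D.Z j w)) 2 D.F₀ :=
  hg.comp_measurePreserving (D.measurePreserving_Z j)

theorem integrable_m_mul {j : Fin J} (η : B) {g : 𝒵 j → ℝ} (hg : MemLp g 2 (D.law j)) :
    Integrable (fun w => D.m j (D.Y w) D.θ₀ η * g (D.Z j w)) D.F₀ :=
  (D.memLp_m j η).integrable_mul (D.memLp_comp_Z hg)

/-- Iterated expectations, in the form of the adjointness that defines `condL2`. -/
theorem integral_m_mul {j : Fin J} (η : B) {g : 𝒵 j → ℝ} (hg : MemLp g 2 (D.law j)) :
    ∫ w, D.m j (D.Y w) D.θ₀ η * g (D.Z j w) ∂D.F₀ = inner ℝ (D.h j η) (hg.toLp g) := by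
  have hmp := D.measurePreserving_Z j
  have h1 : inner ℝ (D.h j η) (hg.toLp g) = inner ℝ ((D.memLp_m j η).toLp)
      (Lp.compMeasurePreserving (D.Z j) hmp (hg.toLp g)) :=
    inner_condL2 D.F₀ (D.Z j) (D.measurable_Z j) _ _
  rw [h1, L2.inner_def]
  refine integral_congr_ae ?_
  filter_upwards [(D.memLp_m j η).coeFn_toLp, Lp.coeFn_compMeasurePreserving (hg.toLp g) hmp,
    hmp.quasiMeasurePreserving.ae (hg.coeFn_toLp)] with w h2 h3 h4
  rw [h2, h3, Function.comp_apply, h4]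
  simp [mul_comm]

theorem h_η₀ (j : Fin J) : D.h j (D.ι D.η₀) = 0 := by
  have hmp := D.measurePreserving_Z j
  have h1 : (fun w => D.h j (D.ι D.η₀) (D.Z j w)) =ᵐ[D.F₀] 0 := by
    refine (condL2_comp_ae_eq D.F₀ (D.Z j) (D.measurable_Z j) _).trans ?_
    exact (condExp_congr_ae (D.memLp_m j (D.ι D.η₀)).coeFn_toLp).trans (D.cmr j)
  have hm : MeasurableSet {z | D.h j (D.ι D.η₀) z = 0} :=
    (Lp.stronglyMeasurable _).measurable (measurableSet_singleton 0)
  refine Lp.ext ?_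
  have h2 : ∀ᵐ z ∂(D.law j), D.h j (D.ι D.η₀) z = 0 :=
    (ae_map_iff (D.measurable_Z j).aemeasurable hm).2 h1
  filter_upwards [h2, Lp.coeFn_zero ℝ 2 (D.law j)] with z h3 h4
  rw [h3, h4, Pi.zero_apply]

/-- The Fréchet derivative of `h_j` with respect to `‖·‖_Ξ` is the restriction of `S^{(j)}`. -/
theorem exists_hasFDerivAt_h (hF : D.FrechetCMR) (j : Fin J) :
    ∃ A : E →L[ℝ] Lp ℝ 2 (D.law j), HasFDerivAt (fun e : E => D.h j (D.ι e)) A D.η₀ ∧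
      ∀ v, A v = D.Sj j (D.ι v) := by
  obtain ⟨h1, h2⟩ := hF j
  refine ⟨_, h2.hasFDerivAt, fun v => ?_⟩
  -- `ι` is not assumed continuous, so the chain rule is unavailable. The two derivatives are
  -- compared along lines, where linearity of `ι` is enough.
  have h3 := (h2.hasFDerivAt.hasLineDerivAt v)
  have h4 := (h1.self_of_nhds.hasFDerivAt.hasLineDerivAt (D.ι v))
  refine HasDerivAt.unique h3 ?_
  have h5 : HasDerivAt (fun t : ℝ => D.h j (D.ι D.η₀ + t • D.ι v)) (D.Sj j (D.ι v)) 0 := h4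
  refine h5.congr_of_eventuallyEq (Eventually.of_forall fun t => ?_)
  simp

end CMRModel

namespace Design

variable {𝒲 𝒴 B E : Type*} [MeasurableSpace 𝒲] [MeasurableSpace 𝒴]
  [NormedAddCommGroup B] [InnerProductSpace ℝ B] [CompleteSpace B]
  [NormedAddCommGroup E] [NormedSpace ℝ E]
  {J : ℕ} {𝒵 : Fin J → Type*} [∀ j, MeasurableSpace (𝒵 j)] {p : ℕ}
  {D : CMRModel 𝒲 𝒴 B E 𝒵 p} {q L : ℕ} (C : Design D q L)

/-- Exhibits the mean moment as linear in `h_j(η)`, so its derivative can be read off from that of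
`h_j`. -/
theorem psiBar_apply (η : B) (a : Fin q) : D.psiBar D.θ₀ η C.kappa₀ a
    = ∑ j, inner ℝ (D.h j η) (D.kappa₀ (C.fL a) j) := by
  have hint : ∀ (a : Fin q) (j : Fin J), Integrable
      (fun w => D.m j (D.Y w) D.θ₀ η * D.kappa₀ (C.fL a) j (D.Z j w)) D.F₀ := fun a j =>
    D.integrable_m_mul η (Lp.memLp (D.kappa₀ (C.fL a) j))
  have happ : ∀ a w, D.psi D.θ₀ η C.kappa₀ w a
      = ∑ j, D.m j (D.Y w) D.θ₀ η * D.kappa₀ (C.fL a) j (D.Z j w) := by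
    intro a w
    rw [CMRModel.psi, WithLp.ofLp_sum, Finset.sum_apply]
    rfl
  rw [CMRModel.psiBar, eval_integral_piLp fun a => by
    simp_rw [happ]
    exact integrable_finsetSum _ fun j _ => hint a j]
  simp_rw [happ]
  rw [integral_finsetSum _ fun j _ => hint a j]
  refine Finset.sum_congr rfl fun j _ => ?_
  rw [D.integral_m_mul η (Lp.memLp (D.kappa₀ (C.fL a) j)), Lp.toLp_coeFn]

/-- Neyman orthogonality with respect to the nuisance parameter. -/
theorem fderiv_psiBar_eq_zero (hF : D.FrechetCMR)
    (hd : DifferentiableAt ℝ (fun e : E => D.psiBar D.θ₀ (D.ι e) C.kappa₀) D.η₀) :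
    fderiv ℝ (fun e : E => D.psiBar D.θ₀ (D.ι e) C.kappa₀) D.η₀ = 0 := by
  choose A hA hAS using D.exists_hasFDerivAt_h hF
  ext v a
  have h1 : HasFDerivAt (fun e : E => D.psiBar D.θ₀ (D.ι e) C.kappa₀ a)
      ((EuclideanSpace.proj a : EuclideanSpace ℝ (Fin q) →L[ℝ] ℝ).comp
        (fderiv ℝ (fun e : E => D.psiBar D.θ₀ (D.ι e) C.kappa₀) D.η₀)) D.η₀ :=
    (EuclideanSpace.proj a : EuclideanSpace ℝ (Fin q) →L[ℝ] ℝ).hasFDerivAt.comp D.η₀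
      hd.hasFDerivAt
  have h2 : HasFDerivAt (fun e : E => D.psiBar D.θ₀ (D.ι e) C.kappa₀ a)
      (∑ j, (innerSL ℝ (D.kappa₀ (C.fL a) j)).comp (A j)) D.η₀ := by
    simp_rw [psiBar_apply]
    refine HasFDerivAt.fun_sum fun j _ => ?_
    have := (innerSL ℝ (D.kappa₀ (C.fL a) j)).hasFDerivAt.comp D.η₀ (hA j)
    refine this.congr_of_eventuallyEq (Eventually.of_forall fun e => ?_)
    simp [real_inner_comm]
  -- Computed through `h_j`, the derivative in direction `v` is `⟨S(ι v), κ₀⟩`, which vanishes by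
  -- orthogonality.
  have h3 := congrArg (fun T : E →L[ℝ] ℝ => T v) (h1.unique h2)
  have h4 : (∑ j, (innerSL ℝ (D.kappa₀ (C.fL a) j)).comp (A j)) v
      = inner ℝ (D.S (D.ι v)) (D.kappa₀ (C.fL a)) := by
    rw [PiLp.inner_apply, sum_apply]
    refine Finset.sum_congr rfl fun j _ => ?_
    rw [ContinuousLinearMap.comp_apply, hAS, innerSL_apply_apply, real_inner_comm]
    rfl
  simp only [h4, CMRModel.inner_S_kappa₀] at h3
  exact h3

theorem memLp_kappa₀ (a : Fin q) (j : Fin J) :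
    MemLp (fun z => C.kappa₀ j z a) 2 (D.law j) :=
  Lp.memLp (D.kappa₀ (C.fL a) j)

/-- The mean of the estimation error of the moment, with the estimators held fixed. -/
theorem abs_integral_sum_sub_le (η : B) (a : Fin q) {κ : ∀ j, 𝒵 j → ℝ}
    (hκ : ∀ j, MemLp (κ j) 2 (D.law j)) {e ρ : ℝ} (hρ0 : 0 ≤ ρ)
    (he : ∀ j, ‖D.h j η - D.h j (D.ι D.η₀)‖ ≤ e)
    (hρ : ∀ j, eLpNorm (fun z => κ j z - C.kappa₀ j z a) 2 (D.law j) ≤ ENNReal.ofReal ρ) :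
    |∫ w, ∑ j, (D.m j (D.Y w) D.θ₀ η * κ j (D.Z j w)
        - D.m j (D.Y w) D.θ₀ (D.ι D.η₀) * C.kappa₀ j (D.Z j w) a) ∂D.F₀|
      ≤ J * (e * ρ) + ‖D.psiBar D.θ₀ η C.kappa₀ - D.psiBar D.θ₀ (D.ι D.η₀) C.kappa₀‖ := by
  have h1 : ∫ w, ∑ j, (D.m j (D.Y w) D.θ₀ η * κ j (D.Z j w)
        - D.m j (D.Y w) D.θ₀ (D.ι D.η₀) * C.kappa₀ j (D.Z j w) a) ∂D.F₀
      = ∑ j, (inner ℝ (D.h j η) ((hκ j).toLp (κ j))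
        - inner ℝ (D.h j (D.ι D.η₀)) ((C.memLp_kappa₀ a j).toLp _)) := by
    have hint : ∀ j, Integrable (fun w => D.m j (D.Y w) D.θ₀ η * κ j (D.Z j w)
        - D.m j (D.Y w) D.θ₀ (D.ι D.η₀) * C.kappa₀ j (D.Z j w) a) D.F₀ := fun j =>
      (D.integrable_m_mul η (hκ j)).sub (D.integrable_m_mul (D.ι D.η₀) (C.memLp_kappa₀ a j))
    rw [integral_finsetSum _ fun j _ => hint j]
    refine Finset.sum_congr rfl fun j _ => ?_
    rw [integral_sub (D.integrable_m_mul η (hκ j))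
      (D.integrable_m_mul (D.ι D.η₀) (C.memLp_kappa₀ a j)), D.integral_m_mul η (hκ j),
      D.integral_m_mul (D.ι D.η₀) (C.memLp_kappa₀ a j)]
  have h2 : ∀ j, (C.memLp_kappa₀ a j).toLp (fun z => C.kappa₀ j z a) = D.kappa₀ (C.fL a) j :=
    fun j => Lp.toLp_coeFn _ _
  -- Because `h_j(η₀) = 0`, it can be subtracted at no cost. This isolates a product of the two
  -- estimation errors from the error of `η` alone at the true instrument.
  have h3 : ∑ j, (inner ℝ (D.h j η) ((hκ j).toLp (κ j))
        - inner ℝ (D.h j (D.ι D.η₀)) ((C.memLp_kappa₀ a j).toLp _))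
      = ∑ j, inner ℝ (D.h j η - D.h j (D.ι D.η₀))
          ((hκ j).toLp (κ j) - (C.memLp_kappa₀ a j).toLp _)
        + (D.psiBar D.θ₀ η C.kappa₀ - D.psiBar D.θ₀ (D.ι D.η₀) C.kappa₀) a := by
    rw [PiLp.sub_apply, psiBar_apply, psiBar_apply, ← Finset.sum_sub_distrib,
      ← Finset.sum_add_distrib]
    refine Finset.sum_congr rfl fun j _ => ?_
    rw [h2, D.h_η₀ j]
    simp [inner_sub_right]
  rw [h1, h3]
  refine (abs_add_le _ _).trans (add_le_add ?_ ?_)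
  · refine (Finset.abs_sum_le_sum_abs _ _).trans ?_
    calc _ ≤ ∑ _j : Fin J, e * ρ := by
          refine Finset.sum_le_sum fun j _ => (abs_real_inner_le_norm _ _).trans ?_
          refine mul_le_mul (he j) ?_ (norm_nonneg _) ((norm_nonneg _).trans (he j))
          rw [← MemLp.toLp_sub, Lp.norm_toLp]
          exact ENNReal.toReal_le_of_le_ofReal hρ0 (hρ j)
      _ = J * (e * ρ) := by simp
  · exact PiLp.norm_apply_le (D.psiBar D.θ₀ η C.kappa₀ - D.psiBar D.θ₀ (D.ι D.η₀) C.kappa₀) a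

end Design

/-! ### Boundedness, measurability and second moment of the moment error -/

namespace Estimators

variable {𝒲 𝒴 B E : Type*} [MeasurableSpace 𝒲] [MeasurableSpace 𝒴]
  [NormedAddCommGroup B] [InnerProductSpace ℝ B] [CompleteSpace B]
  [NormedAddCommGroup E] [NormedSpace ℝ E]
  {J : ℕ} {𝒵 : Fin J → Type*} [∀ j, MeasurableSpace (𝒵 j)] {p : ℕ}
  {D : CMRModel 𝒲 𝒴 B E 𝒵 p} {q L : ℕ} {C : Design D q L} (T : Estimators C)
  {Ω : Type*} [MeasurableSpace Ω] (P : Measure Ω) (W : ℕ → Ω → 𝒲)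

theorem abs_fit_le {n : ℕ} {ℓ : Fin L} (a : Fin q) (t : C.Train n ℓ) (j : Fin J) (z : 𝒵 j)
    {c : ℝ} (h : ∀ k, |T.Mhat n ℓ j k t z| ≤ c) :
    |T.fit n ℓ a t j z| ≤ c * ∑ k, |T.βhat n ℓ a t k| := by
  have := abs_sum_mul_le_mul_sum_abs (fun k => T.Mhat n ℓ j k t z) (T.βhat n ℓ a t) h
  simpa [fit, mul_comm] using this

/-- `f = κ̂ + M̂'β̂`, and `f` is not random. A single realisation with bounded `κ̂` and `M̂`
therefore bounds `f` almost surely. -/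
theorem ae_bounded_f [IsProbabilityMeasure P] (hWD : T.WellDefined P W) (hMhat : T.BoundedMhat P W) :
    ∃ bf : ℝ, ∀ a j, ∀ᵐ z ∂(D.law j), |C.f a j z| ≤ bf := by
  obtain ⟨c, hc⟩ := hMhat
  have h : ∀ j, ∃ b : ℝ, ∀ a, ∀ᵐ z ∂(D.law j), |C.f a j z| ≤ b := by
    intro j
    have ℓ : Fin L := ⟨0, by have := C.two_le_L; omega⟩
    obtain ⟨n, ω, ⟨-, ⟨K, hK⟩, -⟩, hM⟩ := ((hWD j ℓ).and (hc j ℓ)).exists_of_eventually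
    set t := C.train W n ℓ ω
    refine ⟨K + |c j| * ∑ a, ∑ k, |T.βhat n ℓ a t k|, fun a => ?_⟩
    filter_upwards [hK, hM] with z hK hM
    have h1 := (PiLp.norm_apply_le (T.kappaHat n ℓ t j z) a).trans hK
    have h2 := T.abs_fit_le a t j z hM
    have h3 : c j * ∑ k, |T.βhat n ℓ a t k| ≤ |c j| * ∑ a, ∑ k, |T.βhat n ℓ a t k| := by
      have h4 : ∑ k, |T.βhat n ℓ a t k| ≤ ∑ a, ∑ k, |T.βhat n ℓ a t k| :=
        Finset.single_le_sum (f := fun a => ∑ k, |T.βhat n ℓ a t k|)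
          (fun _ _ => Finset.sum_nonneg fun _ _ => abs_nonneg _) (Finset.mem_univ a)
      exact mul_le_mul (le_abs_self _) h4 (Finset.sum_nonneg fun _ _ => abs_nonneg _)
        (abs_nonneg _)
    have h5 : T.kappaHat n ℓ t j z a = C.f a j z - T.fit n ℓ a t j z := rfl
    rw [h5, Real.norm_eq_abs] at h1
    have h6 := abs_sub_abs_le_abs_sub (C.f a j z) (T.fit n ℓ a t j z)
    linarith
  choose b hb using h
  refine ⟨∑ j, |b j|, fun a j => (hb j a).mono fun z hz => hz.trans ((le_abs_self _).trans ?_)⟩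
  exact Finset.single_le_sum (f := fun j => |b j|) (fun _ _ => abs_nonneg _) (Finset.mem_univ j)

/-- A version, jointly measurable in the training sample and the new observation, of the
estimation error of the `a`-th moment. -/
theorem exists_measurable_version (n : ℕ) (ℓ : Fin L) (a : Fin q) :
    ∃ u : C.Train n ℓ × 𝒲 → ℝ, Measurable u ∧ ∀ᵐ w ∂D.F₀, ∀ t, u (t, w)
      = ∑ j, (D.m j (D.Y w) D.θ₀ (D.ι (T.ηhat n ℓ t)) * T.kappaHat n ℓ t j (D.Z j w) a
        - D.m j (D.Y w) D.θ₀ (D.ι D.η₀) * C.kappa₀ j (D.Z j w) a) := by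
  have hf : ∀ j, AEMeasurable (C.f a j) (D.law j) := fun j => (C.memLp_f a j).1.aemeasurable
  have hm : ∀ j, AEMeasurable (fun w => D.m j (D.Y w) D.θ₀ (D.ι D.η₀)) D.F₀ := fun j =>
    (D.memLp_m j _).1.aemeasurable
  have hβ : ∀ k, Measurable fun t : C.Train n ℓ => T.βhat n ℓ a t k := fun k =>
    (measurable_pi_apply k).comp (T.measurable_βhat n ℓ a)
  have hκ : ∀ j, Measurable fun z => C.kappa₀ j z a := fun j =>
    (Lp.stronglyMeasurable (D.kappa₀ (C.fL a) j)).measurable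
  have hpair : ∀ j, Measurable fun x : C.Train n ℓ × 𝒲 => (x.1, D.Z j x.2) := fun j =>
    measurable_fst.prodMk ((D.measurable_Z j).comp measurable_snd)
  refine ⟨fun x => ∑ j, (D.m j (D.Y x.2) D.θ₀ (D.ι (T.ηhat n ℓ x.1)) *
      ((hf j).mk _ (D.Z j x.2) - T.fit n ℓ a x.1 j (D.Z j x.2))
        - (hm j).mk _ x.2 * C.kappa₀ j (D.Z j x.2) a), ?_, ?_⟩
  · refine Finset.measurable_sum _ fun j _ => ?_
    refine ((T.measurable_ηhat n ℓ j).mul ?_).sub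
      (((hm j).measurable_mk.comp measurable_snd).mul
        ((hκ j).comp ((D.measurable_Z j).comp measurable_snd)))
    refine ((hf j).measurable_mk.comp ((D.measurable_Z j).comp measurable_snd)).sub ?_
    refine Finset.measurable_sum _ fun k _ => ?_
    exact ((T.measurable_Mhat n ℓ j k).comp (hpair j)).mul ((hβ k).comp measurable_fst)
  -- Only functions free of the training sample are replaced by measurable representatives, so one
  -- null set in `w` serves every `t`.
  · have h1 : ∀ᵐ w ∂D.F₀, ∀ j, C.f a j (D.Z j w) = (hf j).mk _ (D.Z j w) :=
      ae_all_iff.2 fun j => (D.measurePreserving_Z j).quasiMeasurePreserving.ae (hf j).ae_eq_mk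
    have h2 : ∀ᵐ w ∂D.F₀, ∀ j, D.m j (D.Y w) D.θ₀ (D.ι D.η₀) = (hm j).mk _ w :=
      ae_all_iff.2 fun j => (hm j).ae_eq_mk
    filter_upwards [h1, h2] with w h1 h2 t
    refine Finset.sum_congr rfl fun j _ => ?_
    rw [← h1 j, ← h2 j]
    rfl

/-- The second moment of the estimation error of the moment, with the estimators held fixed. -/
theorem lintegral_sum_sub_sq_le {n : ℕ} {ℓ : Fin L} (a : Fin q) (t : C.Train n ℓ) {K e : ℝ}
    (hK : ∀ j, ∀ᵐ z ∂(D.law j), |T.kappaHat n ℓ t j z a| ≤ K)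
    (h1 : ∀ j, ∫⁻ w, ‖D.m j (D.Y w) D.θ₀ (D.ι (T.ηhat n ℓ t))
        - D.m j (D.Y w) D.θ₀ (D.ι D.η₀)‖ₑ ^ 2 ∂D.F₀ ≤ ENNReal.ofReal e)
    (h2 : ∀ j, ∫⁻ w, ‖D.m j (D.Y w) D.θ₀ (D.ι D.η₀)‖ₑ ^ 2
        * ‖T.kappaHat n ℓ t j (D.Z j w) - C.kappa₀ j (D.Z j w)‖ₑ ^ 2 ∂D.F₀ ≤ ENNReal.ofReal e)
    (he : 0 ≤ e) :
    ∫⁻ w, ‖∑ j, (D.m j (D.Y w) D.θ₀ (D.ι (T.ηhat n ℓ t)) * T.kappaHat n ℓ t j (D.Z j w) a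
        - D.m j (D.Y w) D.θ₀ (D.ι D.η₀) * C.kappa₀ j (D.Z j w) a)‖ₑ ^ 2 ∂D.F₀
      ≤ ENNReal.ofReal (2 * J * (J * ((K ^ 2 + 1) * e))) := by
  set x : Fin J → 𝒲 → ℝ := fun j w => D.m j (D.Y w) D.θ₀ (D.ι (T.ηhat n ℓ t))
    - D.m j (D.Y w) D.θ₀ (D.ι D.η₀) with hx
  set y : Fin J → 𝒲 → ℝ := fun j w => D.m j (D.Y w) D.θ₀ (D.ι D.η₀) with hy
  set Δ : ∀ j, 𝒲 → EuclideanSpace ℝ (Fin q) := fun j w =>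
    T.kappaHat n ℓ t j (D.Z j w) - C.kappa₀ j (D.Z j w) with hΔ
  have hxm : ∀ j, AEMeasurable (fun w => ENNReal.ofReal (K ^ 2) * ‖x j w‖ₑ ^ 2) D.F₀ := fun j =>
    ((((D.memLp_m j _).1.sub (D.memLp_m j _).1).enorm).pow_const 2).const_mul _
  have hK' : ∀ᵐ w ∂D.F₀, ∀ j, |T.kappaHat n ℓ t j (D.Z j w) a| ≤ K :=
    ae_all_iff.2 fun j => (D.measurePreserving_Z j).quasiMeasurePreserving.ae (hK j)
  have hpt : ∀ᵐ w ∂D.F₀, ‖∑ j, (D.m j (D.Y w) D.θ₀ (D.ι (T.ηhat n ℓ t)) *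
        T.kappaHat n ℓ t j (D.Z j w) a
        - D.m j (D.Y w) D.θ₀ (D.ι D.η₀) * C.kappa₀ j (D.Z j w) a)‖ₑ ^ 2
      ≤ ENNReal.ofReal (2 * J) * ∑ j, (ENNReal.ofReal (K ^ 2) * ‖x j w‖ₑ ^ 2
        + ‖y j w‖ₑ ^ 2 * ‖Δ j w‖ₑ ^ 2) := by
    filter_upwards [hK'] with w hw
    set v : Fin J → ℝ := fun j => D.m j (D.Y w) D.θ₀ (D.ι (T.ηhat n ℓ t)) *
      T.kappaHat n ℓ t j (D.Z j w) a - D.m j (D.Y w) D.θ₀ (D.ι D.η₀) * C.kappa₀ j (D.Z j w) a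
      with hv
    have hvj : ∀ j, v j ^ 2 ≤ 2 * (K ^ 2 * ‖x j w‖ ^ 2 + ‖y j w‖ ^ 2 * ‖Δ j w‖ ^ 2) := by
      intro j
      -- Pairing the error in `m` with `κ̂`, rather than with `κ₀`, allows the uniform bound `K` to
      -- be used and leaves no product of two errors.
      have e1 : v j = x j w * T.kappaHat n ℓ t j (D.Z j w) a + y j w * Δ j w a := by
        simp only [hv, hx, hy, hΔ, PiLp.sub_apply]
        ring
      have e2 : (Δ j w a) ^ 2 ≤ ‖Δ j w‖ ^ 2 := by
        rw [← sq_abs, ← Real.norm_eq_abs]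
        exact pow_le_pow_left₀ (norm_nonneg _) (PiLp.norm_apply_le (Δ j w) a) 2
      have e3 : (T.kappaHat n ℓ t j (D.Z j w) a) ^ 2 ≤ K ^ 2 := by
        rw [← sq_abs]
        exact pow_le_pow_left₀ (abs_nonneg _) (hw j) 2
      have e4 := mul_le_mul_of_nonneg_left e2 (sq_nonneg (y j w))
      have e5 := mul_le_mul_of_nonneg_left e3 (sq_nonneg (x j w))
      rw [e1, Real.norm_eq_abs, sq_abs, Real.norm_eq_abs, sq_abs]
      nlinarith [sq_nonneg (x j w * T.kappaHat n ℓ t j (D.Z j w) a - y j w * Δ j w a)]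
    have hcs : (∑ j, v j) ^ 2 ≤ 2 * J * ∑ j, (K ^ 2 * ‖x j w‖ ^ 2 + ‖y j w‖ ^ 2 * ‖Δ j w‖ ^ 2) := by
      have e1 := sq_sum_le_card_mul_sum_sq (s := Finset.univ) (f := v)
      rw [Finset.card_univ, Fintype.card_fin] at e1
      refine e1.trans ?_
      calc (J : ℝ) * ∑ j, v j ^ 2
          ≤ J * ∑ j, 2 * (K ^ 2 * ‖x j w‖ ^ 2 + ‖y j w‖ ^ 2 * ‖Δ j w‖ ^ 2) := by
            gcongr with j
            exact hvj j
        _ = _ := by rw [← Finset.mul_sum]; ring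
    have hL : ‖∑ j, v j‖ₑ ^ 2 = ENNReal.ofReal ((∑ j, v j) ^ 2) := by
      rw [← ofReal_norm, ← ENNReal.ofReal_pow (norm_nonneg _), Real.norm_eq_abs, sq_abs]
    rw [hL]
    refine (ENNReal.ofReal_le_ofReal hcs).trans_eq ?_
    rw [ENNReal.ofReal_mul (by positivity), ENNReal.ofReal_sum_of_nonneg fun j _ => by positivity]
    congr 1
    refine Finset.sum_congr rfl fun j _ => ?_
    rw [ENNReal.ofReal_add (by positivity) (by positivity), ENNReal.ofReal_mul (by positivity),
      ENNReal.ofReal_mul (by positivity), ENNReal.ofReal_pow (norm_nonneg _),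
      ENNReal.ofReal_pow (norm_nonneg (y j w)), ENNReal.ofReal_pow (norm_nonneg (Δ j w)),
      ofReal_norm, ofReal_norm, ofReal_norm]
  have hκm : ∀ j, AEMeasurable (fun w => ‖Δ j w‖ₑ ^ 2) D.F₀ := fun j => by
    refine AEMeasurable.pow_const (AEMeasurable.enorm ?_) 2
    have hk : AEMeasurable (fun z => T.kappaHat n ℓ t j z - C.kappa₀ j z) (D.law j) := by
      refine (WithLp.measurable_toLp 2 (Fin q → ℝ)).comp_aemeasurable
        (f := fun z a => C.f a j z - T.fit n ℓ a t j z - D.kappa₀ (C.fL a) j z)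
        (aemeasurable_pi_lambda _ fun a => ?_)
      refine ((C.memLp_f a j).1.aemeasurable.sub (Measurable.aemeasurable ?_)).sub
        (Lp.stronglyMeasurable (D.kappa₀ (C.fL a) j)).measurable.aemeasurable
      refine Finset.measurable_sum _ fun k _ => ?_
      exact ((T.measurable_Mhat n ℓ j k).comp measurable_prodMk_left).mul_const _
    exact hk.comp_measurable (D.measurable_Z j)
  have hym : ∀ j, AEMeasurable (fun w => ‖y j w‖ₑ ^ 2 * ‖Δ j w‖ₑ ^ 2) D.F₀ := fun j =>
    ((D.memLp_m j _).1.enorm.pow_const 2).mul (hκm j)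
  have hxym : ∀ j, AEMeasurable (fun w => ENNReal.ofReal (K ^ 2) * ‖x j w‖ₑ ^ 2
      + ‖y j w‖ₑ ^ 2 * ‖Δ j w‖ₑ ^ 2) D.F₀ := fun j => (hxm j).add (hym j)
  refine (lintegral_mono_ae hpt).trans ?_
  rw [lintegral_const_mul' _ _ ENNReal.ofReal_ne_top,
    lintegral_finsetSum' _ fun j _ => hxym j,
    ENNReal.ofReal_mul (p := 2 * (J : ℝ)) (by positivity)]
  refine mul_le_mul_right ?_ _
  calc ∑ j, ∫⁻ w, (ENNReal.ofReal (K ^ 2) * ‖x j w‖ₑ ^ 2 + ‖y j w‖ₑ ^ 2 * ‖Δ j w‖ₑ ^ 2) ∂D.F₀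
      ≤ ∑ _j : Fin J, ENNReal.ofReal ((K ^ 2 + 1) * e) := by
        refine Finset.sum_le_sum fun j _ => ?_
        rw [lintegral_add_left' (hxm j), lintegral_const_mul' _ _ ENNReal.ofReal_ne_top, add_mul,
          ENNReal.ofReal_add (by positivity) (by positivity), ENNReal.ofReal_mul (by positivity),
          one_mul]
        gcongr
        · exact h1 j
        · exact h2 j
    _ = ENNReal.ofReal (J * ((K ^ 2 + 1) * e)) := by
        rw [Finset.sum_const, Finset.card_univ, Fintype.card_fin, nsmul_eq_mul,
          ENNReal.ofReal_mul (Nat.cast_nonneg J), ENNReal.ofReal_natCast]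

end Estimators

/-! ### Asymptotic linearity -/

namespace Estimators

variable {𝒲 𝒴 B E : Type*} [MeasurableSpace 𝒲] [MeasurableSpace 𝒴]
  [NormedAddCommGroup B] [InnerProductSpace ℝ B] [CompleteSpace B]
  [NormedAddCommGroup E] [NormedSpace ℝ E]
  {J : ℕ} {𝒵 : Fin J → Type*} [∀ j, MeasurableSpace (𝒵 j)] {p : ℕ}
  {D : CMRModel 𝒲 𝒴 B E 𝒵 p} {q L : ℕ} {C : Design D q L} (T : Estimators C)
  {Ω : Type*} [MeasurableSpace Ω] (P : Measure Ω) (W : ℕ → Ω → 𝒲)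

/-- The error in the `a`-th moment at a new observation `w` due to the estimation of `η₀` and
`κ₀`. -/
def momentError (n : ℕ) (ℓ : Fin L) (a : Fin q) (t : C.Train n ℓ) (w : 𝒲) : ℝ :=
  ∑ j, (D.m j (D.Y w) D.θ₀ (D.ι (T.ηhat n ℓ t)) * T.kappaHat n ℓ t j (D.Z j w) a
    - D.m j (D.Y w) D.θ₀ (D.ι D.η₀) * C.kappa₀ j (D.Z j w) a)

theorem psi_sub_psi_apply (n : ℕ) (ℓ : Fin L) (a : Fin q) (t : C.Train n ℓ) (w : 𝒲) :
    D.psi D.θ₀ (D.ι (T.ηhat n ℓ t)) (T.kappaHat n ℓ t) w a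
      - D.psi D.θ₀ (D.ι D.η₀) C.kappa₀ w a = T.momentError n ℓ a t w := by
  simp only [CMRModel.psi, momentError, WithLp.ofLp_sum, Finset.sum_apply, PiLp.smul_apply,
    smul_eq_mul, Finset.sum_sub_distrib]

/-- Independence across disjoint index sets; this is what cross-fitting provides. -/
theorem indepFun_train (hW : ∀ i, Measurable (W i)) (hWind : iIndepFun W P) (n : ℕ) (ℓ : Fin L) :
    IndepFun (C.train W n ℓ) (fun ω (i : {i : Fin n // C.fold n i = ℓ}) => W i.1.1 ω) P := by
  have h := (hWind.precomp (g := fun i : Fin n => (i : ℕ)) Fin.val_injective).indepFun_finset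
    (Finset.univ.filter fun i => C.fold n i ≠ ℓ) (Finset.univ.filter fun i => C.fold n i = ℓ)
    (Finset.disjoint_filter_filter_not _ _ _).symm (fun i => hW i)
  exact h.comp (φ := fun x (i : C.Out n ℓ) => x ⟨i.1, by simpa using i.2⟩)
    (ψ := fun x (i : {i : Fin n // C.fold n i = ℓ}) => x ⟨i.1, by simpa using i.2⟩)
    (measurable_pi_lambda _ fun i => measurable_pi_apply _)
    (measurable_pi_lambda _ fun i => measurable_pi_apply _)

/-- Within a fold, the scaled sum of the errors is negligible if, with the estimators held fixed,
their second moment vanishes and their mean is `o(n^{-1/2})`. -/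
theorem wpa1_abs_fold_sum_lt [IsProbabilityMeasure P] (hW : ∀ i, Measurable (W i))
    (hWlaw : ∀ i, P.map (W i) = D.F₀) (hWind : iIndepFun W P) (ℓ : Fin L) (a : Fin q)
    (hbias : ∀ δ : ℝ, 0 < δ → Wpa1 P fun n ω =>
      √(n : ℝ) * |∫ w, T.momentError n ℓ a (C.train W n ℓ ω) w ∂D.F₀| < δ)
    (hvar : ∀ η : ℝ, 0 < η → Wpa1 P fun n ω =>
      ∫⁻ w, ‖T.momentError n ℓ a (C.train W n ℓ ω) w‖ₑ ^ 2 ∂D.F₀ ≤ ENNReal.ofReal η)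
    {δ : ℝ} (hδ : 0 < δ) :
    Wpa1 P fun n ω => |(√(n : ℝ))⁻¹ * ∑ i ∈ Finset.univ.filter (fun i => C.fold n i = ℓ),
      T.momentError n ℓ a (C.train W n ℓ ω) (W i ω)| < δ := by
  refine ENNReal.tendsto_nhds_zero.2 fun γ hγ => ?_
  obtain ⟨g, hg0, hg⟩ := ENNReal.lt_iff_exists_nnreal_btwn.1 (ENNReal.half_pos hγ.ne')
  have hg0' : (0 : ℝ) < g := by exact_mod_cast hg0
  -- Chosen so that Chebyshev's bound at deviation `(δ/2)√n` is at most `g < γ/2`. The other half of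
  -- `δ` is left for the conditional mean.
  set η : ℝ := g * (δ / 2) ^ 2 with hη
  have hη0 : 0 < η := by positivity
  have hgood := ENNReal.tendsto_nhds_zero.1 ((hbias (δ / 2) (by positivity)).and (hvar η hη0))
    (γ / 2) (ENNReal.half_pos hγ.ne')
  filter_upwards [hgood, eventually_gt_atTop 0] with n hgood hn
  have hn0 : (0 : ℝ) < n := by exact_mod_cast hn
  have hsq : 0 < √(n : ℝ) := Real.sqrt_pos.2 hn0
  obtain ⟨u, hu, hae⟩ := T.exists_measurable_version n ℓ a
  have hae' : ∀ᵐ w ∂D.F₀, ∀ t, u (t, w) = T.momentError n ℓ a t w := hae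
  have hX : Measurable (C.train W n ℓ) := measurable_pi_lambda _ fun i => hW _
  have hcheb := measure_centered_sum_ge_le P D.F₀ (C.train W n ℓ) hX
    (fun (i : {i : Fin n // C.fold n i = ℓ}) => W i.1.1) (fun i => hW _)
    (indepFun_train P W hW hWind n ℓ)
    (hWind.precomp (Fin.val_injective.comp Subtype.val_injective)) (fun i => hWlaw _) u hu hη0.le
    (δ := δ / 2 * √(n : ℝ)) (by positivity)
  set S := {ω | ∫⁻ w, ‖u (C.train W n ℓ ω, w)‖ₑ ^ 2 ∂D.F₀ ≤ ENNReal.ofReal η ∧ δ / 2 * √(n : ℝ)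
    ≤ |∑ i : {i : Fin n // C.fold n i = ℓ}, (u (C.train W n ℓ ω, W i.1.1 ω)
      - ∫ w, u (C.train W n ℓ ω, w) ∂D.F₀)|} with hS
  have hcard : (Fintype.card {i : Fin n // C.fold n i = ℓ} : ℝ) ≤ n := by
    have := Fintype.card_subtype_le fun i : Fin n => C.fold n i = ℓ
    rw [Fintype.card_fin] at this
    exact_mod_cast this
  have hSle : P S ≤ γ / 2 := by
    refine hcheb.trans (le_trans ?_ hg.le)
    rw [← ENNReal.ofReal_coe_nnreal]
    refine ENNReal.ofReal_le_ofReal ?_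
    rw [mul_pow, Real.sq_sqrt hn0.le, div_le_iff₀ (by positivity)]
    calc _ ≤ (n : ℝ) * η := by gcongr
      _ = g * ((δ / 2) ^ 2 * n) := by rw [hη]; ring
  -- Agreement for all `t` simultaneously permits substituting the random training sample for `t`.
  have hsample : ∀ᵐ ω ∂P, ∀ i : ℕ, ∀ t, u (t, W i ω) = T.momentError n ℓ a t (W i ω) := by
    refine ae_all_iff.2 fun i => ?_
    have h : ∀ᵐ w ∂(P.map (W i)), ∀ t, u (t, w) = T.momentError n ℓ a t w := by
      rw [hWlaw i]
      exact hae'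
    exact ae_of_ae_map (hW i).aemeasurable h
  set G := {ω | ¬ (√(n : ℝ) * |∫ w, T.momentError n ℓ a (C.train W n ℓ ω) w ∂D.F₀| < δ / 2 ∧
      ∫⁻ w, ‖T.momentError n ℓ a (C.train W n ℓ ω) w‖ₑ ^ 2 ∂D.F₀ ≤ ENNReal.ofReal η)} with hG
  calc P _ ≤ P (G ∪ S) := by
        refine measure_mono_ae ?_
        filter_upwards [hsample] with ω hω hbad
        by_contra hcon
        have hcon' : ω ∉ G ∧ ω ∉ S := not_or.1 hcon
        obtain ⟨hb, hv⟩ := not_not.1 hcon'.1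
        have hint : ∫ w, u (C.train W n ℓ ω, w) ∂D.F₀
            = ∫ w, T.momentError n ℓ a (C.train W n ℓ ω) w ∂D.F₀ :=
          integral_congr_ae (hae'.mono fun w hw => hw _)
        have hlint : ∫⁻ w, ‖u (C.train W n ℓ ω, w)‖ₑ ^ 2 ∂D.F₀
            = ∫⁻ w, ‖T.momentError n ℓ a (C.train W n ℓ ω) w‖ₑ ^ 2 ∂D.F₀ :=
          lintegral_congr_ae (hae'.mono fun w hw => by simp only [hw])
        have hsmall : |∑ i : {i : Fin n // C.fold n i = ℓ}, (u (C.train W n ℓ ω, W i.1.1 ω)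
            - ∫ w, u (C.train W n ℓ ω, w) ∂D.F₀)| < δ / 2 * √(n : ℝ) := by
          by_contra! hge
          exact hcon'.2 ⟨hlint.trans_le hv, hge⟩
        refine hbad ?_
        set b := ∫ w, T.momentError n ℓ a (C.train W n ℓ ω) w ∂D.F₀
        rw [hint, Finset.sum_sub_distrib, Finset.sum_const, Finset.card_univ, nsmul_eq_mul]
          at hsmall
        have hsum : ∑ i ∈ Finset.univ.filter (fun i => C.fold n i = ℓ),
            T.momentError n ℓ a (C.train W n ℓ ω) (W i ω)
            = ∑ i : {i : Fin n // C.fold n i = ℓ}, u (C.train W n ℓ ω, W i.1.1 ω) := by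
          rw [Finset.sum_subtype (p := fun i => C.fold n i = ℓ) _ (by simp)]
          exact Finset.sum_congr rfl fun i _ => (hω _ _).symm
        rw [hsum, abs_mul, abs_of_pos (inv_pos.2 hsq), inv_mul_lt_iff₀ hsq]
        set s := ∑ i : {i : Fin n // C.fold n i = ℓ}, u (C.train W n ℓ ω, W i.1.1 ω)
        set N : ℝ := (Fintype.card {i : Fin n // C.fold n i = ℓ} : ℝ) with hN
        have h1 : |N * b| ≤ δ / 2 * √(n : ℝ) := by
          rw [abs_mul, abs_of_nonneg (Nat.cast_nonneg _)]
          calc N * |b| ≤ n * |b| := by gcongr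
            _ = √(n : ℝ) * (√(n : ℝ) * |b|) := by rw [← mul_assoc, Real.mul_self_sqrt hn0.le]
            _ ≤ √(n : ℝ) * (δ / 2) := by gcongr
            _ = _ := mul_comm _ _
        have h2 : |s| ≤ |s - N * b| + |N * b| := by
          simpa using abs_add_le (s - N * b) (N * b)
        linarith
    _ ≤ P G + P S := measure_union_le _ _
    _ ≤ γ / 2 + γ / 2 := add_le_add hgood hSle
    _ = γ := ENNReal.add_halves γ

/-- The folds partition the sample, so the oracle sum is regrouped by fold and subtracted term by
term. -/
theorem sqrt_smul_psiHat_sub_apply {Ω : Type*} (W : ℕ → Ω → 𝒲) (n : ℕ) (ω : Ω) (a : Fin q) :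
    (√(n : ℝ) • T.psiHat W n D.θ₀ ω
      - (√(n : ℝ))⁻¹ • ∑ i ∈ Finset.range n, D.psi D.θ₀ (D.ι D.η₀) C.kappa₀ (W i ω)) a
      = ∑ ℓ, (√(n : ℝ))⁻¹ * ∑ i ∈ Finset.univ.filter (fun i => C.fold n i = ℓ),
        T.momentError n ℓ a (C.train W n ℓ ω) (W i ω) := by
  have h1 : √(n : ℝ) * (n : ℝ)⁻¹ = (√(n : ℝ))⁻¹ := by
    rw [← div_eq_mul_inv, Real.sqrt_div_self]
  have h2 : ∑ i ∈ Finset.range n, D.psi D.θ₀ (D.ι D.η₀) C.kappa₀ (W i ω)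
      = ∑ ℓ, ∑ i ∈ Finset.univ.filter (fun i => C.fold n i = ℓ),
        D.psi D.θ₀ (D.ι D.η₀) C.kappa₀ (W i ω) := by
    rw [Finset.sum_fiberwise, Finset.sum_range]
  rw [psiHat, smul_smul, h1, h2, ← smul_sub, ← Finset.sum_sub_distrib, PiLp.smul_apply,
    WithLp.ofLp_sum, Finset.sum_apply, smul_eq_mul, Finset.mul_sum]
  refine Finset.sum_congr rfl fun ℓ _ => ?_
  rw [← Finset.sum_sub_distrib, WithLp.ofLp_sum, Finset.sum_apply]
  congr 1
  refine Finset.sum_congr rfl fun i _ => ?_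
  rw [← psi_sub_psi_apply, PiLp.sub_apply]

/-- The nuisance estimator enters the mean of the moments only through negligible terms. -/
theorem wpa1_nuisance_rates {dη τ : ℝ} (hτ : 0 < τ) (hτη : τ < dη) (hF : D.FrechetCMR)
    (hη : T.EtaRate P W dη)
    (hC2 : ContDiffAt ℝ 2 (fun e : E => D.psiBar D.θ₀ (D.ι e) C.kappa₀) D.η₀) :
    ∃ K : ℝ, 0 ≤ K ∧ ∀ ℓ, Wpa1 P fun n ω =>
      (∀ j, ‖D.h j (D.ι (T.ηhat n ℓ (C.train W n ℓ ω))) - D.h j (D.ι D.η₀)‖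
        ≤ K * (n : ℝ) ^ (τ - dη)) ∧
      ‖D.psiBar D.θ₀ (D.ι (T.ηhat n ℓ (C.train W n ℓ ω))) C.kappa₀
        - D.psiBar D.θ₀ (D.ι D.η₀) C.kappa₀‖ ≤ K * ((n : ℝ) ^ (τ - dη)) ^ 2 := by
  have h1 : ∀ j, ∃ K : ℝ, ∀ᶠ e in 𝓝 D.η₀,
      ‖D.h j (D.ι e) - D.h j (D.ι D.η₀)‖ ≤ K * ‖e - D.η₀‖ := fun j => by
    obtain ⟨A, hA, -⟩ := D.exists_hasFDerivAt_h hF j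
    exact hA.isBigO_sub.bound
  choose K₁ hK₁ using h1
  obtain ⟨K₂, hK₂, h2⟩ := hC2.eventually_norm_sub_le_of_fderiv_eq_zero
    (C.fderiv_psiBar_eq_zero hF (hC2.differentiableAt (by simp)))
  obtain ⟨r, hr, hball⟩ := Metric.eventually_nhds_iff.1 ((eventually_all.2 hK₁).and h2)
  have hsum0 : 0 ≤ ∑ j, |K₁ j| := Finset.sum_nonneg fun _ _ => abs_nonneg _
  refine ⟨∑ j, |K₁ j| + K₂, by positivity, fun ℓ => ?_⟩
  -- The slack `n^τ` absorbs the level-dependent constant of the `O_p` bound.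
  have hrate : Wpa1 P fun n ω => ‖T.ηhat n ℓ (C.train W n ℓ ω) - D.η₀‖ ≤ (n : ℝ) ^ (τ - dη) := by
    refine ((hη ℓ).wpa1_abs_le (b := fun n : ℕ => (n : ℝ) ^ (τ - dη)) fun K => ?_).mono
      (Eventually.of_forall fun n ω hω => by rwa [abs_of_nonneg (norm_nonneg _)] at hω)
    have h3 := ((tendsto_rpow_atTop hτ).comp tendsto_natCast_atTop_atTop).eventually_ge_atTop K
    filter_upwards [h3, eventually_gt_atTop 0] with n hn hn0
    rw [sub_eq_add_neg, Real.rpow_add (by exact_mod_cast hn0)]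
    exact mul_le_mul_of_nonneg_right hn (by positivity)
  have hlim : Tendsto (fun n : ℕ => (n : ℝ) ^ (τ - dη)) atTop (𝓝 0) := by
    have := (tendsto_rpow_neg_atTop (y := dη - τ) (by linarith)).comp tendsto_natCast_atTop_atTop
    refine this.congr fun n => ?_
    rw [Function.comp_apply, neg_sub]
  refine hrate.mono ((hlim.eventually_lt_const hr).mono fun n hn ω hω => ?_)
  have hx : dist (T.ηhat n ℓ (C.train W n ℓ ω)) D.η₀ < r := by
    rw [dist_eq_norm]
    exact hω.trans_lt hn
  obtain ⟨h4, h5⟩ := hball hx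
  refine ⟨fun j => (h4 j).trans ?_, h5.trans ?_⟩
  · have : K₁ j ≤ ∑ j, |K₁ j| + K₂ := (le_abs_self _).trans <|
      (Finset.single_le_sum (f := fun j => |K₁ j|) (fun _ _ => abs_nonneg _)
        (Finset.mem_univ j)).trans (le_add_of_nonneg_right hK₂)
    calc K₁ j * _ ≤ (∑ j, |K₁ j| + K₂) * ‖T.ηhat n ℓ (C.train W n ℓ ω) - D.η₀‖ := by gcongr
      _ ≤ _ := by gcongr
  · gcongr
    exact le_add_of_nonneg_left hsum0

end Estimators

/-! ### Conditional second moment and conditional mean of the moment error -/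

namespace Estimators

variable {𝒲 𝒴 B E : Type*} [MeasurableSpace 𝒲] [MeasurableSpace 𝒴]
  [NormedAddCommGroup B] [InnerProductSpace ℝ B] [CompleteSpace B]
  [NormedAddCommGroup E] [NormedSpace ℝ E]
  {J : ℕ} {𝒵 : Fin J → Type*} [∀ j, MeasurableSpace (𝒵 j)] {p : ℕ}
  {D : CMRModel 𝒲 𝒴 B E 𝒵 p} {q L : ℕ} {C : Design D q L} (T : Estimators C)
  {Ω : Type*} [MeasurableSpace Ω] (P : Measure Ω) (W : ℕ → Ω → 𝒲)

theorem kappaHat_sub_kappa₀_ae_eq {n : ℕ} {ℓ : Fin L} (a : Fin q) (t : C.Train n ℓ) (j : Fin J) :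
    (fun z => T.kappaHat n ℓ t j z a - C.kappa₀ j z a)
      =ᵐ[D.law j] fun z => C.fStar a j z - T.fit n ℓ a t j z := by
  have h1 : D.kappa₀ (C.fL a) j = C.fL a j - C.fStar a j := rfl
  filter_upwards [Lp.coeFn_sub (C.fL a j) (C.fStar a j), (C.memLp_f a j).coeFn_toLp] with z h2 h3
  have h4 : C.kappa₀ j z a = C.fL a j z - C.fStar a j z := by
    have : C.kappa₀ j z a = D.kappa₀ (C.fL a) j z := rfl
    rw [this, h1, h2, Pi.sub_apply]
  have h5 : C.fL a j z = C.f a j z := h3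
  have h6 : T.kappaHat n ℓ t j z a = C.f a j z - T.fit n ℓ a t j z := rfl
  rw [h4, h5, h6]
  ring

/-- With the estimators held fixed, the second moment of the error vanishes in probability. -/
theorem wpa1_lintegral_momentError_sq_le (hMS : T.MeanSquare P W) (ℓ : Fin L) (a : Fin q) {K : ℝ}
    (hK : Wpa1 P fun n ω => ∀ j, ∀ᵐ z ∂(D.law j),
      |T.kappaHat n ℓ (C.train W n ℓ ω) j z a| ≤ K) {η : ℝ} (hη : 0 < η) :
    Wpa1 P fun n ω =>
      ∫⁻ w, ‖T.momentError n ℓ a (C.train W n ℓ ω) w‖ₑ ^ 2 ∂D.F₀ ≤ ENNReal.ofReal η := by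
  -- The added 1 keeps the denominator positive without using `J > 0`.
  set e : ℝ := η / (2 * J * (J * (K ^ 2 + 1)) + 1) with he
  have he0 : 0 < e := by positivity
  have h1 := Wpa1.forall fun j => (hMS.2 j ℓ).1.wpa1_lt (ENNReal.ofReal_pos.2 he0)
  have h2 := Wpa1.forall fun j => (hMS.2 j ℓ).2.2.wpa1_lt (ENNReal.ofReal_pos.2 he0)
  refine ((hK.and h1).and h2).mono (Eventually.of_forall fun n ω hω => ?_)
  refine (T.lintegral_sum_sub_sq_le a (C.train W n ℓ ω) hω.1.1 (fun j => (hω.1.2 j).le)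
    (fun j => (hω.2 j).le) he0.le).trans (ENNReal.ofReal_le_ofReal ?_)
  have h3 : (2 * J * (J * (K ^ 2 + 1)) + 1) * e = η := by
    rw [he]
    field_simp
  nlinarith

/-- With the estimators held fixed, the mean of the error is of smaller order than `n^{-1/2}`. -/
theorem wpa1_sqrt_mul_abs_integral_momentError_lt {dη dmin s τ : ℝ} (hWD : T.WellDefined P W)
    (ℓ : Fin L) (a : Fin q) {K K' : ℝ} (hK' : 0 ≤ K')
    (hη : Wpa1 P fun n ω =>
      (∀ j, ‖D.h j (D.ι (T.ηhat n ℓ (C.train W n ℓ ω))) - D.h j (D.ι D.η₀)‖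
        ≤ K * (n : ℝ) ^ (τ - dη)) ∧
      ‖D.psiBar D.θ₀ (D.ι (T.ηhat n ℓ (C.train W n ℓ ω))) C.kappa₀
        - D.psiBar D.θ₀ (D.ι D.η₀) C.kappa₀‖ ≤ K * ((n : ℝ) ^ (τ - dη)) ^ 2)
    (hfit : Wpa1 P fun n ω => ∀ j, eLpNorm (fun z => C.fStar a j z
        - T.fit n ℓ a (C.train W n ℓ ω) j z) 2 (D.law j)
        ≤ ENNReal.ofReal (K' * ((n : ℝ) ^ (τ - s) + (n : ℝ) ^ (-dmin))))
    (hs : 1 / 2 + 2 * τ < dη + s) (hd : 1 / 2 + τ < dη + dmin) (hη2 : 1 / 4 + τ < dη)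
    {δ : ℝ} (hδ : 0 < δ) :
    Wpa1 P fun n ω =>
      √(n : ℝ) * |∫ w, T.momentError n ℓ a (C.train W n ℓ ω) w ∂D.F₀| < δ := by
  have hpow : ∀ x : ℝ, x < 0 → Tendsto (fun n : ℕ => (n : ℝ) ^ x) atTop (𝓝 0) := fun x hx => by
    have := (tendsto_rpow_neg_atTop (y := -x) (by linarith)).comp tendsto_natCast_atTop_atTop
    simpa [Function.comp_def] using this
  have hlim : Tendsto (fun n : ℕ => √(n : ℝ) * (J * (K * (n : ℝ) ^ (τ - dη) *
      (K' * ((n : ℝ) ^ (τ - s) + (n : ℝ) ^ (-dmin)))) + K * ((n : ℝ) ^ (τ - dη)) ^ 2))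
      atTop (𝓝 0) := by
    -- The three exponents belong to `η̂` error times Lasso error, `η̂` error times regressor error,
    -- and the squared `η̂` error; the three rate hypotheses make them negative.
    have h1 := (((hpow (1 / 2 + (τ - dη) + (τ - s)) (by linarith)).add
      (hpow (1 / 2 + (τ - dη) + -dmin) (by linarith))).const_mul (J * K * K')).add
      ((hpow (1 / 2 + (τ - dη) + (τ - dη)) (by linarith)).const_mul K)
    simp only [add_zero, mul_zero] at h1
    refine h1.congr' ?_
    filter_upwards [eventually_gt_atTop 0] with n hn
    have hn0 : (0 : ℝ) < n := by exact_mod_cast hn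
    rw [Real.rpow_add hn0 (1 / 2 + (τ - dη)) (τ - s), Real.rpow_add hn0 (1 / 2 + (τ - dη)) (-dmin),
      Real.rpow_add hn0 (1 / 2 + (τ - dη)) (τ - dη), Real.rpow_add hn0 (1 / 2) (τ - dη),
      Real.sqrt_eq_rpow]
    ring
  have hMemLp := Wpa1.forall fun j => hWD j ℓ
  refine ((hη.and hfit).and hMemLp).mono ?_
  filter_upwards [hlim.eventually_lt_const hδ] with n hn ω ⟨⟨⟨hh, hψ⟩, hfit⟩, hL⟩
  refine lt_of_le_of_lt (mul_le_mul_of_nonneg_left ?_ (Real.sqrt_nonneg _)) hn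
  refine (C.abs_integral_sum_sub_le (D.ι (T.ηhat n ℓ (C.train W n ℓ ω))) a
    (κ := fun j z => T.kappaHat n ℓ (C.train W n ℓ ω) j z a)
    (fun j => (C.memLp_f a j).sub ((hL j).1 a)) (by positivity) hh fun j => ?_).trans
    (add_le_add le_rfl hψ)
  rw [eLpNorm_congr_ae (T.kappaHat_sub_kappa₀_ae_eq a (C.train W n ℓ ω) j)]
  exact hfit j

end Estimators

/-- Convergence in measure to zero of a Euclidean vector follows from that of its coordinates. -/
theorem tendstoInMeasure_zero_of_wpa1_coordinates {Ω : Type*} [MeasurableSpace Ω] {P : Measure Ω}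
    {q : ℕ} {X : ℕ → Ω → EuclideanSpace ℝ (Fin q)}
    (h : ∀ a, ∀ δ : ℝ, 0 < δ → Wpa1 P fun n ω => |X n ω a| < δ) :
    TendstoInMeasure P X atTop fun _ => 0 := by
  refine tendstoInMeasure_of_ne_top fun ε hε hεtop => ?_
  have hε' : 0 < ε.toReal := ENNReal.toReal_pos hε.ne' hεtop
  set δ : ℝ := ε.toReal / (q + 1) with hδ
  have hδ0 : 0 < δ := by positivity
  have hall : Wpa1 P fun n ω => ¬ ε ≤ edist (X n ω) 0 := by
    refine (Wpa1.forall fun a => h a δ hδ0).mono (Eventually.of_forall fun n ω hω => ?_)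
    rw [not_le, edist_zero_right, ← ofReal_norm, ENNReal.ofReal_lt_iff_lt_toReal (norm_nonneg _)
      hεtop]
    have h1 : ‖X n ω‖ ≤ ∑ a, |X n ω a| := by
      have h2 : X n ω = ∑ a, X n ω a • EuclideanSpace.single a (1 : ℝ) := by
        ext b
        simp [Finset.sum_apply, Pi.single_apply]
      calc ‖X n ω‖ = ‖∑ a, X n ω a • EuclideanSpace.single a (1 : ℝ)‖ := by rw [← h2]
        _ ≤ ∑ a, ‖X n ω a • EuclideanSpace.single a (1 : ℝ)‖ := norm_sum_le _ _
        _ = _ := by simp [norm_smul]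
    calc ‖X n ω‖ ≤ ∑ _a : Fin q, δ := h1.trans (Finset.sum_le_sum fun a _ => (hω a).le)
      _ = q * δ := by simp
      _ < (q + 1) * δ := by linarith
      _ = ε.toReal := by rw [hδ]; field_simp
  simpa [Wpa1] using hall

theorem mainTheorem3
    {𝒲 𝒴 B E Ω : Type*} [MeasurableSpace 𝒲] [MeasurableSpace 𝒴] [MeasurableSpace Ω]
    [NormedAddCommGroup B] [InnerProductSpace ℝ B] [CompleteSpace B]
    [NormedAddCommGroup E] [NormedSpace ℝ E]
    {J : ℕ} {𝒵 : Fin J → Type*} [∀ j, MeasurableSpace (𝒵 j)] {p q L : ℕ}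
    (D : CMRModel 𝒲 𝒴 B E 𝒵 p) (C : Design D q L) (T : Estimators C)
    -- an i.i.d. sample with law `F₀`
    (P : Measure Ω) [IsProbabilityMeasure P] (W : ℕ → Ω → 𝒲)
    (hW : ∀ i, Measurable (W i)) (hWlaw : ∀ i, P.map (W i) = D.F₀) (hWind : iIndepFun W P)
    -- Fréchet differentiability of the conditional moments
    (hFrechet : D.FrechetCMR)
    -- regularity of the estimators
    (hMS : T.MeanSquare P W) (hWD : T.WellDefined P W)
    -- rates; `c > 0` is the (small) exponent entering `ε_n`
    (d : Fin J → ℝ) (dmin dη ξ c : ℝ)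
    (hd : ∀ j, 0 < d j ∧ d j < 1 / 2) (hdmin : IsLeast (Set.range d) dmin)
    (hdmin_mem : 1 / 4 < dmin ∧ dmin < 1 / 2) (hdη : 1 / 4 < dη ∧ dη < 1 / 2) (hξ : 0 < ξ)
    (hc : 0 < c)
    (hrate : 1 / 2 < (2 * ξ * (dmin - c) + dη * (2 * ξ + 1)) / (2 * ξ + 1))
    (hη : T.EtaRate P W dη)
    -- the debiased population moment is twice continuously Fréchet differentiable near `η₀`
    (hC2 : ContDiffAt ℝ 2 (fun e : E => D.psiBar D.θ₀ (D.ι e) C.kappa₀) D.η₀)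
    -- the estimated regressors and the dictionary
    (hMhat : T.BoundedMhat P W) (hreg : T.RegressorRate P W d)
    (hregIn : T.RegressorRateInSample P W d) (hr : C.DictionaryGrowth)
    -- conditions for the Lasso step
    (hM : C.BoundedM) (βbar : ∀ n, Fin q → C.Idx n → ℝ)
    (hsparse : C.ApproxSparse (C.eps c d) ξ βbar) (heigen : C.SparseEigen (C.eps c d))
    (hpen : C.PenaltyRate (C.eps c d)) (hβs : C.BetaStarBounded (C.eps c d) βbar) :
    TendstoInMeasure P
      (fun (n : ℕ) ω => √(n : ℝ) • T.psiHat W n D.θ₀ ω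
        - (√(n : ℝ))⁻¹ • ∑ i ∈ Finset.range n, D.psi D.θ₀ (D.ι D.η₀) C.kappa₀ (W i ω))
      atTop (fun _ => 0) := by
  set s : ℝ := (dmin - c) * (2 * ξ / (2 * ξ + 1)) with hs
  have hrate' : 1 / 2 < s + dη := by
    refine hrate.trans_eq ?_
    rw [hs]
    field_simp
  -- As `dη < 1/2`, the rate inequality forces `s > 0`, and hence `dmin - c > 0`.
  have hcd : c < dmin := by
    have h1 : 0 < s := by linarith [hdη.2]
    have h2 : 0 < 2 * ξ / (2 * ξ + 1) := by positivity
    have := pos_of_mul_pos_left h1 h2.le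
    linarith
  obtain ⟨bf, hf⟩ := T.ae_bounded_f P W hWD hMhat
  -- One small exponent `τ` pays for both the `O_p` constant of `η̂` and the gap between `λ_n` and
  -- `ε_n`, so it is counted twice in their product. Strictness of `dη > 1/4` and of the rate
  -- inequality leaves room for it.
  obtain ⟨τ, hτ0, hτ1, hτ2⟩ : ∃ τ : ℝ, 0 < τ ∧ 1 / 4 + τ < dη ∧ 1 / 2 + 2 * τ < dη + s := by
    refine ⟨min ((dη - 1 / 4) / 2) ((dη + s - 1 / 2) / 4), ?_, ?_, ?_⟩
    · exact lt_min (by linarith [hdη.1]) (by linarith)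
    · linarith [min_le_left ((dη - 1 / 4) / 2) ((dη + s - 1 / 2) / 4), hdη.1]
    · linarith [min_le_right ((dη - 1 / 4) / 2) ((dη + s - 1 / 2) / 4)]
  obtain ⟨Kη, -, hnuis⟩ := T.wpa1_nuisance_rates P W hτ0 (by linarith) hFrechet hη hC2
  obtain ⟨cM, hcM⟩ := hMhat
  have hfold : ∀ ℓ a, ∀ δ : ℝ, 0 < δ → Wpa1 P fun n ω =>
      |(√(n : ℝ))⁻¹ * ∑ i ∈ Finset.univ.filter (fun i => C.fold n i = ℓ),
        T.momentError n ℓ a (C.train W n ℓ ω) (W i ω)| < δ := by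
    intro ℓ a δ hδ
    obtain ⟨K, hK, hlasso⟩ := T.wpa1_lasso P W hW hWlaw hWind hdmin (by linarith [hdmin_mem.1])
      hdmin_mem.2 hξ hc hcd hreg hregIn hr hM hf hsparse heigen hpen hβs ℓ hτ0
    refine T.wpa1_abs_fold_sum_lt P W hW hWlaw hWind ℓ a (fun δ' hδ' => ?_) (fun η hη => ?_) hδ
    · exact T.wpa1_sqrt_mul_abs_integral_momentError_lt P W hWD ℓ a hK.le (hnuis ℓ)
        (hlasso.mono (Eventually.of_forall fun n ω hω => (hω a).2)) hτ2
        (by linarith [hdmin_mem.1]) hτ1 hδ'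
    · refine T.wpa1_lintegral_momentError_sq_le P W hMS ℓ a (K := bf + (∑ j, |cM j|) * K) ?_ hη
      refine (hlasso.and (Wpa1.forall fun j => hcM j ℓ)).mono
        (Eventually.of_forall fun n ω hω j => ?_)
      filter_upwards [hf a j, hω.2 j] with z hz hMz
      have h1 := T.abs_fit_le a (C.train W n ℓ ω) j z hMz
      have h2 : cM j * ∑ k, |T.βhat n ℓ a (C.train W n ℓ ω) k| ≤ (∑ j, |cM j|) * K := by
        refine mul_le_mul ((le_abs_self _).trans ?_) (hω.1 a).1
          (Finset.sum_nonneg fun _ _ => abs_nonneg _) (Finset.sum_nonneg fun _ _ => abs_nonneg _)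
        exact Finset.single_le_sum (f := fun j => |cM j|) (fun _ _ => abs_nonneg _)
          (Finset.mem_univ j)
      have h3 : T.kappaHat n ℓ (C.train W n ℓ ω) j z a
          = C.f a j z - T.fit n ℓ a (C.train W n ℓ ω) j z := rfl
      rw [h3]
      linarith [abs_sub (C.f a j z) (T.fit n ℓ a (C.train W n ℓ ω) j z)]
  refine tendstoInMeasure_zero_of_wpa1_coordinates fun a δ hδ => ?_
  have hδ' : 0 < δ / (L + 1) := by positivity
  refine (Wpa1.forall fun ℓ => hfold ℓ a _ hδ').mono (Eventually.of_forall fun n ω hω => ?_)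
  rw [T.sqrt_smul_psiHat_sub_apply]
  calc _ ≤ ∑ ℓ, |(√(n : ℝ))⁻¹ * ∑ i ∈ Finset.univ.filter (fun i => C.fold n i = ℓ),
        T.momentError n ℓ a (C.train W n ℓ ω) (W i ω)| := Finset.abs_sum_le_sum_abs _ _
    _ ≤ ∑ _ℓ : Fin L, δ / (L + 1) := Finset.sum_le_sum fun ℓ _ => (hω ℓ).le
    _ = L * (δ / (L + 1)) := by simp
    _ < (L + 1) * (δ / (L + 1)) := by linarith
    _ = δ := by field_simp

end
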